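/- **Problem.** Let $n\ge 1$ agents minimise $U(x)=u(x)+h(x)$, $u=\frac1n\sum_{i=1}^n u_i$, over $\mathcal X=\{x\in\mathbb R^d: g(x)\le 0\}$, where $u_i(x)=\mathbb E[f_i(x,\xi_i)]$, each $f_i(\cdot,s)$ is continuously differentiable, and $h,g:\mathbb R^d\to\mathbb R$ are convex. Put $U^\star=\inf_{\mathcal X}U$. **Assumptions.** (a) $U$ is bounded below on $\mathcal X$. (b) $\mathbb E[\nabla f_i(x,\xi_i)]=\nabla u_i(x)$. (c) $\mathbb E\|\nabla f_i(x,\xi_i)-\nabla u_i(x)\|^2\le\sigma_i^2$ for all $x$; $\bar\sigma^2=\sum_i\sigma_i^2$. (d) $\mathbb E\|\nabla f_i(x,\xi_i)-\nabla f_i(y,\xi_i)\|^2\le L^2\|x-y\|^2$ for all $x,y$. (e) Every surrogate $\hat f_i(\cdot,y,s)$ is differentiable and $\mu$-strongly convex ($\mu>0$), with $\nabla\hat f_i(y,y,s)=\nabla f_i(y,s)$ and $\|\nabla\hat f_i(x,y,s)-\nabla\hat f_i(y,y,s)\|\le L_s\|x-y\|$ (gradients in the first argument). (f) The matrix $W$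 is doubly stochastic, $W_{ii}>0$, and for $i\ne j$: $W_{ij}>0$ if $ij$ is an edge of a fixed connected undirected graph on the agents, and $W_{ij}=0$ otherwise; $\lambda_W$ is the spectral norm of $W-\frac1n\mathbf 1\mathbf 1^{\mathsf T}$. All samples below are independent, those of agent $i$ being distributed as $\xi_i$. **Algorithm (D-MSSCA, $T$ iterations, step sizes $\alpha,\beta$, initial batch $b_0$).** All agents start at the same $x_i^1=\bar x^1\in\mathcal X$, and $y_i^1=z_i^1=\frac1{b_0}\sum_{r=1}^{b_0}\nabla f_i(x_i^1,\xi_i^{1,r})$. For $t=1,\dots,T$, $$\hat x_i^t=\arg\min_{v\in\mathcal X}\ \tilde f_i^t(v)+\langle y_i^t-z_i^t,v-x_i^t\rangle+h(v),\qquad x_i^{t+1}=\sum_jW_{ij}\bigl(x_j^t+\alpha(\hat x_j^t-x_j^t)\bigr),$$ $$z_i^{t+1}=\nabla f_i(x_i^{t+1},\xi_i^{t+1})+(1-\beta)\bigl(z_i^t-\nabla f_i(x_i^t,\xi_i^{t+1})\bigr),\qquad y_i^{t+1}=\sum_jW_{ij}(y_j^t+z_j^{t+1}-z_j^t),$$ where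 $\tilde f_i^1(v)=\frac1{b_0}\sum_{r=1}^{b_0}\hat f_i(v,x_i^1,\xi_i^{1,r})$ and, for $t\ge2$, $\tilde f_i^t(v)=\hat f_i(v,x_i^t,\xi_i^t)+(1-\beta)\langle z_i^{t-1}-\nabla f_i(x_i^{t-1},\xi_i^t),v-x_i^t\rangle$. The agents together make $n(b_0+2T)$ stochastic first-order oracle calls. The run reaches an $\epsilon$-KKT point if there are random vectors $\hat w_i^t\in\partial(h+\mathbb 1_{\mathcal X})(\hat x_i^t)$, where $\mathbb 1_{\mathcal X}$ is $0$ on $\mathcal X$ and $+\infty$ elsewhere, with mean-squared stationary gap $$\frac1n\sum_{i=1}^n\frac1T\sum_{t=1}^T\mathbb E\bigl\|\nabla u(\hat x_i^t)+\hat w_i^t\bigr\|^2\le\epsilon .$$ **Statement.** Fix $n,L,L_s,\mu,\lambda_W$, upper bounds $V,B,\Gamma$ for $\bar\sigma^2$, $U(\bar x^1)-U^\star$ and $\sum_i\|\nabla u_i(\bar x^1)\|^2$, and constants $a_1,k_1,b_1>0$ and $a_2,k_2,b_2$. There are constants $c,C>0$, depending only on these numbers, such that the following holds for every $\epsilon\in(0,1]$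 and $T=\lceil c\,\epsilon^{-3/2}\rceil$. If the parameters are of the orders $$a_1T^{-1/3}\le\alpha\le a_2T^{-1/3},\qquad k_1T^{-2/3}\le\beta\le k_2T^{-2/3},\qquad b_1T^{1/3}\le b_0\le b_2T^{1/3},$$ and satisfy $$108\,L^2\Bigl(1+\frac{8\lambda_W^2}{(1-\lambda_W^2)^2}\Bigr)\alpha^2\le n\mu^2\beta$$ (for $\beta=\alpha^2$ this reads $\mu\ge\frac{6\sqrt3L}{\sqrt n}\bigl(1+\frac{8\lambda_W^2}{(1-\lambda_W^2)^2}\bigr)^{1/2}$), then every run of $T$ iterations of D-MSSCA, for every problem as above and in every dimension $d$, reaches an $\epsilon$-KKT point, and makes at most $C\epsilon^{-3/2}$ stochastic first-order oracle calls. -/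

import Mathlib

open MeasureTheory ProbabilityTheory
open scoped ENNReal

noncomputable section

namespace DMSSCA

/-- The decision space `ℝ^d` with its Euclidean norm. -/
abbrev Vec (d : ℕ) : Type := EuclideanSpace ℝ (Fin d)

/-! ### The problem -/

/-- Data of the decentralized stochastic composite problem
`min (1/n) ∑ i, u i x + h x` subject to `g x ≤ 0`, where `u i x = 𝔼[f i x ξ]`, `ξ ∼ law i`. -/
structure Problem (n d : ℕ) (Ξ : Type*) [MeasurableSpace Ξ] where
  /-- sampled local costs -/
  f : Fin n → Vec d → Ξ → ℝ
  /-- law of the data of each agent -/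
  law : Fin n → Measure Ξ
  /-- regularizer -/
  h : Vec d → ℝ
  /-- constraint function -/
  g : Vec d → ℝ

namespace Problem

variable {n d : ℕ} {Ξ : Type*} [MeasurableSpace Ξ] (P : Problem n d Ξ)

/-- The stochastic first-order oracle of agent `i`: the gradient of `f i · s` at `x`. -/
def gradf (i : Fin n) (x : Vec d) (s : Ξ) : Vec d := gradient (fun v => P.f i v s) x

/-- Local cost `u i x = 𝔼[f i x ξ]`. -/
def u (i : Fin n) (x : Vec d) : ℝ := ∫ s, P.f i x s ∂(P.law i)

/-- Smooth part of the objective, the average of the local costs. -/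
def uAvg (x : Vec d) : ℝ := (1 / (n : ℝ)) * ∑ i, P.u i x

/-- The objective `U`. -/
def U (x : Vec d) : ℝ := P.uAvg x + P.h x

/-- The feasible set. -/
def feasible : Set (Vec d) := {x | P.g x ≤ 0}

/-- The optimal value `U⋆`. -/
def optValue : ℝ := sInf (P.U '' P.feasible)

/-- Assumptions on the problem: `f` is continuously differentiable in `x`, `h` and `g` are convex,
the objective is bounded below, and the stochastic gradients are unbiased, have variance at most
`σ i ^ 2`, and are mean-squared `L`-smooth. -/
structure Assumptions (L : ℝ) (σ : Fin n → ℝ) : Prop where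
  prob : ∀ i, IsProbabilityMeasure (P.law i)
  f_smooth : ∀ i s, ContDiff ℝ 1 (fun x => P.f i x s)
  f_measurable : ∀ i x, Measurable (P.f i x)
  f_integrable : ∀ i x, Integrable (P.f i x) (P.law i)
  h_convex : ConvexOn ℝ Set.univ P.h
  g_convex : ConvexOn ℝ Set.univ P.g
  bddBelow : BddBelow (P.U '' P.feasible)
  unbiased : ∀ i x, HasGradientAt (P.u i) (∫ s, P.gradf i x s ∂(P.law i)) x
  variance : ∀ i x,
    ∫⁻ s, ‖P.gradf i x s - gradient (P.u i) x‖ₑ ^ 2 ∂(P.law i) ≤ ENNReal.ofReal (σ i ^ 2)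
  meanSquaredSmooth : ∀ i x y,
    ∫⁻ s, ‖P.gradf i x s - P.gradf i y s‖ₑ ^ 2 ∂(P.law i)
      ≤ ENNReal.ofReal (L ^ 2 * ‖x - y‖ ^ 2)

/-- Assumptions on the surrogates: `fhat i · y s` is a model of `f i · s` around the base point
`y`. It is differentiable and `μ`-strongly convex, its gradient at the base point is that of
`f i · s` (tangent matching), and it is `Ls`-smooth relative to the base point. -/
structure SurrogateAssumptions (fhat : Fin n → Vec d → Vec d → Ξ → ℝ) (μ Ls : ℝ) : Prop where
  measurable : ∀ i, Measurable (fun p : Vec d × Vec d × Ξ => fhat i p.1 p.2.1 p.2.2)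
  differentiable : ∀ i y s, Differentiable ℝ (fun x => fhat i x y s)
  strongConvex : ∀ i y s, StrongConvexOn Set.univ μ (fun x => fhat i x y s)
  tangent : ∀ i y s, gradient (fun x => fhat i x y s) y = P.gradf i y s
  smooth : ∀ i x y s,
    ‖gradient (fun v => fhat i v y s) x - gradient (fun v => fhat i v y s) y‖ ≤ Ls * ‖x - y‖

end Problem

/-! ### The network -/

/-- `W` is a doubly stochastic communication matrix of the connected undirected graph `G`, with
positive diagonal, and its off-diagonal support is exactly the edge set. -/
structure NetworkAssumptions {n : ℕ} (G : SimpleGraph (Fin n))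
    (W : Matrix (Fin n) (Fin n) ℝ) : Prop where
  connected : G.Connected
  doublyStochastic : W ∈ doublyStochastic ℝ (Fin n)
  diag_pos : ∀ i, 0 < W i i
  edge_pos : ∀ i j, G.Adj i j → 0 < W i j
  nonedge : ∀ i j, i ≠ j → ¬ G.Adj i j → W i j = 0

/-- The contraction factor `λ_W` of the network: the spectral norm of `W - (1/n) 𝟏 𝟏ᵀ`, which for
symmetric `W` is the largest absolute value of an eigenvalue of that matrix. -/
def lambdaW {n : ℕ} (W : Matrix (Fin n) (Fin n) ℝ) : ℝ :=
  ‖Matrix.toEuclideanCLM (n := Fin n) (𝕜 := ℝ) (W - Matrix.of fun _ _ => 1 / (n : ℝ))‖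

/-! ### The algorithm -/

section Algorithm

variable {n d : ℕ} {Ξ Ω : Type*} [MeasurableSpace Ξ] [MeasurableSpace Ω]

/-- Sampling: `ξ i t r` is the `r`-th sample that agent `i` can draw at time `t`. All samples are
independent, and those of agent `i` have law `P.law i`. -/
structure IsSampling (P : Problem n d Ξ) (Pr : Measure Ω) (ξ : Fin n → ℕ → ℕ → Ω → Ξ) : Prop where
  measurable : ∀ i t r, Measurable (ξ i t r)
  law_eq : ∀ i t r, Pr.map (ξ i t r) = P.law i
  indep : iIndepFun (fun p : Fin n × ℕ × ℕ => ξ p.1 p.2.1 p.2.2) Pr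

/-- The function `f̃` of agent `i` at time `t` along the outcome `ω`. At `t = 1` it is the surrogate
averaged over the initial batch (there is no momentum term yet). For `t ≥ 2` it is the surrogate at
the single sample of time `t`, plus the linear momentum correction. -/
def ftilde (P : Problem n d Ξ) (fhat : Fin n → Vec d → Vec d → Ξ → ℝ)
    (ξ : Fin n → ℕ → ℕ → Ω → Ξ) (β : ℝ) (b₀ : ℕ) (x z : Fin n → ℕ → Ω → Vec d)
    (i : Fin n) (t : ℕ) (ω : Ω) (v : Vec d) : ℝ :=
  if t = 1 then
    (b₀ : ℝ)⁻¹ * ∑ r ∈ Finset.range b₀, fhat i v (x i 1 ω) (ξ i 1 r ω)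
  else
    fhat i v (x i t ω) (ξ i t 0 ω)
      + (1 - β) * inner ℝ (z i (t - 1) ω - P.gradf i (x i (t - 1) ω) (ξ i t 0 ω)) (v - x i t ω)

/-- `x, xhat, z, y` are the iterates of `T` iterations of D-MSSCA with step sizes `α`, `β`, initial
batch size `b₀` and common starting point `x₁`. -/
structure IsRun (P : Problem n d Ξ) (fhat : Fin n → Vec d → Vec d → Ξ → ℝ)
    (W : Matrix (Fin n) (Fin n) ℝ) (ξ : Fin n → ℕ → ℕ → Ω → Ξ) (α β : ℝ) (b₀ T : ℕ) (x₁ : Vec d)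
    (x xhat z y : Fin n → ℕ → Ω → Vec d) : Prop where
  x_init : ∀ i ω, x i 1 ω = x₁
  z_init : ∀ i ω,
    z i 1 ω = (b₀ : ℝ)⁻¹ • ∑ r ∈ Finset.range b₀, P.gradf i (x i 1 ω) (ξ i 1 r ω)
  y_init : ∀ i ω, y i 1 ω = z i 1 ω
  /-- the minimizer of the local surrogate problem is feasible -/
  xhat_mem : ∀ i t ω, 1 ≤ t → t ≤ T → xhat i t ω ∈ P.feasible
  xhat_min : ∀ i t ω, 1 ≤ t → t ≤ T →
    IsMinOn (fun v => ftilde P fhat ξ β b₀ x z i t ω v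
        + inner ℝ (y i t ω - z i t ω) (v - x i t ω) + P.h v)
      P.feasible (xhat i t ω)
  x_step : ∀ i t ω, 1 ≤ t → t ≤ T →
    x i (t + 1) ω = ∑ j, W i j • (x j t ω + α • (xhat j t ω - x j t ω))
  z_step : ∀ i t ω, 1 ≤ t → t ≤ T →
    z i (t + 1) ω = P.gradf i (x i (t + 1) ω) (ξ i (t + 1) 0 ω)
      + (1 - β) • (z i t ω - P.gradf i (x i t ω) (ξ i (t + 1) 0 ω))
  y_step : ∀ i t ω, 1 ≤ t → t ≤ T →
    y i (t + 1) ω = ∑ j, W i j • (y j t ω + z j (t + 1) ω - z j t ω)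

/-- Number of stochastic first-order oracle calls of all agents in `T` iterations: each agent
makes `b₀` calls for the initial batch, and two calls per iteration (the gradients at the new and at
the previous iterate, both at the new sample). -/
def sfoCalls (n b₀ T : ℕ) : ℕ := ∑ _i : Fin n, (b₀ + ∑ _t ∈ Finset.Icc 1 T, 2)

/-! ### Approximate optimality -/

/-- The subdifferential at `a` of `h + 𝟙_X`, the function that is `h` on `X` and `+∞` elsewhere. -/
def subdiffOn (h : Vec d → ℝ) (X : Set (Vec d)) (a : Vec d) : Set (Vec d) :=
  {w | a ∈ X ∧ ∀ v ∈ X, h a + inner ℝ w (v - a) ≤ h v}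

/-- The mean-squared stationary gap
`(1/n) ∑ i, (1/T) ∑ t ∈ {1, …, T}, 𝔼 ‖∇u (xhat i t) + w i t‖²`. -/
def meanSquaredGap (P : Problem n d Ξ) (Pr : Measure Ω) (T : ℕ)
    (xhat w : Fin n → ℕ → Ω → Vec d) : ℝ≥0∞ :=
  (n : ℝ≥0∞)⁻¹ * ∑ i, (T : ℝ≥0∞)⁻¹ * ∑ t ∈ Finset.Icc 1 T,
    ∫⁻ ω, ‖gradient P.uAvg (xhat i t ω) + w i t ω‖ₑ ^ 2 ∂Pr

/-- The iterates `xhat` reach an `ε`-KKT point: with suitable random subgradients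
`w i t ∈ ∂(h + 𝟙_X)(xhat i t)`, the mean-squared stationary gap is at most `ε`. -/
def IsEpsKKT (P : Problem n d Ξ) (Pr : Measure Ω) (T : ℕ) (xhat : Fin n → ℕ → Ω → Vec d)
    (ε : ℝ) : Prop :=
  ∃ w : Fin n → ℕ → Ω → Vec d,
    (∀ i t, 1 ≤ t → t ≤ T → Measurable (w i t)) ∧
    (∀ i t ω, 1 ≤ t → t ≤ T → w i t ω ∈ subdiffOn P.h P.feasible (xhat i t ω)) ∧
    meanSquaredGap P Pr T xhat w ≤ ENNReal.ofReal ε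

end Algorithm

end DMSSCA

end

set_option linter.unusedSectionVars false

noncomputable section

namespace DMSSCA

/-! Write u for the average of the u_i, x̄_t for the average iterate and δ_i for the step from x_i^t
to the local minimiser. The potential n u(x̄_t) + ∑ h(x_i^t) decreases up to errors. Each agent
minimises a μ-strongly convex model whose gradient at x_i^t is y_i^t, so its step gains μ‖δ_i‖². The
price is the distance from y_i^t to ∇u(x̄_t), which splits into the consensus error, the averaged
momentum error and the disagreement of the y_i (`IsRun.gradAvg_sub_y`). Since the potential stays
above n U⋆, summation in time bounds the total squared step S by nB/α plus the totals of these three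
errors (`IsRun.sum_stepSq_le`).

The errors are in turn driven by the steps. Gossip contracts disagreement because λ_W < 1
(`NetworkAssumptions.lambdaW_lt_one`), so the consensus and tracking errors feed back only O(α²) S.
The momentum error contracts by 1 - β and receives innovations that are centred given the past.
Independence across agents divides the innovation of the averaged error by n²
(`IsRun.ex_gradErr_succ_le`), and its feedback is O(α²/(nβ)) S. For large T the O(α²) feedbacks are
negligible, but α²/β is of order one: the assumed inequality between α² and β is exactly what keeps
this feedback below μ/12, out of the available 3μ/8. `EnergyRecursion.sums_le_of_recursion` closes
the loop and leaves a budget of order T^(1/3).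

The negative model gradient at the minimiser is a subgradient of h + 𝟙_X, and the stationary gap it
produces is controlled by the same four totals (`IsRun.sum_gap_le`). The mean gap is thus O(T^(1/3)
/ T) = O(T^(-2/3)), which is O(ε) for T of order ε^(-3/2).

Second moments are taken in [0, ∞], so the recursions need no integrability; finiteness follows by a
separate induction (`EnergyRecursion.ne_top`). Conditioning on the past requires the iterates to be
measurable, hence a measurable argmin (`measurable_of_argmin`). -/

open Filter Topology

/-! ### First-order inequalities for convex and smooth functions -/

section Convex

variable {E : Type*} [NormedAddCommGroup E] [InnerProductSpace ℝ E] [CompleteSpace E]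

lemma tendsto_slope_of_hasGradientAt {φ : E → ℝ} {g a : E} (hφ : HasGradientAt φ g a) (p : E) :
    Tendsto (fun s : ℝ => s⁻¹ * (φ (a + s • p) - φ a)) (𝓝[>] 0) (𝓝 (inner ℝ g p)) := by
  have h1 : HasDerivAt (fun s : ℝ => φ (a + s • p)) (inner ℝ g p) 0 := by
    have h2 : HasDerivAt (fun s : ℝ => a + s • p) p 0 := by
      simpa using ((hasDerivAt_id (0 : ℝ)).smul_const p).const_add a
    have h3 : HasFDerivAt φ (InnerProductSpace.toDual ℝ E g) (a + (0 : ℝ) • p) := by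
      simpa using hφ.hasFDerivAt
    simpa [Function.comp_def] using h3.comp_hasDerivAt (0 : ℝ) h2
  have h4 := hasDerivAt_iff_tendsto_slope_zero.1 h1
  have h5 : (𝓝[>] (0 : ℝ)) ≤ 𝓝[≠] 0 := nhdsWithin_mono _ (fun x hx => ne_of_gt hx)
  simpa using h4.mono_left h5

/-- Apply strong convexity at v + s (w - v), divide by s and let s tend to 0 from the right. -/
lemma add_inner_add_sq_le_of_strongConvexOn {φ : E → ℝ} {g v : E} {m : ℝ}
    (hc : StrongConvexOn Set.univ m φ) (hφ : HasGradientAt φ g v) (w : E) :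
    φ v + inner ℝ g (w - v) + m / 2 * ‖w - v‖ ^ 2 ≤ φ w := by
  have h1 := tendsto_slope_of_hasGradientAt hφ (w - v)
  have h2 : Tendsto (fun s : ℝ => φ w - φ v - (1 - s) * (m / 2 * ‖w - v‖ ^ 2)) (𝓝[>] 0)
      (𝓝 (φ w - φ v - (1 - 0) * (m / 2 * ‖w - v‖ ^ 2))) :=
    Tendsto.mono_left (Continuous.tendsto (by fun_prop) 0) nhdsWithin_le_nhds
  have h3 : inner ℝ g (w - v) ≤ φ w - φ v - (1 - 0) * (m / 2 * ‖w - v‖ ^ 2) := by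
    refine le_of_tendsto_of_tendsto h1 h2 ?_
    filter_upwards [Ioo_mem_nhdsGT (zero_lt_one' ℝ)] with s hs
    have h4 := hc.2 (Set.mem_univ v) (Set.mem_univ w) (by linarith [hs.2] : 0 ≤ 1 - s) hs.1.le
      (by ring)
    have h5 : (1 - s) • v + s • w = v + s • (w - v) := by module
    rw [h5] at h4
    simp only [smul_eq_mul] at h4
    rw [norm_sub_rev v w] at h4
    rw [inv_mul_le_iff₀ hs.1]
    linarith
  linarith

/-- The minimiser is compared with the points of the segment towards v; convexity bounds h there,
and dividing by the length of the move leaves the directional derivative of φ. Convexity of φ plays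
no role. -/
lemma add_inner_neg_le_of_isMinOn {φ h : E → ℝ} {g a : E} {X : Set E} (hX : Convex ℝ X)
    (hh : ConvexOn ℝ Set.univ h) (hφ : HasGradientAt φ g a) (ha : a ∈ X)
    (hmin : IsMinOn (fun v => φ v + h v) X a) {v : E} (hv : v ∈ X) :
    h a + inner ℝ (-g) (v - a) ≤ h v := by
  have h1 := tendsto_slope_of_hasGradientAt hφ (v - a)
  have h2 : -(h v - h a) ≤ inner ℝ g (v - a) := by
    refine ge_of_tendsto h1 ?_
    filter_upwards [Ioo_mem_nhdsGT (zero_lt_one' ℝ)] with s hs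
    have h5 : (1 - s) • a + s • v = a + s • (v - a) := by module
    have h6 : a + s • (v - a) ∈ X := by
      rw [← h5]
      exact hX ha hv (by linarith [hs.2]) hs.1.le (by ring)
    have h4 := hh.2 (Set.mem_univ a) (Set.mem_univ v) (by linarith [hs.2] : 0 ≤ 1 - s) hs.1.le
      (by ring)
    rw [h5] at h4
    simp only [smul_eq_mul] at h4
    have h7 := isMinOn_iff.1 hmin _ h6
    rw [le_inv_mul_iff₀ hs.1]
    linarith
  rw [inner_neg_left]
  linarith

/-- Mean value inequality for u minus its linearisation at x. It gives L instead of the sharp L / 2,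
a loss that the later requirement L α ≤ μ / 8 accounts for. -/
lemma le_add_inner_add_sq_of_lipschitz_gradient {u : E → ℝ} {u' : E → E} {L : ℝ} (hL : 0 ≤ L)
    (hu : ∀ x, HasGradientAt u (u' x) x) (hlip : ∀ x y, ‖u' x - u' y‖ ≤ L * ‖x - y‖) (x y : E) :
    u y ≤ u x + inner ℝ (u' x) (y - x) + L * ‖y - x‖ ^ 2 := by
  have h1 := (convex_segment x y).norm_image_sub_le_of_norm_hasFDerivWithin_le'
    (f := u) (f' := fun z => InnerProductSpace.toDual ℝ E (u' z))
    (φ := InnerProductSpace.toDual ℝ E (u' x)) (C := L * ‖y - x‖)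
    (fun z _ => (hu z).hasFDerivAt.hasFDerivWithinAt)
    (fun z hz => by
      rw [← map_sub, LinearIsometryEquiv.norm_map]
      refine (hlip z x).trans (mul_le_mul_of_nonneg_left ?_ hL)
      obtain ⟨a, b, ha, hb, hab, rfl⟩ := hz
      have h5 : a • x + b • y - x = b • (y - x) := by
        rw [show a = 1 - b by linarith]; module
      rw [h5, norm_smul, Real.norm_of_nonneg hb]
      exact mul_le_of_le_one_left (norm_nonneg _) (by linarith))
    (left_mem_segment ℝ x y) (right_mem_segment ℝ x y)
  have h2 := (le_abs_self _).trans h1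
  simp only [InnerProductSpace.toDual_apply_apply] at h2
  nlinarith

end Convex

/-! ### Measurable argmins and gradients -/

section Measurability

/-- The best point among the first k members of a dense sequence of X is measurable in ω. Its value
tends to the minimum, and quadratic growth turns convergence of values into convergence of points,
so the minimiser is a pointwise limit of measurable maps. -/
lemma measurable_of_argmin {E Ω : Type*} {_ : MeasurableSpace Ω} [NormedAddCommGroup E]
    [SecondCountableTopology E] [MeasurableSpace E] [BorelSpace E] {X : Set E}
    {F : Ω → E → ℝ} {a : Ω → E} {m : ℝ} (hm : 0 < m)
    (hF : ∀ v, Measurable fun ω => F ω v) (hc : ∀ ω, Continuous (F ω))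
    (ha : ∀ ω, a ω ∈ X) (hX : X.Nonempty)
    (hgrowth : ∀ ω, ∀ v ∈ X, F ω (a ω) + m * ‖v - a ω‖ ^ 2 ≤ F ω v) : Measurable a := by
  classical
  have : Nonempty X := hX.to_subtype
  let q : ℕ → E := fun k => (TopologicalSpace.denseSeq X k : E)
  -- `r k` carries the best of `q 0, …, q k` together with its value; the strict comparison keeps
  -- the earlier point in a tie.
  let r : ℕ → Ω → E × ℝ := fun k => Nat.rec (fun ω => (q 0, F ω (q 0)))
    (fun k p ω => if F ω (q (k + 1)) < (p ω).2 then (q (k + 1), F ω (q (k + 1))) else p ω) k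
  have hr0 : ∀ ω, r 0 ω = (q 0, F ω (q 0)) := fun ω => rfl
  have hr1 : ∀ k ω, r (k + 1) ω =
      if F ω (q (k + 1)) < (r k ω).2 then (q (k + 1), F ω (q (k + 1))) else r k ω :=
    fun k ω => rfl
  have hmeas : ∀ k, Measurable (r k) := by
    intro k
    induction k with
    | zero => exact measurable_const.prodMk (hF _)
    | succ k ih =>
      have : r (k + 1) = fun ω => if F ω (q (k + 1)) < (r k ω).2 then
          (q (k + 1), F ω (q (k + 1))) else r k ω := funext (hr1 k)
      rw [this]
      exact Measurable.ite (measurableSet_lt (hF _) ih.snd) (measurable_const.prodMk (hF _)) ih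
  have hval : ∀ k ω, (r k ω).1 ∈ X ∧ (r k ω).2 = F ω (r k ω).1 := by
    intro k ω
    induction k with
    | zero => exact ⟨(TopologicalSpace.denseSeq X 0).2, rfl⟩
    | succ k ih =>
      rw [hr1]
      split_ifs
      · exact ⟨(TopologicalSpace.denseSeq X (k + 1)).2, rfl⟩
      · exact ih
  have hle : ∀ k ω j, j ≤ k → (r k ω).2 ≤ F ω (q j) := by
    intro k ω
    induction k with
    | zero => intro j hj; obtain rfl : j = 0 := by omega
              exact le_rfl
    | succ k ih =>
      intro j hj
      rw [hr1]
      rcases Nat.lt_or_ge j (k + 1) with hjk | hjk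
      · have := ih j (by omega)
        split_ifs with h
        · exact h.le.trans this
        · exact this
      · obtain rfl : j = k + 1 := by omega
        split_ifs with h
        · exact le_rfl
        · exact not_lt.1 h
  refine measurable_of_tendsto_metrizable (f := fun k ω => (r k ω).1)
    (fun k => (hmeas k).fst) ?_
  rw [tendsto_pi_nhds]
  intro ω
  rw [Metric.tendsto_atTop]
  intro ε hε
  -- The tolerance m ε² is what the growth condition converts into distance ε.
  have hopen : IsOpen {v : X | F ω v < F ω (a ω) + m * ε ^ 2} :=
    isOpen_lt ((hc ω).comp continuous_subtype_val) continuous_const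
  obtain ⟨v, hv, j, rfl⟩ := (TopologicalSpace.denseRange_denseSeq X).inter_open_nonempty _ hopen
    ⟨⟨a ω, ha ω⟩, by simp only [Set.mem_ofPred_eq, lt_add_iff_pos_right]; positivity⟩
  refine ⟨j, fun k hk => ?_⟩
  have h1 := hgrowth ω _ (hval k ω).1
  have h2 : F ω (q j) < F ω (a ω) + m * ε ^ 2 := hv
  have h3 := hle k ω j hk
  rw [(hval k ω).2] at h3
  rw [dist_eq_norm]
  have h4 : m * ‖(r k ω).1 - a ω‖ ^ 2 < m * ε ^ 2 := by linarith
  exact lt_of_pow_lt_pow_left₀ 2 hε.le (lt_of_mul_lt_mul_left h4 hm.le)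

/-- Each directional derivative is a limit of difference quotients along 1 / (k + 1), and the
gradient is recovered from its coordinates. The base point may move with s, as the surrogate
gradients require. -/
lemma measurable_of_hasGradientAt {d : ℕ} {S : Type*} {_ : MeasurableSpace S}
    {F : S → Vec d → ℝ} {G : S → Vec d} {a : S → Vec d}
    (hF : ∀ p : Vec d, Measurable fun s => F s (a s + p))
    (hG : ∀ s, HasGradientAt (F s) (G s) (a s)) : Measurable G := by
  have h1 : ∀ p : Vec d, Measurable fun s => inner ℝ (G s) p := by
    intro p
    have hlim : Tendsto (fun k : ℕ => ((k : ℝ) + 1)⁻¹) atTop (𝓝[>] (0 : ℝ)) :=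
      tendsto_nhdsWithin_iff.2 ⟨by simpa using tendsto_one_div_add_atTop_nhds_zero_nat (𝕜 := ℝ),
        Eventually.of_forall fun k => by simp only [Set.mem_Ioi]; positivity⟩
    refine measurable_of_tendsto_metrizable
      (f := fun (k : ℕ) s => ((((k : ℝ) + 1)⁻¹)⁻¹ *
        (F s (a s + ((k : ℝ) + 1)⁻¹ • p) - F s (a s)))) (fun k => ?_) ?_
    · have h0 := hF 0
      simp only [add_zero] at h0
      exact measurable_const.mul ((hF _).sub h0)
    · rw [tendsto_pi_nhds]
      intro s
      exact (tendsto_slope_of_hasGradientAt (hG s) p).comp hlim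
  have h2 : G = fun s => ∑ k, (inner ℝ (EuclideanSpace.basisFun (Fin d) ℝ k) (G s)) •
      EuclideanSpace.basisFun (Fin d) ℝ k := by
    funext s
    exact ((EuclideanSpace.basisFun (Fin d) ℝ).sum_repr' (G s)).symm
  rw [h2]
  refine Finset.measurable_sum _ fun k _ => Measurable.smul_const ?_ _
  have h3 := h1 (EuclideanSpace.basisFun (Fin d) ℝ k)
  simp only [fun s => real_inner_comm (EuclideanSpace.basisFun (Fin d) ℝ k) (G s)] at h3 ⊢
  exact h3

end Measurability

end DMSSCA

namespace DMSSCA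

/-! ### Averages, disagreement and contraction by gossip -/

section Network

variable {n : ℕ}

/-- The average of a finite family of vectors. -/
def avg {E : Type*} [AddCommGroup E] [Module ℝ E] (a : Fin n → E) : E := (n : ℝ)⁻¹ • ∑ i, a i

/-- The sum of the squared distances of a finite family of vectors to its average. -/
def disp {E : Type*} [NormedAddCommGroup E] [NormedSpace ℝ E] (a : Fin n → E) : ℝ :=
  ∑ i, ‖a i - avg a‖ ^ 2

lemma disp_nonneg {E : Type*} [NormedAddCommGroup E] [NormedSpace ℝ E] (a : Fin n → E) :
    0 ≤ disp a := Finset.sum_nonneg fun _ _ => by positivity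

lemma toEuclideanCLM_sub_average_apply (W : Matrix (Fin n) (Fin n) ℝ) (p : Fin n → ℝ) (i : Fin n) :
    (Matrix.toEuclideanCLM (n := Fin n) (𝕜 := ℝ) (W - Matrix.of fun _ _ => 1 / (n : ℝ)))
      (WithLp.toLp 2 p) i = ∑ j, W i j * p j - avg p := by
  rw [Matrix.toEuclideanCLM_toLp]
  simp [Matrix.mulVec, dotProduct, sub_mul, Finset.sum_sub_distrib, avg, Finset.mul_sum]

lemma lambdaW_nonneg (W : Matrix (Fin n) (Fin n) ℝ) : 0 ≤ lambdaW W := norm_nonneg _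

lemma sum_sq_sub_avg_le_lambdaW (W : Matrix (Fin n) (Fin n) ℝ) (p : Fin n → ℝ) :
    ∑ i, (∑ j, W i j * p j - avg p) ^ 2 ≤ lambdaW W ^ 2 * ∑ i, p i ^ 2 := by
  have h1 := (Matrix.toEuclideanCLM (n := Fin n) (𝕜 := ℝ)
    (W - Matrix.of fun _ _ => 1 / (n : ℝ))).le_opNorm (WithLp.toLp 2 p)
  have h2 := pow_le_pow_left₀ (norm_nonneg _) h1 2
  rw [mul_pow, EuclideanSpace.real_norm_sq_eq, EuclideanSpace.real_norm_sq_eq] at h2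
  simp only [toEuclideanCLM_sub_average_apply] at h2
  exact h2

lemma sum_avg_eq {E : Type*} [AddCommGroup E] [Module ℝ E] (hn : n ≠ 0) (a : Fin n → E) :
    ∑ i, (a i - avg a) = 0 := by
  have : (n : ℝ) ≠ 0 := by exact_mod_cast hn
  rw [Finset.sum_sub_distrib]
  simp [avg, ← Nat.cast_smul_eq_nsmul ℝ, smul_smul, this]

lemma avg_sub_avg {E : Type*} [AddCommGroup E] [Module ℝ E] (hn : n ≠ 0) (a : Fin n → E) :
    avg (fun i => a i - avg a) = 0 := by
  rw [avg, sum_avg_eq hn, smul_zero]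

lemma avg_add {E : Type*} [AddCommGroup E] [Module ℝ E] (a b : Fin n → E) :
    avg (fun i => a i + b i) = avg a + avg b := by
  simp [avg, Finset.sum_add_distrib]

lemma avg_sub {E : Type*} [AddCommGroup E] [Module ℝ E] (a b : Fin n → E) :
    avg (fun i => a i - b i) = avg a - avg b := by
  simp [avg, Finset.sum_sub_distrib, smul_sub]

lemma avg_smul {E : Type*} [AddCommGroup E] [Module ℝ E] (c : ℝ) (a : Fin n → E) :
    avg (fun i => c • a i) = c • avg a := by
  simp [avg, ← Finset.smul_sum, smul_comm c]

lemma avg_const {E : Type*} [AddCommGroup E] [Module ℝ E] (hn : n ≠ 0) (v : E) :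
    avg (fun _ : Fin n => v) = v := by
  have : (n : ℝ) ≠ 0 := by exact_mod_cast hn
  simp [avg, ← Nat.cast_smul_eq_nsmul ℝ, smul_smul, this]

lemma avg_mix {E : Type*} [AddCommGroup E] [Module ℝ E] {W : Matrix (Fin n) (Fin n) ℝ}
    (hW : W ∈ doublyStochastic ℝ (Fin n)) (a : Fin n → E) :
    avg (fun i => ∑ j, W i j • a j) = avg a := by
  rw [avg, avg, Finset.sum_comm]
  congr 1
  refine Finset.sum_congr rfl fun j _ => ?_
  rw [← Finset.sum_smul, sum_col_of_mem_doublyStochastic hW, one_smul]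

lemma sum_smul_sub_avg {E : Type*} [AddCommGroup E] [Module ℝ E] {W : Matrix (Fin n) (Fin n) ℝ}
    (hW : W ∈ doublyStochastic ℝ (Fin n)) (a : Fin n → E) (i : Fin n) (c : E) :
    ∑ j, W i j • (a j - c) = ∑ j, W i j • a j - c := by
  simp only [smul_sub, Finset.sum_sub_distrib]
  rw [← Finset.sum_smul, sum_row_of_mem_doublyStochastic hW, one_smul]

lemma NetworkAssumptions.pos {G : SimpleGraph (Fin n)} {W : Matrix (Fin n) (Fin n) ℝ}
    (h : NetworkAssumptions G W) : n ≠ 0 := by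
  rintro rfl
  exact (h.connected.nonempty).elim fun i => i.elim0

/-- Symmetry of W is not assumed, so no eigenvalues are used. If the norm were at least 1, a centred
vector p would satisfy ‖W p‖ ≥ ‖p‖. The defect ‖p‖² - ‖W p‖² is a sum of weighted variances along
the rows, so p would be constant on the support of each row, hence along edges, hence everywhere by
connectedness; being centred, p would vanish. -/
lemma NetworkAssumptions.lambdaW_lt_one {G : SimpleGraph (Fin n)} {W : Matrix (Fin n) (Fin n) ℝ}
    (h : NetworkAssumptions G W) : lambdaW W < 1 := by
  have hn := h.pos
  have hW := h.doublyStochastic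
  by_contra! hcon
  have : Nontrivial (EuclideanSpace ℝ (Fin n)) := by
    have : Nonempty (Fin n) := ⟨⟨0, Nat.pos_of_ne_zero hn⟩⟩
    infer_instance
  -- By compactness of the sphere the operator norm is attained at a unit vector.
  obtain ⟨v, hv, hmax⟩ := (isCompact_sphere (0 : EuclideanSpace ℝ (Fin n)) 1).exists_isMaxOn
    (NormedSpace.sphere_nonempty.2 zero_le_one)
    ((Matrix.toEuclideanCLM (n := Fin n) (𝕜 := ℝ)
      (W - Matrix.of fun _ _ => 1 / (n : ℝ))).continuous.norm.continuousOn)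
  have hv1 : ‖v‖ = 1 := by simpa using hv
  have hbig : 1 ≤ ‖(Matrix.toEuclideanCLM (n := Fin n) (𝕜 := ℝ)
      (W - Matrix.of fun _ _ => 1 / (n : ℝ))) v‖ := by
    refine hcon.trans (ContinuousLinearMap.opNorm_le_of_unit_norm (norm_nonneg _) fun w hw => ?_)
    exact isMaxOn_iff.1 hmax w (by simpa using hw)
  set p : Fin n → ℝ := fun i => v i - avg v.ofLp with hp
  have hnorm : ∑ i, v i ^ 2 = 1 := by
    rw [← EuclideanSpace.real_norm_sq_eq, hv1, one_pow]
  have hps : ∑ i, p i = 0 := sum_avg_eq hn v.ofLp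
  have hpn : ∑ i, p i ^ 2 ≤ 1 := by
    have h1 : ∑ i, v i ^ 2 = ∑ i, (p i ^ 2 + 2 * avg v.ofLp * p i + avg v.ofLp ^ 2) :=
      Finset.sum_congr rfl fun i _ => by simp only [hp]; ring
    rw [Finset.sum_add_distrib, Finset.sum_add_distrib, ← Finset.mul_sum, hps] at h1
    have h2 : 0 ≤ ∑ _i : Fin n, avg v.ofLp ^ 2 := Finset.sum_nonneg fun _ _ => sq_nonneg _
    linarith
  -- Unit row sums turn (W - (1/n) 𝟏 𝟏ᵀ) v into W applied to the centred vector.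
  have hWp : 1 ≤ ∑ i, (∑ j, W i j * p j) ^ 2 := by
    have h1 := pow_le_pow_left₀ zero_le_one hbig 2
    rw [one_pow, EuclideanSpace.real_norm_sq_eq] at h1
    refine h1.trans (le_of_eq (Finset.sum_congr rfl fun i _ => ?_))
    have h2 := toEuclideanCLM_sub_average_apply W v.ofLp i
    rw [WithLp.toLp_ofLp] at h2
    rw [h2]
    have h3 := sum_smul_sub_avg hW v.ofLp i (avg v.ofLp)
    simp only [smul_eq_mul] at h3
    rw [← h3]
  -- Row i of W is a probability vector, so the inner sum is a variance; unit column sums give ∑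
  -- p_j² after summation over i.
  have hvar : ∑ i, ∑ j, W i j * (p j - ∑ k, W i k * p k) ^ 2
      = ∑ j, p j ^ 2 - ∑ i, (∑ j, W i j * p j) ^ 2 := by
    have h1 : ∀ i, ∑ j, W i j * (p j - ∑ k, W i k * p k) ^ 2
        = ∑ j, W i j * p j ^ 2 - (∑ j, W i j * p j) ^ 2 := by
      intro i
      set c := ∑ k, W i k * p k with hc
      have : ∀ j, W i j * (p j - c) ^ 2 = W i j * p j ^ 2 - 2 * c * (W i j * p j) + c ^ 2 * W i j :=
        fun j => by ring
      simp only [this]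
      rw [Finset.sum_add_distrib, Finset.sum_sub_distrib, ← Finset.mul_sum, ← Finset.mul_sum,
        sum_row_of_mem_doublyStochastic hW, ← hc]
      ring
    simp only [h1]
    rw [Finset.sum_sub_distrib, Finset.sum_comm]
    congr 1
    refine Finset.sum_congr rfl fun j _ => ?_
    rw [← Finset.sum_mul, sum_col_of_mem_doublyStochastic hW, one_mul]
  have hzero : ∑ i, ∑ j, W i j * (p j - ∑ k, W i k * p k) ^ 2 = 0 :=
    le_antisymm (by rw [hvar]; linarith)
      (Finset.sum_nonneg fun i _ => Finset.sum_nonneg fun j _ =>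
        mul_nonneg (nonneg_of_mem_doublyStochastic hW) (sq_nonneg _))
  have heq : ∀ i j, 0 < W i j → p j = ∑ k, W i k * p k := by
    intro i j hij
    have h1 := (Finset.sum_eq_zero_iff_of_nonneg fun i _ => Finset.sum_nonneg fun j _ =>
      mul_nonneg (nonneg_of_mem_doublyStochastic hW) (sq_nonneg _)).1 hzero i (Finset.mem_univ i)
    have h2 := (Finset.sum_eq_zero_iff_of_nonneg fun j _ =>
      mul_nonneg (nonneg_of_mem_doublyStochastic hW) (sq_nonneg _)).1 h1 j (Finset.mem_univ j)
    rcases mul_eq_zero.1 h2 with h3 | h3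
    · exact absurd h3 hij.ne'
    · exact sub_eq_zero.1 (pow_eq_zero_iff two_ne_zero |>.1 h3)
  -- The positive diagonal identifies p i with the mean of row i, and the edge weight identifies p j
  -- with the same mean.
  have hadj : ∀ i j, G.Adj i j → p i = p j := fun i j hij => by
    rw [heq i i (h.diag_pos i), heq i j (h.edge_pos i j hij)]
  have hconst : ∀ i j, p i = p j := by
    intro i j
    obtain ⟨w⟩ := h.connected.preconnected i j
    induction w with
    | nil => rfl
    | cons hab _ ih => exact (hadj _ _ hab).trans ih
  have hp0 : ∀ i, p i = 0 := by
    intro i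
    have h1 : ∑ j, p j = n * p i := by
      rw [Finset.sum_congr rfl fun j _ => hconst j i]; simp
    rw [hps] at h1
    exact (mul_eq_zero.1 h1.symm).resolve_left (by exact_mod_cast hn)
  simp [hp0] at hWp
  linarith

variable {d : ℕ}

lemma avg_apply (a : Fin n → Vec d) (k : Fin d) : avg a k = avg (fun i => a i k) := by
  simp [avg]

/-- Apply the operator bound to each coordinate of the centred family; centring removes the rank-one
part. -/
lemma disp_mix_le (hn : n ≠ 0) {W : Matrix (Fin n) (Fin n) ℝ}
    (hW : W ∈ doublyStochastic ℝ (Fin n)) (a : Fin n → Vec d) :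
    disp (fun i => ∑ j, W i j • a j) ≤ lambdaW W ^ 2 * disp a := by
  rw [disp, disp, avg_mix hW]
  simp only [EuclideanSpace.real_norm_sq_eq]
  rw [Finset.sum_comm, Finset.sum_comm (f := fun i k => (a i - avg a).ofLp k ^ 2), Finset.mul_sum]
  refine Finset.sum_le_sum fun k _ => ?_
  have h1 := sum_sq_sub_avg_le_lambdaW W (fun i => (a i - avg a).ofLp k)
  refine le_trans (le_of_eq (Finset.sum_congr rfl fun i _ => ?_)) h1
  rw [← avg_apply (fun i => a i - avg a), avg_sub_avg hn, ← sum_smul_sub_avg hW]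
  simp

lemma norm_sum_sq_le {E : Type*} [SeminormedAddCommGroup E] (a : Fin n → E) :
    ‖∑ i, a i‖ ^ 2 ≤ n * ∑ i, ‖a i‖ ^ 2 := by
  refine (pow_le_pow_left₀ (norm_nonneg _) (norm_sum_le _ _) 2).trans ?_
  simpa using sq_sum_le_card_mul_sum_sq (s := Finset.univ) (f := fun i => ‖a i‖)

lemma norm_avg_sq_le {E : Type*} [NormedAddCommGroup E] [NormedSpace ℝ E] (hn : n ≠ 0)
    (a : Fin n → E) : n * ‖avg a‖ ^ 2 ≤ ∑ i, ‖a i‖ ^ 2 := by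
  have hn' : (0 : ℝ) < n := by exact_mod_cast Nat.pos_of_ne_zero hn
  rw [avg, norm_smul, mul_pow, Real.norm_of_nonneg (by positivity)]
  calc (n : ℝ) * ((n : ℝ)⁻¹ ^ 2 * ‖∑ i, a i‖ ^ 2)
      ≤ n * ((n : ℝ)⁻¹ ^ 2 * (n * ∑ i, ‖a i‖ ^ 2)) := by
        gcongr; exact norm_sum_sq_le a
    _ = ∑ i, ‖a i‖ ^ 2 := by field_simp

lemma disp_le_sum_sq {E : Type*} [NormedAddCommGroup E] [InnerProductSpace ℝ E] (hn : n ≠ 0)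
    (a : Fin n → E) : disp a ≤ ∑ i, ‖a i‖ ^ 2 := by
  have h1 : ∀ i, ‖a i - avg a‖ ^ 2
      = ‖a i‖ ^ 2 - 2 * inner ℝ (a i - avg a) (avg a) - ‖avg a‖ ^ 2 := by
    intro i
    rw [norm_sub_sq_real, inner_sub_left, real_inner_self_eq_norm_sq]; ring
  rw [disp]
  simp only [h1]
  rw [Finset.sum_sub_distrib, Finset.sum_sub_distrib, ← Finset.mul_sum, ← sum_inner,
    sum_avg_eq hn, inner_zero_left]
  have h2 : 0 ≤ ∑ _i : Fin n, ‖avg a‖ ^ 2 := Finset.sum_nonneg fun _ _ => sq_nonneg _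
  linarith

lemma norm_add_sq_le {E : Type*} [SeminormedAddCommGroup E] {η : ℝ} (hη : 0 < η) (a b : E) :
    ‖a + b‖ ^ 2 ≤ (1 + η) * ‖a‖ ^ 2 + (1 + η⁻¹) * ‖b‖ ^ 2 := by
  have h1 := pow_le_pow_left₀ (norm_nonneg _) (norm_add_le a b) 2
  have h2 : 0 ≤ η⁻¹ * (η * ‖a‖ - ‖b‖) ^ 2 := by positivity
  have h3 : η⁻¹ * (η * ‖a‖ - ‖b‖) ^ 2 = η * ‖a‖ ^ 2 - 2 * (‖a‖ * ‖b‖) + η⁻¹ * ‖b‖ ^ 2 := by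
    field_simp
    ring
  nlinarith

lemma disp_add_le {E : Type*} [NormedAddCommGroup E] [InnerProductSpace ℝ E] (hn : n ≠ 0)
    {η : ℝ} (hη : 0 < η) (a b : Fin n → E) :
    disp (fun i => a i + b i) ≤ (1 + η) * disp a + (1 + η⁻¹) * ∑ i, ‖b i‖ ^ 2 := by
  have h1 : disp (fun i => a i + b i) ≤ (1 + η) * disp a + (1 + η⁻¹) * disp b := by
    simp only [disp, avg_add, Finset.mul_sum, ← Finset.sum_add_distrib]
    refine Finset.sum_le_sum fun i _ => ?_
    rw [add_sub_add_comm]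
    exact norm_add_sq_le hη _ _
  have h2 := mul_le_mul_of_nonneg_left (disp_le_sum_sq hn b) (by positivity : 0 ≤ 1 + η⁻¹)
  linarith

/-- One gossip round after a perturbation, with a rate strictly better than one. -/
lemma disp_mix_add_le (hn : n ≠ 0) {W : Matrix (Fin n) (Fin n) ℝ}
    (hW : W ∈ doublyStochastic ℝ (Fin n)) (hlam : lambdaW W < 1) (a b : Fin n → Vec d) :
    disp (fun i => ∑ j, W i j • (a j + b j)) ≤ (1 + lambdaW W ^ 2) / 2 * disp a
      + lambdaW W ^ 2 * (1 + lambdaW W ^ 2) / (1 - lambdaW W ^ 2) * ∑ i, ‖b i‖ ^ 2 := by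
  have h0 := lambdaW_nonneg W
  have h1 := disp_mix_le hn hW (fun i => a i + b i)
  -- The Young parameter below divides by λ_W², so λ_W = 0 is treated apart.
  rcases h0.eq_or_lt with h2 | h2
  · rw [← h2] at h1 ⊢
    have := disp_nonneg a
    norm_num at h1 ⊢
    linarith
  set l := lambdaW W
  have hl : 0 < 1 - l ^ 2 := by nlinarith
  -- This η makes λ_W² (1 + η) the midpoint (1 + λ_W²) / 2 of λ_W² and 1.
  have h3 := disp_add_le hn (η := (1 - l ^ 2) / (2 * l ^ 2)) (by positivity) a b
  have h4 := h1.trans (mul_le_mul_of_nonneg_left h3 (sq_nonneg l))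
  refine h4.trans (le_of_eq ?_)
  field_simp
  ring

end Network

/-! ### Second moments in [0, ∞] and independence -/

section Expectation

variable {Ω : Type*} [MeasurableSpace Ω] (Pr : Measure Ω)

/-- The expectation of a nonnegative real function, with values in `[0, ∞]`. -/
def ex (g : Ω → ℝ) : ℝ≥0∞ := ∫⁻ ω, ENNReal.ofReal (g ω) ∂Pr

variable {Pr}

lemma ex_mono {g g' : Ω → ℝ} (h : ∀ ω, g ω ≤ g' ω) : ex Pr g ≤ ex Pr g' :=
  lintegral_mono fun ω => ENNReal.ofReal_le_ofReal (h ω)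

lemma ex_add {g g' : Ω → ℝ} (hg : Measurable g) (h0 : ∀ ω, 0 ≤ g ω) (h0' : ∀ ω, 0 ≤ g' ω) :
    ex Pr (fun ω => g ω + g' ω) = ex Pr g + ex Pr g' := by
  simp only [ex, ENNReal.ofReal_add (h0 _) (h0' _)]
  exact lintegral_add_left hg.ennreal_ofReal _

lemma ex_mul {c : ℝ} (hc : 0 ≤ c) (g : Ω → ℝ) :
    ex Pr (fun ω => c * g ω) = ENNReal.ofReal c * ex Pr g := by
  simp only [ex, ENNReal.ofReal_mul hc]
  exact lintegral_const_mul' _ _ ENNReal.ofReal_ne_top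

lemma ex_sum {ι : Type*} (s : Finset ι) {g : ι → Ω → ℝ} (hg : ∀ i ∈ s, Measurable (g i))
    (h0 : ∀ i ∈ s, ∀ ω, 0 ≤ g i ω) :
    ex Pr (fun ω => ∑ i ∈ s, g i ω) = ∑ i ∈ s, ex Pr (g i) := by
  simp only [ex]
  rw [← lintegral_finsetSum' _ fun i hi => (hg i hi).ennreal_ofReal.aemeasurable]
  refine lintegral_congr fun ω => ENNReal.ofReal_sum_of_nonneg fun i hi => h0 i hi ω

lemma ex_const [IsProbabilityMeasure Pr] (c : ℝ) : ex Pr (fun _ => c) = ENNReal.ofReal c := by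
  simp [ex]

lemma ex_norm_sq {E : Type*} [NormedAddCommGroup E] (f : Ω → E) :
    ex Pr (fun ω => ‖f ω‖ ^ 2) = ∫⁻ ω, ‖f ω‖ₑ ^ 2 ∂Pr := by
  refine lintegral_congr fun ω => ?_
  rw [ENNReal.ofReal_pow (norm_nonneg _), ofReal_norm]

lemma memLp_two_of_ex_ne_top {E : Type*} [NormedAddCommGroup E] [MeasurableSpace E] [BorelSpace E]
    [SecondCountableTopology E] {f : Ω → E} (hf : Measurable f)
    (h : ex Pr (fun ω => ‖f ω‖ ^ 2) ≠ ∞) : MemLp f 2 Pr := by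
  refine ⟨hf.aestronglyMeasurable, ?_⟩
  rw [eLpNorm_lt_top_iff_lintegral_rpow_enorm_lt_top two_ne_zero ENNReal.ofNat_ne_top]
  rw [ex_norm_sq] at h
  simpa using h.lt_top

lemma ex_eq_ofReal_integral {E : Type*} [NormedAddCommGroup E] {f : Ω → E} (hf : MemLp f 2 Pr) :
    ex Pr (fun ω => ‖f ω‖ ^ 2) = ENNReal.ofReal (∫ ω, ‖f ω‖ ^ 2 ∂Pr) := by
  rw [ofReal_integral_eq_lintegral_ofReal]
  · rfl
  · exact hf.integrable_norm_pow two_ne_zero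
  · exact Filter.Eventually.of_forall fun ω => by positivity

variable [IsProbabilityMeasure Pr]

section Independence

variable {E : Type*} [NormedAddCommGroup E] [InnerProductSpace ℝ E] [MeasurableSpace E]
  [BorelSpace E] [SecondCountableTopology E] [CompleteSpace E]

/-- The cross term is the inner product of the two means, and the mean of Y is zero. -/
lemma ex_norm_add_sq_of_indepFun {X Y : Ω → E} (hX : MemLp X 2 Pr) (hY : MemLp Y 2 Pr)
    (hXY : IndepFun X Y Pr) (h0 : ∫ ω, Y ω ∂Pr = 0) :
    ex Pr (fun ω => ‖X ω + Y ω‖ ^ 2) = ex Pr (fun ω => ‖X ω‖ ^ 2) + ex Pr (fun ω => ‖Y ω‖ ^ 2) := by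
  have hi : Integrable (fun ω => inner ℝ (X ω) (Y ω)) Pr := by
    refine (MemLp.integrable_norm_pow (hX.norm.add hY.norm) two_ne_zero).mono'
      (hX.1.inner hY.1) (Filter.Eventually.of_forall fun ω => ?_)
    have h1 := norm_inner_le_norm (𝕜 := ℝ) (X ω) (Y ω)
    simp only [Pi.add_apply, Real.norm_eq_abs, sq_abs] at h1 ⊢
    nlinarith [norm_nonneg (X ω), norm_nonneg (Y ω)]
  have h1 : ∫ ω, inner ℝ (X ω) (Y ω) ∂Pr = 0 := by
    have := hXY.integral_bilin (hX.integrable one_le_two) (hY.integrable one_le_two) (innerSL ℝ)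
    rw [h0, map_zero] at this
    exact this
  rw [ex_eq_ofReal_integral hX, ex_eq_ofReal_integral hY, ← ENNReal.ofReal_add
    (integral_nonneg fun _ => by positivity) (integral_nonneg fun _ => by positivity)]
  have h2 := ex_eq_ofReal_integral (hX.add hY)
  simp only [Pi.add_apply] at h2
  rw [h2]
  congr 1
  simp only [norm_add_sq_real]
  rw [integral_add, integral_add, integral_const_mul, h1]
  · ring
  · exact hX.integrable_norm_pow two_ne_zero
  · exact hi.const_mul 2
  · exact (hX.integrable_norm_pow two_ne_zero).add (hi.const_mul 2)
  · exact hY.integrable_norm_pow two_ne_zero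

lemma ex_norm_add_sum_sq {ι : Type*} {X : ι → Ω → E} (hX : ∀ i, Measurable (X i))
    (hind : iIndepFun X Pr) (h2 : ∀ i, ex Pr (fun ω => ‖X i ω‖ ^ 2) ≠ ∞)
    (h0 : ∀ i, ∫ ω, X i ω ∂Pr = 0) (c : E) (s : Finset ι) :
    ex Pr (fun ω => ‖c + ∑ i ∈ s, X i ω‖ ^ 2)
      = ENNReal.ofReal (‖c‖ ^ 2) + ∑ i ∈ s, ex Pr (fun ω => ‖X i ω‖ ^ 2) := by
  classical
  induction s using Finset.induction_on with
  | empty => simp [ex_const]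
  | insert j s hj ih =>
    have hm : ∀ i, MemLp (X i) 2 Pr := fun i => memLp_two_of_ex_ne_top (hX i) (h2 i)
    have h1 : IndepFun (fun ω => c + ∑ i ∈ s, X i ω) (X j) Pr := by
      have := hind.indepFun_finsetSum_of_notMem hX hj
      have h3 := this.comp (φ := fun v => c + v) (ψ := id) (by fun_prop) measurable_id
      simpa [Function.comp_def] using h3
    have h3 : MemLp (fun ω => c + ∑ i ∈ s, X i ω) 2 Pr :=
      (memLp_const c).add (memLp_finsetSum s fun i _ => hm i)
    have h4 := ex_norm_add_sq_of_indepFun h3 (hm j) h1 (h0 j)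
    rw [ih] at h4
    simp only [Finset.sum_insert hj]
    rw [add_comm (ex Pr fun ω => ‖X j ω‖ ^ 2), ← add_assoc, ← h4]
    congr 1
    funext ω
    rw [add_assoc, add_comm (X j ω)]

/-- Dropping the first term gives Jensen's inequality for the mean; dropping the second bounds a
variance by a second moment. Both uses occur below. -/
lemma ex_norm_sub_integral_sq_add {X : Ω → E} (hX : MemLp X 2 Pr) :
    ex Pr (fun ω => ‖X ω - ∫ ω, X ω ∂Pr‖ ^ 2) + ENNReal.ofReal (‖∫ ω, X ω ∂Pr‖ ^ 2)
      = ex Pr (fun ω => ‖X ω‖ ^ 2) := by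
  set c := ∫ ω, X ω ∂Pr
  have hc : MemLp (fun _ : Ω => c) 2 Pr := memLp_const c
  have hY : MemLp (fun ω => X ω - c) 2 Pr := hX.sub hc
  have h0 : ∫ ω, (X ω - c) ∂Pr = 0 := by
    rw [integral_sub (hX.integrable one_le_two) (integrable_const _)]
    simp [c]
  have := ex_norm_add_sq_of_indepFun hc hY (indepFun_const_left c _) h0
  simp only [ex_const, add_sub_cancel] at this
  rw [this, add_comm]

end Independence

/-- The joint law is a product, so the past A may be frozen while the fresh sample η is averaged.
This replaces conditional expectations. -/
lemma ex_eq_lintegral_ex_of_indepFun {S R : Type*} [MeasurableSpace S] [MeasurableSpace R]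
    {A : Ω → S} {η : Ω → R} (hA : Measurable A) (hη : Measurable η) (hind : IndepFun A η Pr)
    {ψ : S × R → ℝ} (hψ : Measurable ψ) :
    ex Pr (fun ω => ψ (A ω, η ω)) = ∫⁻ ω, ex Pr (fun ω' => ψ (A ω, η ω')) ∂Pr := by
  have h1 := (indepFun_iff_map_prod_eq_prod_map_map hA.aemeasurable hη.aemeasurable).1 hind
  have := Measure.isProbabilityMeasure_map (μ := Pr) hA.aemeasurable
  have := Measure.isProbabilityMeasure_map (μ := Pr) hη.aemeasurable
  have hm : Measurable fun p => ENNReal.ofReal (ψ p) := hψ.ennreal_ofReal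
  calc ex Pr (fun ω => ψ (A ω, η ω))
      = ∫⁻ p, ENNReal.ofReal (ψ p) ∂(Pr.map fun ω => (A ω, η ω)) :=
        (lintegral_map hm (hA.prodMk hη)).symm
    _ = ∫⁻ a, ∫⁻ s, ENNReal.ofReal (ψ (a, s)) ∂(Pr.map η) ∂(Pr.map A) := by
        rw [h1, lintegral_prod _ hm.aemeasurable]
    _ = ∫⁻ ω, ∫⁻ s, ENNReal.ofReal (ψ (A ω, s)) ∂(Pr.map η) ∂Pr :=
        lintegral_map hm.lintegral_prod_right' hA
    _ = ∫⁻ ω, ex Pr (fun ω' => ψ (A ω, η ω')) ∂Pr := by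
        refine lintegral_congr fun ω => ?_
        exact lintegral_map (hm.comp (measurable_const.prodMk measurable_id)) hη

end Expectation

/-! ### Moments of the stochastic gradients -/

section Oracle

variable {n d : ℕ} {Ξ : Type*} [MeasurableSpace Ξ] {P : Problem n d Ξ} {L : ℝ} {σ : Fin n → ℝ}

namespace Problem

namespace Assumptions

variable (hP : P.Assumptions L σ)
include hP

lemma hasGradientAt_f (i : Fin n) (x : Vec d) (s : Ξ) :
    HasGradientAt (fun v => P.f i v s) (P.gradf i x s) x :=
  (((hP.f_smooth i s).differentiable one_ne_zero) x).hasGradientAt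

lemma measurable_gradf_right (i : Fin n) (x : Vec d) : Measurable (P.gradf i x) :=
  measurable_of_hasGradientAt (F := fun s v => P.f i v s) (a := fun _ => x)
    (fun p => hP.f_measurable i (x + p)) fun s => hP.hasGradientAt_f i x s

lemma continuous_gradf_left (i : Fin n) (s : Ξ) : Continuous fun x => P.gradf i x s :=
  (InnerProductSpace.toDual ℝ (Vec d)).symm.continuous.comp
    ((hP.f_smooth i s).continuous_fderiv one_ne_zero)

lemma measurable_gradf (i : Fin n) : Measurable fun p : Vec d × Ξ => P.gradf i p.1 p.2 :=
  measurable_uncurry_of_continuous_of_measurable (u := P.gradf i)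
    (fun s => hP.continuous_gradf_left i s) (hP.measurable_gradf_right i)

lemma hasGradientAt_u (i : Fin n) (x : Vec d) : HasGradientAt (P.u i) (gradient (P.u i) x) x :=
  (hP.unbiased i x).differentiableAt.hasGradientAt

lemma integral_gradf (i : Fin n) (x : Vec d) :
    ∫ s, P.gradf i x s ∂(P.law i) = gradient (P.u i) x := (hP.unbiased i x).gradient.symm

lemma ex_gradf_sub_le (i : Fin n) (x : Vec d) :
    ex (P.law i) (fun s => ‖P.gradf i x s - gradient (P.u i) x‖ ^ 2)
      ≤ ENNReal.ofReal (σ i ^ 2) := by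
  rw [ex_norm_sq]; exact hP.variance i x

lemma memLp_gradf (i : Fin n) (x : Vec d) : MemLp (P.gradf i x) 2 (P.law i) := by
  have := hP.prob i
  have h1 : MemLp (fun s => P.gradf i x s - gradient (P.u i) x) 2 (P.law i) :=
    memLp_two_of_ex_ne_top ((hP.measurable_gradf_right i x).sub_const _)
      ((hP.ex_gradf_sub_le i x).trans_lt ENNReal.ofReal_lt_top).ne
  have h2 := h1.add (memLp_const (gradient (P.u i) x))
  refine h2.ae_eq (Filter.Eventually.of_forall fun s => ?_)
  simp

lemma integrable_gradf (i : Fin n) (x : Vec d) : Integrable (P.gradf i x) (P.law i) :=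
  have := hP.prob i
  (hP.memLp_gradf i x).integrable one_le_two

lemma ex_gradf_sub_gradf_le (i : Fin n) (x y : Vec d) :
    ex (P.law i) (fun s => ‖P.gradf i x s - P.gradf i y s‖ ^ 2)
      ≤ ENNReal.ofReal (L ^ 2 * ‖x - y‖ ^ 2) := by
  rw [ex_norm_sq]; exact hP.meanSquaredSmooth i x y

/-- Mean-squared smoothness passes to the mean gradient by Jensen. -/
lemma norm_gradient_u_sub_le (hL : 0 ≤ L) (i : Fin n) (x y : Vec d) :
    ‖gradient (P.u i) x - gradient (P.u i) y‖ ≤ L * ‖x - y‖ := by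
  have := hP.prob i
  have h1 := ex_norm_sub_integral_sq_add ((hP.memLp_gradf i x).sub (hP.memLp_gradf i y))
  simp only [Pi.sub_apply] at h1
  rw [integral_sub (hP.integrable_gradf i x) (hP.integrable_gradf i y), hP.integral_gradf,
    hP.integral_gradf] at h1
  have h2 := (le_add_self.trans h1.le).trans (hP.ex_gradf_sub_gradf_le i x y)
  rw [ENNReal.ofReal_le_ofReal_iff (by positivity), ← mul_pow] at h2
  exact le_of_sq_le_sq h2 (by positivity)

lemma continuous_gradient_u (hL : 0 ≤ L) (i : Fin n) : Continuous (gradient (P.u i)) :=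
  (LipschitzWith.of_dist_le_mul (K := ⟨L, hL⟩) fun x y => by
    rw [dist_eq_norm, dist_eq_norm]
    exact hP.norm_gradient_u_sub_le hL i x y).continuous

end Assumptions

/-- The innovation of the momentum estimator of agent `i` when it moves from `q` to `p`. -/
def innov (P : Problem n d Ξ) (β : ℝ) (i : Fin n) (p q : Vec d) (s : Ξ) : Vec d :=
  (P.gradf i p s - gradient (P.u i) p) - (1 - β) • (P.gradf i q s - gradient (P.u i) q)

namespace Assumptions

variable (hP : P.Assumptions L σ)
include hP

lemma integral_gradf_sub (i : Fin n) (p : Vec d) :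
    ∫ s, (P.gradf i p s - gradient (P.u i) p) ∂(P.law i) = 0 := by
  have := hP.prob i
  rw [integral_sub (hP.integrable_gradf i p) (integrable_const _), hP.integral_gradf]
  simp

lemma integral_innov (β : ℝ) (i : Fin n) (p q : Vec d) :
    ∫ s, P.innov β i p q s ∂(P.law i) = 0 := by
  have := hP.prob i
  simp only [innov]
  rw [integral_sub, integral_smul, hP.integral_gradf_sub, hP.integral_gradf_sub]
  · simp
  · exact (hP.integrable_gradf i p).sub (integrable_const _)
  · exact ((hP.integrable_gradf i q).sub (integrable_const _)).smul (1 - β)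

lemma measurable_innov (hL : 0 ≤ L) (β : ℝ) (i : Fin n) :
    Measurable fun r : Vec d × Vec d × Ξ => P.innov β i r.1 r.2.1 r.2.2 := by
  have h1 := (hP.measurable_gradf i).comp
    (measurable_fst.prodMk measurable_snd.snd : Measurable fun r : Vec d × Vec d × Ξ => (r.1, r.2.2))
  have h2 := (hP.measurable_gradf i).comp
    (measurable_snd.fst.prodMk measurable_snd.snd :
      Measurable fun r : Vec d × Vec d × Ξ => (r.2.1, r.2.2))
  have h3 := (hP.continuous_gradient_u hL i).measurable
  exact (h1.sub (h3.comp measurable_fst)).sub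
    ((h2.sub (h3.comp measurable_snd.fst)).const_smul (1 - β))

/-- The innovation is β times the noise at p plus 1 - β times the centred increment of the gradient
from q to p. The increment uses one sample at both points, so its variance is at most L²‖p - q‖²,
and the plain noise enters only with β². -/
lemma ex_innov_le {β : ℝ} (hβ0 : 0 ≤ β) (hβ1 : β ≤ 1) (i : Fin n) (p q : Vec d) :
    ex (P.law i) (fun s => ‖P.innov β i p q s‖ ^ 2)
      ≤ ENNReal.ofReal (2 * β ^ 2 * σ i ^ 2 + 2 * L ^ 2 * ‖p - q‖ ^ 2) := by
  have := hP.prob i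
  have h1 := ex_norm_sub_integral_sq_add ((hP.memLp_gradf i p).sub (hP.memLp_gradf i q))
  simp only [Pi.sub_apply] at h1
  rw [integral_sub (hP.integrable_gradf i p) (hP.integrable_gradf i q), hP.integral_gradf,
    hP.integral_gradf] at h1
  have h2 := (le_self_add.trans h1.le).trans (hP.ex_gradf_sub_gradf_le i p q)
  have hm1 : Measurable fun s => 2 * β ^ 2 * ‖P.gradf i p s - gradient (P.u i) p‖ ^ 2 :=
    (((hP.measurable_gradf_right i p).sub_const _).norm.pow_const 2).const_mul _
  calc ex (P.law i) (fun s => ‖P.innov β i p q s‖ ^ 2)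
      ≤ ex (P.law i) (fun s => 2 * β ^ 2 * ‖P.gradf i p s - gradient (P.u i) p‖ ^ 2
          + 2 * ‖P.gradf i p s - P.gradf i q s - (gradient (P.u i) p - gradient (P.u i) q)‖ ^ 2) := by
        refine ex_mono fun s => ?_
        have h3 : P.innov β i p q s = β • (P.gradf i p s - gradient (P.u i) p) + (1 - β) •
            (P.gradf i p s - P.gradf i q s - (gradient (P.u i) p - gradient (P.u i) q)) := by
          rw [innov]; module
        rw [h3]
        refine (norm_add_sq_le one_pos _ _).trans ?_
        rw [norm_smul, norm_smul, mul_pow, mul_pow, Real.norm_of_nonneg hβ0,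
          Real.norm_of_nonneg (by linarith : 0 ≤ 1 - β)]
        have h4 : (1 - β) ^ 2 ≤ 1 := by nlinarith
        have h5 := mul_le_mul_of_nonneg_right h4 (sq_nonneg
          ‖P.gradf i p s - P.gradf i q s - (gradient (P.u i) p - gradient (P.u i) q)‖)
        norm_num
        linarith
    _ = ENNReal.ofReal (2 * β ^ 2)
          * ex (P.law i) (fun s => ‖P.gradf i p s - gradient (P.u i) p‖ ^ 2)
        + ENNReal.ofReal 2 * ex (P.law i) (fun s =>
          ‖P.gradf i p s - P.gradf i q s - (gradient (P.u i) p - gradient (P.u i) q)‖ ^ 2) := by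
        rw [ex_add hm1 (fun _ => by positivity) (fun _ => by positivity),
          ex_mul (by positivity), ex_mul (by positivity)]
    _ ≤ ENNReal.ofReal (2 * β ^ 2) * ENNReal.ofReal (σ i ^ 2)
        + ENNReal.ofReal 2 * ENNReal.ofReal (L ^ 2 * ‖p - q‖ ^ 2) := by
        gcongr
        exact hP.ex_gradf_sub_le i p
    _ = ENNReal.ofReal (2 * β ^ 2 * σ i ^ 2 + 2 * L ^ 2 * ‖p - q‖ ^ 2) := by
        rw [← ENNReal.ofReal_mul (by positivity), ← ENNReal.ofReal_mul (by positivity),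
          ← ENNReal.ofReal_add (by positivity) (by positivity), mul_assoc 2 (L ^ 2)]

end Assumptions

end Problem

end Oracle

/-! ### Strongly convex models and their minimisers -/

section Model

variable {E : Type*} [NormedAddCommGroup E] [InnerProductSpace ℝ E] [CompleteSpace E]

/-- `φ` is a differentiable model with gradient `φ'`, bounded below by its first-order expansions
plus `m / 2 * ‖·‖ ^ 2`, whose gradient varies at most linearly around `a`. -/
structure IsModel (m K : ℝ) (a : E) (φ : E → ℝ) (φ' : E → E) : Prop where
  grad : ∀ v, HasGradientAt φ (φ' v) v
  lower : ∀ v w, φ v + inner ℝ (φ' v) (w - v) + m / 2 * ‖w - v‖ ^ 2 ≤ φ w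
  smooth : ∀ v, ‖φ' v - φ' a‖ ≤ K * ‖v - a‖

lemma IsModel.add_inner {m K : ℝ} {a : E} {φ : E → ℝ} {φ' : E → E} (h : IsModel m K a φ φ')
    (k : ℝ) (c : E) :
    IsModel m K a (fun v => φ v + k * inner ℝ c (v - a)) (fun v => φ' v + k • c) where
  grad v := by
    have h1 : HasFDerivAt (fun v => inner ℝ c (v - a)) (InnerProductSpace.toDual ℝ E c) v := by
      have h2 := (InnerProductSpace.toDual ℝ E c).hasFDerivAt.comp v
        ((hasFDerivAt_id v).sub_const a)
      simpa [Function.comp_def] using h2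
    rw [hasGradientAt_iff_hasFDerivAt, map_add, map_smul]
    exact (h.grad v).hasFDerivAt.add (h1.const_mul k)
  lower v w := by
    have h1 := h.lower v w
    have h2 : w - a = (w - v) + (v - a) := by abel
    rw [inner_add_left, inner_smul_left, h2, inner_add_right]
    simp only [conj_trivial]
    linarith
  smooth v := by simpa using h.smooth v

/-- All three conditions survive averaging with unchanged constants; this serves the batched model
at time 1. -/
lemma IsModel.average {m K : ℝ} {a : E} {b : ℕ} (hb : b ≠ 0) {φ : ℕ → E → ℝ} {φ' : ℕ → E → E}
    (h : ∀ r, IsModel m K a (φ r) (φ' r)) :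
    IsModel m K a (fun v => (b : ℝ)⁻¹ * ∑ r ∈ Finset.range b, φ r v)
      (fun v => (b : ℝ)⁻¹ • ∑ r ∈ Finset.range b, φ' r v) := by
  have hb' : (b : ℝ) ≠ 0 := by exact_mod_cast hb
  have hb0 : 0 ≤ (b : ℝ)⁻¹ := by positivity
  refine ⟨fun v => ?_, fun v w => ?_, fun v => ?_⟩
  · rw [hasGradientAt_iff_hasFDerivAt, map_smul, map_sum]
    exact (HasFDerivAt.fun_sum fun r _ => ((h r).grad v).hasFDerivAt).const_mul _
  · have h1 := mul_le_mul_of_nonneg_left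
      (Finset.sum_le_sum fun r (_ : r ∈ Finset.range b) => (h r).lower v w) hb0
    rw [Finset.sum_add_distrib, Finset.sum_add_distrib, ← sum_inner] at h1
    simp only [Finset.sum_const, Finset.card_range, nsmul_eq_mul] at h1
    have h2 : (b : ℝ)⁻¹ * (b * (m / 2 * ‖w - v‖ ^ 2)) = m / 2 * ‖w - v‖ ^ 2 := by field_simp
    rw [inner_smul_left]
    simp only [conj_trivial]
    linarith
  · rw [← smul_sub, ← Finset.sum_sub_distrib, norm_smul, Real.norm_of_nonneg hb0]
    calc (b : ℝ)⁻¹ * ‖∑ r ∈ Finset.range b, (φ' r v - φ' r a)‖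
        ≤ (b : ℝ)⁻¹ * ∑ r ∈ Finset.range b, K * ‖v - a‖ := by
          gcongr
          exact norm_sum_le_of_le _ fun r _ => (h r).smooth v
      _ = K * ‖v - a‖ := by
          simp only [Finset.sum_const, Finset.card_range, nsmul_eq_mul]
          field_simp

lemma IsModel.growth {m K : ℝ} {a p : E} {φ h : E → ℝ} {φ' : E → E} {X : Set E}
    (hφ : IsModel m K a φ φ') (hX : Convex ℝ X) (hh : ConvexOn ℝ Set.univ h) (hp : p ∈ X)
    (hmin : IsMinOn (fun v => φ v + h v) X p) {v : E} (hv : v ∈ X) :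
    φ p + h p + m / 2 * ‖v - p‖ ^ 2 ≤ φ v + h v := by
  have h1 := add_inner_neg_le_of_isMinOn hX hh (hφ.grad p) hp hmin hv
  have h2 := hφ.lower p v
  rw [inner_neg_left] at h1
  linarith

/-- The full m is the sum of two halves: quadratic growth of the local objective at its minimiser p,
and the strong convexity of φ expanded at a. -/
lemma IsModel.step_le {m K : ℝ} {a p : E} {φ h : E → ℝ} {φ' : E → E} {X : Set E}
    (hφ : IsModel m K a φ φ') (hX : Convex ℝ X) (hh : ConvexOn ℝ Set.univ h) (hp : p ∈ X)
    (hmin : IsMinOn (fun v => φ v + h v) X p) (ha : a ∈ X) :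
    h p - h a + inner ℝ (φ' a) (p - a) ≤ -m * ‖p - a‖ ^ 2 := by
  have h1 := hφ.growth hX hh hp hmin ha
  have h2 := hφ.lower a p
  rw [norm_sub_rev] at h1
  linarith

end Model

/-! ### Local problems, measurability and the filtration -/

section Run

variable {n d : ℕ} {Ξ Ω : Type*} [MeasurableSpace Ξ]
  {P : Problem n d Ξ} {fhat : Fin n → Vec d → Vec d → Ξ → ℝ} {W : Matrix (Fin n) (Fin n) ℝ}
  {ξ : Fin n → ℕ → ℕ → Ω → Ξ} {L μ Ls α β : ℝ} {σ : Fin n → ℝ} {b₀ T : ℕ} {x₁ : Vec d}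
  {x xhat z y : Fin n → ℕ → Ω → Vec d}

/-- The smooth part of the local problem solved by agent `i` at time `t`. -/
def model (P : Problem n d Ξ) (fhat : Fin n → Vec d → Vec d → Ξ → ℝ)
    (ξ : Fin n → ℕ → ℕ → Ω → Ξ) (β : ℝ) (b₀ : ℕ) (x z y : Fin n → ℕ → Ω → Vec d)
    (i : Fin n) (t : ℕ) (ω : Ω) (v : Vec d) : ℝ :=
  ftilde P fhat ξ β b₀ x z i t ω v + inner ℝ (y i t ω - z i t ω) (v - x i t ω)

/-- The gradient of `model`. -/
def modelGrad (P : Problem n d Ξ) (fhat : Fin n → Vec d → Vec d → Ξ → ℝ)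
    (ξ : Fin n → ℕ → ℕ → Ω → Ξ) (β : ℝ) (b₀ : ℕ) (x z y : Fin n → ℕ → Ω → Vec d)
    (i : Fin n) (t : ℕ) (ω : Ω) (v : Vec d) : Vec d :=
  if t = 1 then
    (b₀ : ℝ)⁻¹ • ∑ r ∈ Finset.range b₀, gradient (fun v => fhat i v (x i 1 ω) (ξ i 1 r ω)) v
      + (y i t ω - z i t ω)
  else
    gradient (fun v => fhat i v (x i t ω) (ξ i t 0 ω)) v
      + (1 - β) • (z i (t - 1) ω - P.gradf i (x i (t - 1) ω) (ξ i t 0 ω))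
      + (y i t ω - z i t ω)

lemma Problem.SurrogateAssumptions.isModel (hS : P.SurrogateAssumptions fhat μ Ls) (i : Fin n)
    (a : Vec d) (s : Ξ) :
    IsModel μ Ls a (fun v => fhat i v a s) (gradient fun v => fhat i v a s) where
  grad v := (hS.differentiable i a s v).hasGradientAt
  lower v w := add_inner_add_sq_le_of_strongConvexOn (hS.strongConvex i a s)
    (hS.differentiable i a s v).hasGradientAt w
  smooth v := hS.smooth i v a s

lemma isModel_model (hS : P.SurrogateAssumptions fhat μ Ls) (hb : b₀ ≠ 0) (i : Fin n) (t : ℕ)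
    (ω : Ω) : IsModel μ Ls (x i t ω) (model P fhat ξ β b₀ x z y i t ω)
      (modelGrad P fhat ξ β b₀ x z y i t ω) := by
  by_cases ht : t = 1
  · subst ht
    have h1 := (IsModel.average hb fun r => hS.isModel i (x i 1 ω) (ξ i 1 r ω)).add_inner 1
      (y i 1 ω - z i 1 ω)
    convert h1 using 1
    · funext v; simp [model, ftilde]
    · funext v; simp [modelGrad]
  · have h1 := ((hS.isModel i (x i t ω) (ξ i t 0 ω)).add_inner (1 - β)
      (z i (t - 1) ω - P.gradf i (x i (t - 1) ω) (ξ i t 0 ω))).add_inner 1 (y i t ω - z i t ω)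
    convert h1 using 1
    · funext v; simp [model, ftilde, ht]
    · funext v; simp [modelGrad, ht]

/-- By tangent matching, the surrogate gradient plus the momentum correction is z_i^t by its own
update rule (for t = 1 it is the batch mean); the linear term y_i^t - z_i^t then replaces z_i^t by
the tracker. -/
lemma IsRun.modelGrad_self (hS : P.SurrogateAssumptions fhat μ Ls)
    (hR : IsRun P fhat W ξ α β b₀ T x₁ x xhat z y) (i : Fin n) {t : ℕ} (ht : 1 ≤ t) (htT : t ≤ T)
    (ω : Ω) : modelGrad P fhat ξ β b₀ x z y i t ω (x i t ω) = y i t ω := by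
  by_cases h1 : t = 1
  · subst h1
    simp [modelGrad, hS.tangent, hR.z_init]
  · obtain ⟨s, rfl⟩ : ∃ s, t = s + 1 := ⟨t - 1, by omega⟩
    simp only [modelGrad, h1, if_false, hS.tangent, add_tsub_cancel_right]
    rw [hR.z_step i s ω (by omega) (by omega)]
    abel

lemma IsRun.isMinOn_model (hR : IsRun P fhat W ξ α β b₀ T x₁ x xhat z y) (i : Fin n) {t : ℕ}
    (ht : 1 ≤ t) (htT : t ≤ T) (ω : Ω) :
    IsMinOn (fun v => model P fhat ξ β b₀ x z y i t ω v + P.h v) P.feasible (xhat i t ω) :=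
  hR.xhat_min i t ω ht htT

lemma Problem.Assumptions.convex_feasible (hP : P.Assumptions L σ) : Convex ℝ P.feasible := by
  simpa [Problem.feasible] using hP.g_convex.convex_le 0

lemma Problem.Assumptions.continuous_h (hP : P.Assumptions L σ) : Continuous P.h :=
  hP.h_convex.locallyLipschitz.continuous

lemma IsRun.x_mem (hR : IsRun P fhat W ξ α β b₀ T x₁ x xhat z y) (hP : P.Assumptions L σ)
    (hW : W ∈ doublyStochastic ℝ (Fin n)) (hx₁ : x₁ ∈ P.feasible) (hα0 : 0 ≤ α) (hα1 : α ≤ 1)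
    (ω : Ω) {t : ℕ} (ht : 1 ≤ t) (htT : t ≤ T + 1) (i : Fin n) : x i t ω ∈ P.feasible := by
  induction t, ht using Nat.le_induction generalizing i with
  | base => rw [hR.x_init]; exact hx₁
  | succ t ht ih =>
    rw [hR.x_step i t ω ht (by omega)]
    refine hP.convex_feasible.sum_mem (fun j _ => nonneg_of_mem_doublyStochastic hW)
      (sum_row_of_mem_doublyStochastic hW i) fun j _ => ?_
    have h1 : x j t ω + α • (xhat j t ω - x j t ω) = (1 - α) • x j t ω + α • xhat j t ω := by
      module
    rw [h1]
    exact hP.convex_feasible (ih (by omega) j) (hR.xhat_mem j t ω ht (by omega)) (by linarith) hα0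
      (by ring)

/-- The negative model gradient at the minimizer, a subgradient of `h + 𝟙_X`. -/
def subgrad (P : Problem n d Ξ) (fhat : Fin n → Vec d → Vec d → Ξ → ℝ)
    (ξ : Fin n → ℕ → ℕ → Ω → Ξ) (β : ℝ) (b₀ : ℕ) (x xhat z y : Fin n → ℕ → Ω → Vec d)
    (i : Fin n) (t : ℕ) (ω : Ω) : Vec d :=
  -modelGrad P fhat ξ β b₀ x z y i t ω (xhat i t ω)

lemma IsRun.subgrad_mem (hR : IsRun P fhat W ξ α β b₀ T x₁ x xhat z y) (hP : P.Assumptions L σ)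
    (hS : P.SurrogateAssumptions fhat μ Ls) (hb : b₀ ≠ 0) (i : Fin n) {t : ℕ}
    (ht : 1 ≤ t) (htT : t ≤ T) (ω : Ω) :
    subgrad P fhat ξ β b₀ x xhat z y i t ω ∈ subdiffOn P.h P.feasible (xhat i t ω) :=
  ⟨hR.xhat_mem i t ω ht htT, fun _ hv => add_inner_neg_le_of_isMinOn hP.convex_feasible
    hP.h_convex ((isModel_model hS hb i t ω).grad _) (hR.xhat_mem i t ω ht htT)
    (hR.isMinOn_model i ht htT ω) hv⟩

/-- The subgradient is minus the model gradient at the minimiser, whereas y_i^t is the model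
gradient at x_i^t; the surrogate smoothness compares the two. -/
lemma IsRun.norm_subgrad_add_le (hR : IsRun P fhat W ξ α β b₀ T x₁ x xhat z y)
    (hS : P.SurrogateAssumptions fhat μ Ls) (hb : b₀ ≠ 0) (i : Fin n) {t : ℕ}
    (ht : 1 ≤ t) (htT : t ≤ T) (ω : Ω) :
    ‖subgrad P fhat ξ β b₀ x xhat z y i t ω + y i t ω‖ ≤ Ls * ‖xhat i t ω - x i t ω‖ := by
  have h1 := (isModel_model (P := P) (β := β) (z := z) (y := y) (x := x) (ξ := ξ)
    hS hb i t ω).smooth (xhat i t ω)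
  rw [hR.modelGrad_self hS i ht htT, norm_sub_rev] at h1
  rwa [subgrad, neg_add_eq_sub]

lemma IsRun.h_step_le (hR : IsRun P fhat W ξ α β b₀ T x₁ x xhat z y) (hP : P.Assumptions L σ)
    (hS : P.SurrogateAssumptions fhat μ Ls) (hb : b₀ ≠ 0) (i : Fin n) {t : ℕ}
    (ht : 1 ≤ t) (htT : t ≤ T) (ω : Ω) (hx : x i t ω ∈ P.feasible) :
    P.h (xhat i t ω) - P.h (x i t ω) + inner ℝ (y i t ω) (xhat i t ω - x i t ω)
      ≤ -μ * ‖xhat i t ω - x i t ω‖ ^ 2 := by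
  have h1 := (isModel_model (P := P) (β := β) (z := z) (y := y) (x := x) (ξ := ξ)
    hS hb i t ω).step_le hP.convex_feasible hP.h_convex (hR.xhat_mem i t ω ht htT)
    (hR.isMinOn_model i ht htT ω) hx
  rwa [hR.modelGrad_self hS i ht htT] at h1

section Measurability

variable {m : MeasurableSpace Ω}

lemma Problem.SurrogateAssumptions.measurable_gradient (hS : P.SurrogateAssumptions fhat μ Ls)
    (i : Fin n) :
    Measurable fun p : Vec d × Vec d × Ξ => gradient (fun v => fhat i v p.2.1 p.2.2) p.1 :=
  measurable_of_hasGradientAt (S := Vec d × Vec d × Ξ) (F := fun p v => fhat i v p.2.1 p.2.2)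
    (a := fun p => p.1)
    (fun q => (hS.measurable i).comp ((measurable_fst.add_const q).prodMk measurable_snd))
    fun p => (hS.differentiable i p.2.1 p.2.2 p.1).hasGradientAt

lemma measurable_model (hP : P.Assumptions L σ) (hS : P.SurrogateAssumptions fhat μ Ls)
    {i : Fin n} {t : ℕ} (ht : 1 ≤ t) (hx : ∀ s, 1 ≤ s → s ≤ t → Measurable[m] (x i s))
    (hz : ∀ s, 1 ≤ s → s ≤ t → Measurable[m] (z i s)) (hy : Measurable[m] (y i t))
    (hξ : ∀ r, Measurable[m] (ξ i t r)) (v : Vec d) :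
    Measurable[m] fun ω => model P fhat ξ β b₀ x z y i t ω v := by
  have h0 : Measurable[m] fun ω => inner ℝ (y i t ω - z i t ω) (v - x i t ω) :=
    (hy.sub (hz t ht le_rfl)).inner (measurable_const.sub (hx t ht le_rfl))
  refine Measurable.add ?_ h0
  by_cases h1 : t = 1
  · subst h1
    simp only [ftilde, if_true]
    exact (Finset.measurable_sum _ fun r _ => (hS.measurable i).comp
      (measurable_const.prodMk ((hx 1 le_rfl le_rfl).prodMk (hξ r)))).const_mul _
  · simp only [ftilde, h1, if_false]
    refine ((hS.measurable i).comp (measurable_const.prodMk ((hx t ht le_rfl).prodMk (hξ 0)))).add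
      (Measurable.const_mul (Measurable.inner (Measurable.sub (hz (t - 1) (by omega) (by omega))
        ((hP.measurable_gradf i).comp ((hx (t - 1) (by omega) (by omega)).prodMk (hξ 0))))
        (measurable_const.sub (hx t ht le_rfl))) _)

lemma measurable_modelGrad (hP : P.Assumptions L σ) (hS : P.SurrogateAssumptions fhat μ Ls)
    {i : Fin n} {t : ℕ} (ht : 1 ≤ t) (hx : ∀ s, 1 ≤ s → s ≤ t → Measurable[m] (x i s))
    (hz : ∀ s, 1 ≤ s → s ≤ t → Measurable[m] (z i s)) (hy : Measurable[m] (y i t))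
    (hξ : ∀ r, Measurable[m] (ξ i t r)) {v : Ω → Vec d} (hv : Measurable[m] v) :
    Measurable[m] fun ω => modelGrad P fhat ξ β b₀ x z y i t ω (v ω) := by
  have h0 : Measurable[m] fun ω => y i t ω - z i t ω := hy.sub (hz t ht le_rfl)
  by_cases h1 : t = 1
  · subst h1
    simp only [modelGrad, if_true]
    refine Measurable.add (Measurable.fun_const_smul (Finset.measurable_sum _ fun r _ => ?_) _) h0
    exact hS.measurable_gradient i |>.comp (hv.prodMk ((hx 1 le_rfl le_rfl).prodMk (hξ r)))
  · simp only [modelGrad, h1, if_false]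
    refine Measurable.add (Measurable.add ?_ (Measurable.fun_const_smul (Measurable.sub
      (hz (t - 1) (by omega) (by omega)) ((hP.measurable_gradf i).comp
        ((hx (t - 1) (by omega) (by omega)).prodMk (hξ 0)))) _)) h0
    exact hS.measurable_gradient i |>.comp (hv.prodMk ((hx t ht le_rfl).prodMk (hξ 0)))

lemma IsRun.measurable_xhat_of (hR : IsRun P fhat W ξ α β b₀ T x₁ x xhat z y)
    (hP : P.Assumptions L σ) (hS : P.SurrogateAssumptions fhat μ Ls) (hμ : 0 < μ) (hb : b₀ ≠ 0)
    (hx₁ : x₁ ∈ P.feasible)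
    {i : Fin n} {t : ℕ} (ht : 1 ≤ t) (htT : t ≤ T)
    (hx : ∀ s, 1 ≤ s → s ≤ t → Measurable[m] (x i s))
    (hz : ∀ s, 1 ≤ s → s ≤ t → Measurable[m] (z i s)) (hy : Measurable[m] (y i t))
    (hξ : ∀ r, Measurable[m] (ξ i t r)) : Measurable[m] (xhat i t) := by
  refine measurable_of_argmin (X := P.feasible) (m := μ / 2) (by positivity)
    (F := fun ω v => model P fhat ξ β b₀ x z y i t ω v + P.h v)
    (fun v => (measurable_model hP hS ht hx hz hy hξ v).add_const _) (fun ω => ?_)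
    (fun ω => hR.xhat_mem i t ω ht htT) ⟨x₁, hx₁⟩ fun ω v hv => ?_
  · refine Continuous.add ?_ hP.continuous_h
    exact continuous_iff_continuousAt.2 fun v =>
      ((isModel_model hS hb i t ω).grad v).continuousAt
  · exact (isModel_model hS hb i t ω).growth hP.convex_feasible hP.h_convex
      (hR.xhat_mem i t ω ht htT) (hR.isMinOn_model i ht htT ω) hv

end Measurability

/-- The information available at time `t`: the samples drawn at times at most `t`. -/
@[reducible] def past (ξ : Fin n → ℕ → ℕ → Ω → Ξ) (t : ℕ) : MeasurableSpace Ω :=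
  ⨆ p ∈ {p : Fin n × ℕ × ℕ | p.2.1 ≤ t}, MeasurableSpace.comap (ξ p.1 p.2.1 p.2.2) inferInstance

lemma past_mono (ξ : Fin n → ℕ → ℕ → Ω → Ξ) {s t : ℕ} (h : s ≤ t) : past ξ s ≤ past ξ t :=
  biSup_mono fun _ hp => le_trans hp h

lemma measurable_past_sample (ξ : Fin n → ℕ → ℕ → Ω → Ξ) (i : Fin n) {s t : ℕ} (h : s ≤ t) (r : ℕ) :
    Measurable[past ξ t] (ξ i s r) := by
  refine Measurable.mono (comap_measurable (ξ i s r)) ?_ le_rfl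
  exact le_biSup (f := fun p : Fin n × ℕ × ℕ =>
    MeasurableSpace.comap (ξ p.1 p.2.1 p.2.2) inferInstance)
    (show (i, s, r) ∈ {p : Fin n × ℕ × ℕ | p.2.1 ≤ t} from h)

/-- The next iterate `x i (t + 1)` is already known at time t, whereas `z i (t + 1)` involves the
sample of time t + 1. This shift makes the fresh sample independent of both points at which it is
evaluated. Mixing forces the induction to treat all agents together. -/
lemma IsRun.measurable_past (hR : IsRun P fhat W ξ α β b₀ T x₁ x xhat z y)
    (hP : P.Assumptions L σ) (hS : P.SurrogateAssumptions fhat μ Ls) (hμ : 0 < μ) (hb : b₀ ≠ 0)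
    (hx₁ : x₁ ∈ P.feasible) {t : ℕ} (ht : 1 ≤ t) (htT : t ≤ T + 1) (i : Fin n) :
    Measurable[past ξ t] (x i t) ∧ Measurable[past ξ t] (z i t) ∧ Measurable[past ξ t] (y i t) ∧
      (t ≤ T → Measurable[past ξ t] (xhat i t) ∧ Measurable[past ξ t] (x i (t + 1))) := by
  induction t using Nat.strong_induction_on generalizing i with
  | _ t ih =>
  have key : ∀ i, Measurable[past ξ t] (x i t) ∧ Measurable[past ξ t] (z i t) ∧
      Measurable[past ξ t] (y i t) := by
    intro i
    by_cases h1 : t = 1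
    · subst h1
      have hxm : ∀ i, Measurable[past ξ 1] (x i 1) := fun i => by
        rw [show x i 1 = fun _ => x₁ from funext (hR.x_init i)]; exact measurable_const
      have hzm : Measurable[past ξ 1] (z i 1) := by
        rw [show z i 1 = _ from funext (hR.z_init i)]
        exact Measurable.fun_const_smul (Finset.measurable_sum _ fun r _ =>
          (hP.measurable_gradf i).comp ((hxm i).prodMk (measurable_past_sample ξ i le_rfl r))) _
      refine ⟨hxm i, hzm, ?_⟩
      rw [show y i 1 = z i 1 from funext (hR.y_init i)]
      exact hzm
    · obtain ⟨s, rfl⟩ : ∃ s, t = s + 1 := ⟨t - 1, by omega⟩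
      have ihs := ih s (by omega) (by omega) (by omega)
      have hle := past_mono ξ (Nat.le_succ s)
      have hxm : ∀ i, Measurable[past ξ (s + 1)] (x i (s + 1)) := fun i =>
        ((ihs i).2.2.2 (by omega)).2.mono hle le_rfl
      have hzm : ∀ i, Measurable[past ξ (s + 1)] (z i (s + 1)) := fun i => by
        rw [show z i (s + 1) = _ from funext fun ω => hR.z_step i s ω (by omega) (by omega)]
        have h2 := measurable_past_sample ξ i (le_refl (s + 1)) 0
        exact ((hP.measurable_gradf i).comp ((hxm i).prodMk h2)).add (Measurable.fun_const_smul
          (((ihs i).2.1.mono hle le_rfl).sub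
            ((hP.measurable_gradf i).comp (((ihs i).1.mono hle le_rfl).prodMk h2))) _)
      refine ⟨hxm i, hzm i, ?_⟩
      rw [show y i (s + 1) = _ from funext fun ω => hR.y_step i s ω (by omega) (by omega)]
      exact Finset.measurable_sum _ fun j _ => Measurable.fun_const_smul
        ((((ihs j).2.2.1.mono hle le_rfl).add (hzm j)).sub ((ihs j).2.1.mono hle le_rfl)) _
  refine ⟨(key i).1, (key i).2.1, (key i).2.2, fun hT => ?_⟩
  have hxh : ∀ i, Measurable[past ξ t] (xhat i t) := fun i => by
    refine hR.measurable_xhat_of hP hS hμ hb hx₁ ht hT (fun s hs hst => ?_) (fun s hs hst => ?_)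
      (key i).2.2 fun r => measurable_past_sample ξ i le_rfl r
    · rcases hst.eq_or_lt with rfl | h
      · exact (key i).1
      · exact (ih s h hs (by omega) i).1.mono (past_mono ξ hst) le_rfl
    · rcases hst.eq_or_lt with rfl | h
      · exact (key i).2.1
      · exact (ih s h hs (by omega) i).2.1.mono (past_mono ξ hst) le_rfl
  refine ⟨hxh i, ?_⟩
  rw [show x i (t + 1) = _ from funext fun ω => hR.x_step i t ω ht hT]
  exact Finset.measurable_sum _ fun j _ => Measurable.fun_const_smul
    ((key j).1.add (Measurable.fun_const_smul ((hxh j).sub (key j).1) _)) _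

variable [MeasurableSpace Ω] {Pr : Measure Ω}

lemma IsSampling.past_le (hξ : IsSampling P Pr ξ) (t : ℕ) : past ξ t ≤ ‹MeasurableSpace Ω› :=
  iSup₂_le fun p _ => (hξ.measurable p.1 p.2.1 p.2.2).comap_le

/-- The samples of times at most t and those of time t + 1 have disjoint index sets. -/
lemma IsSampling.indepFun_past [IsProbabilityMeasure Pr] (hξ : IsSampling P Pr ξ) {S : Type*}
    [MeasurableSpace S] {t : ℕ} {A : Ω → S} (hA : Measurable[past ξ t] A) :
    IndepFun A (fun ω i => ξ i (t + 1) 0 ω) Pr := by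
  have h1 := indep_iSup_of_disjoint (S := {p : Fin n × ℕ × ℕ | p.2.1 ≤ t})
    (T := {p : Fin n × ℕ × ℕ | p.2.1 = t + 1})
    (m := fun p : Fin n × ℕ × ℕ => MeasurableSpace.comap (ξ p.1 p.2.1 p.2.2) inferInstance)
    (fun p => (hξ.measurable p.1 p.2.1 p.2.2).comap_le) hξ.indep.iIndep
    (Set.disjoint_left.2 fun p (hp : p.2.1 ≤ t) (hq : p.2.1 = t + 1) => by omega)
  refine indep_of_indep_of_le_right (indep_of_indep_of_le_left h1 hA.comap_le) ?_
  refine Measurable.comap_le ?_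
  refine @measurable_pi_lambda _ _ _ (_) _ _ fun i => ?_
  refine Measurable.mono (comap_measurable (ξ i (t + 1) 0)) ?_ le_rfl
  exact le_biSup (f := fun p : Fin n × ℕ × ℕ =>
    MeasurableSpace.comap (ξ p.1 p.2.1 p.2.2) inferInstance)
    (show (i, t + 1, 0) ∈ {p : Fin n × ℕ × ℕ | p.2.1 = t + 1} from rfl)

end Run

/-! ### Deterministic inequalities along one outcome -/

section Pathwise

variable {n d : ℕ} {Ξ Ω : Type*} [MeasurableSpace Ξ]
  {P : Problem n d Ξ} {fhat : Fin n → Vec d → Vec d → Ξ → ℝ} {W : Matrix (Fin n) (Fin n) ℝ}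
  {ξ : Fin n → ℕ → ℕ → Ω → Ξ} {L μ Ls α β : ℝ} {σ : Fin n → ℝ} {b₀ T : ℕ} {x₁ : Vec d}
  {x xhat z y : Fin n → ℕ → Ω → Vec d}

/-- The gradient of `uAvg`. -/
def gradAvg (P : Problem n d Ξ) (v : Vec d) : Vec d := avg fun i => gradient (P.u i) v

/-- The error of the gradient estimator of agent `i`. -/
def gradErr (P : Problem n d Ξ) (x z : Fin n → ℕ → Ω → Vec d) (i : Fin n) (t : ℕ) (ω : Ω) : Vec d :=
  z i t ω - gradient (P.u i) (x i t ω)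

/-- The sum of the squared lengths of the steps towards the local minimizers. -/
def stepSq (x xhat : Fin n → ℕ → Ω → Vec d) (t : ℕ) (ω : Ω) : ℝ :=
  ∑ i, ‖xhat i t ω - x i t ω‖ ^ 2

/-- The sum of the squared increments of a family of processes. -/
def incrSq (x : Fin n → ℕ → Ω → Vec d) (t : ℕ) (ω : Ω) : ℝ :=
  ∑ i, ‖x i (t + 1) ω - x i t ω‖ ^ 2

/-- The disagreement of the agents. -/
def dispAt (x : Fin n → ℕ → Ω → Vec d) (t : ℕ) (ω : Ω) : ℝ := disp fun i => x i t ω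

/-- The squared norm of the averaged gradient error. -/
def avgErrSq (P : Problem n d Ξ) (x z : Fin n → ℕ → Ω → Vec d) (t : ℕ) (ω : Ω) : ℝ :=
  ‖avg fun i => gradErr P x z i t ω‖ ^ 2

/-- The sum of the squared gradient errors. -/
def errSq (P : Problem n d Ξ) (x z : Fin n → ℕ → Ω → Vec d) (t : ℕ) (ω : Ω) : ℝ :=
  ∑ i, ‖gradErr P x z i t ω‖ ^ 2

lemma stepSq_nonneg (x xhat : Fin n → ℕ → Ω → Vec d) (t : ℕ) (ω : Ω) : 0 ≤ stepSq x xhat t ω :=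
  Finset.sum_nonneg fun _ _ => by positivity

lemma incrSq_nonneg (x : Fin n → ℕ → Ω → Vec d) (t : ℕ) (ω : Ω) : 0 ≤ incrSq x t ω :=
  Finset.sum_nonneg fun _ _ => by positivity

lemma dispAt_nonneg (x : Fin n → ℕ → Ω → Vec d) (t : ℕ) (ω : Ω) : 0 ≤ dispAt x t ω :=
  disp_nonneg _

lemma avgErrSq_nonneg (P : Problem n d Ξ) (x z : Fin n → ℕ → Ω → Vec d) (t : ℕ) (ω : Ω) :
    0 ≤ avgErrSq P x z t ω := sq_nonneg _

lemma errSq_nonneg (P : Problem n d Ξ) (x z : Fin n → ℕ → Ω → Vec d) (t : ℕ) (ω : Ω) :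
    0 ≤ errSq P x z t ω := Finset.sum_nonneg fun _ _ => by positivity

lemma Problem.Assumptions.hasGradientAt_uAvg (hP : P.Assumptions L σ) (v : Vec d) :
    HasGradientAt P.uAvg (gradAvg P v) v := by
  rw [hasGradientAt_iff_hasFDerivAt, gradAvg, avg, map_smul, map_sum, ← one_div]
  exact (HasFDerivAt.fun_sum fun i _ => (hP.hasGradientAt_u i v).hasFDerivAt).const_mul _

lemma Problem.Assumptions.norm_gradAvg_sub_le (hP : P.Assumptions L σ) (hL : 0 ≤ L) (hn : n ≠ 0)
    (v w : Vec d) : ‖gradAvg P v - gradAvg P w‖ ≤ L * ‖v - w‖ := by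
  have hn' : (0 : ℝ) < n := by exact_mod_cast Nat.pos_of_ne_zero hn
  rw [gradAvg, gradAvg, ← avg_sub, avg, norm_smul, Real.norm_of_nonneg (by positivity),
    inv_mul_le_iff₀ hn']
  refine (norm_sum_le_of_le _ fun i _ => hP.norm_gradient_u_sub_le hL i v w).trans ?_
  simp

lemma Problem.Assumptions.norm_gradAvg_sub_avg_sq_le (hP : P.Assumptions L σ) (hL : 0 ≤ L)
    (hn : n ≠ 0) (a : Fin n → Vec d) :
    n * ‖gradAvg P (avg a) - avg (fun i => gradient (P.u i) (a i))‖ ^ 2 ≤ L ^ 2 * disp a := by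
  rw [gradAvg, ← avg_sub]
  refine (norm_avg_sq_le hn _).trans ?_
  rw [disp, Finset.mul_sum]
  refine Finset.sum_le_sum fun i _ => ?_
  rw [← mul_pow, norm_sub_rev (a i)]
  exact pow_le_pow_left₀ (norm_nonneg _) (hP.norm_gradient_u_sub_le hL i _ _) 2

variable (hR : IsRun P fhat W ξ α β b₀ T x₁ x xhat z y)
include hR

/-- The gradient-tracking invariant: column sums equal to one preserve averages, and both families
start equal. -/
lemma IsRun.avg_y (hW : W ∈ doublyStochastic ℝ (Fin n)) {t : ℕ} (ht : 1 ≤ t) (htT : t ≤ T + 1)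
    (ω : Ω) : avg (fun i => y i t ω) = avg (fun i => z i t ω) := by
  induction t, ht using Nat.le_induction with
  | base => simp only [hR.y_init]
  | succ t ht ih =>
    simp only [hR.y_step _ t ω ht (by omega)]
    rw [avg_mix hW (fun j => y j t ω + z j (t + 1) ω - z j t ω), avg_sub, avg_add, ih (by omega)]
    abel

lemma IsRun.avg_x_succ (hW : W ∈ doublyStochastic ℝ (Fin n)) {t : ℕ} (ht : 1 ≤ t) (htT : t ≤ T)
    (ω : Ω) : avg (fun i => x i (t + 1) ω)
      = avg (fun i => x i t ω) + α • avg (fun i => xhat i t ω - x i t ω) := by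
  simp only [hR.x_step _ t ω ht htT]
  rw [avg_mix hW (fun j => x j t ω + α • (xhat j t ω - x j t ω)), avg_add, avg_smul]

lemma IsRun.dispAt_x_one (hn : n ≠ 0) (ω : Ω) : dispAt x 1 ω = 0 := by
  simp [dispAt, disp, hR.x_init, avg_const hn]

lemma IsRun.dispAt_x_succ_le (hn : n ≠ 0) (hW : W ∈ doublyStochastic ℝ (Fin n))
    (hlam : lambdaW W < 1) {t : ℕ} (ht : 1 ≤ t) (htT : t ≤ T) (ω : Ω) :
    dispAt x (t + 1) ω ≤ (1 + lambdaW W ^ 2) / 2 * dispAt x t ω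
      + lambdaW W ^ 2 * (1 + lambdaW W ^ 2) / (1 - lambdaW W ^ 2) * α ^ 2 * stepSq x xhat t ω := by
  have h1 := disp_mix_add_le hn hW hlam (fun i => x i t ω) (fun i => α • (xhat i t ω - x i t ω))
  simp only [norm_smul, mul_pow, Real.norm_eq_abs, sq_abs, ← Finset.mul_sum] at h1
  simp only [dispAt, hR.x_step _ t ω ht htT, stepSq]
  linarith

lemma IsRun.dispAt_y_succ_le (hn : n ≠ 0) (hW : W ∈ doublyStochastic ℝ (Fin n))
    (hlam : lambdaW W < 1) {t : ℕ} (ht : 1 ≤ t) (htT : t ≤ T) (ω : Ω) :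
    dispAt y (t + 1) ω ≤ (1 + lambdaW W ^ 2) / 2 * dispAt y t ω
      + lambdaW W ^ 2 * (1 + lambdaW W ^ 2) / (1 - lambdaW W ^ 2) * incrSq z t ω := by
  have h1 := disp_mix_add_le hn hW hlam (fun i => y i t ω) (fun i => z i (t + 1) ω - z i t ω)
  simpa only [dispAt, hR.y_step _ t ω ht htT, incrSq, add_sub_assoc] using h1

/-- Each increment is routed through the two averages, which differ by α times the average step;
only the deviations from consensus remain besides that. -/
lemma IsRun.incrSq_x_le (hn : n ≠ 0) (hW : W ∈ doublyStochastic ℝ (Fin n))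
    {t : ℕ} (ht : 1 ≤ t) (htT : t ≤ T) (ω : Ω) :
    incrSq x t ω ≤ 3 * dispAt x (t + 1) ω + 3 * dispAt x t ω + 3 * α ^ 2 * stepSq x xhat t ω := by
  have h1 := norm_avg_sq_le hn fun i => xhat i t ω - x i t ω
  have h2 := hR.avg_x_succ hW ht htT ω
  set c := avg (fun i => x i t ω) with hc
  set c' := avg (fun i => x i (t + 1) ω) with hc'
  have h3 : ∀ i, ‖x i (t + 1) ω - x i t ω‖ ^ 2 ≤ 3 * ‖x i (t + 1) ω - c'‖ ^ 2
      + 3 * ‖x i t ω - c‖ ^ 2 + 3 * α ^ 2 * ‖avg (fun i => xhat i t ω - x i t ω)‖ ^ 2 := by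
    intro i
    have h4 := norm_sum_sq_le ![x i (t + 1) ω - c', -(x i t ω - c), c' - c]
    simp only [Fin.sum_univ_three, Matrix.cons_val] at h4
    rw [show x i (t + 1) ω - c' + -(x i t ω - c) + (c' - c) = x i (t + 1) ω - x i t ω by abel,
      norm_neg, show c' - c = α • avg (fun i => xhat i t ω - x i t ω) by rw [h2]; abel,
      norm_smul, mul_pow, Real.norm_eq_abs, sq_abs] at h4
    push_cast at h4
    linarith
  have h5 := Finset.sum_le_sum fun i (_ : i ∈ Finset.univ) => h3 i
  rw [Finset.sum_add_distrib, Finset.sum_add_distrib, ← Finset.mul_sum, ← Finset.mul_sum,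
    Finset.sum_const, Finset.card_univ, Fintype.card_fin, nsmul_eq_mul] at h5
  have h6 := mul_le_mul_of_nonneg_left h1 (by positivity : 0 ≤ 3 * α ^ 2)
  simp only [incrSq, dispAt, disp, stepSq]
  rw [← hc, ← hc']
  linarith

/-- At v = x̄_t the three terms are the effect of disagreement on the gradients, the averaged
momentum error and the tracking error of agent i. The tracking invariant is what makes only the
average of the momentum errors appear. -/
lemma IsRun.gradAvg_sub_y (hW : W ∈ doublyStochastic ℝ (Fin n)) {t : ℕ} (ht : 1 ≤ t)
    (htT : t ≤ T + 1) (i : Fin n) (ω : Ω) (v : Vec d) :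
    gradAvg P v - y i t ω
      = (gradAvg P v - avg fun j => gradient (P.u j) (x j t ω)) - avg (fun j => gradErr P x z j t ω)
        - (y i t ω - avg fun j => y j t ω) := by
  simp only [gradErr]
  rw [avg_sub, hR.avg_y hW ht htT]
  abel

omit hR in
lemma inner_le_of_pos {E : Type*} [NormedAddCommGroup E] [InnerProductSpace ℝ E] {k : ℝ}
    (hk : 0 < k) (a b : E) : inner ℝ a b ≤ (2 * k)⁻¹ * ‖a‖ ^ 2 + k / 2 * ‖b‖ ^ 2 := by
  have h1 := real_inner_le_norm a b
  have h2 : 0 ≤ (2 * k)⁻¹ * (‖a‖ - k * ‖b‖) ^ 2 := by positivity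
  have h3 : (2 * k)⁻¹ * (‖a‖ - k * ‖b‖) ^ 2
      = (2 * k)⁻¹ * ‖a‖ ^ 2 - ‖a‖ * ‖b‖ + k / 2 * ‖b‖ ^ 2 := by
    field_simp
    ring
  linarith

/-- The potential whose decrease drives the analysis. -/
def potential (P : Problem n d Ξ) (x : Fin n → ℕ → Ω → Vec d) (t : ℕ) (ω : Ω) : ℝ :=
  n * P.uAvg (avg fun i => x i t ω) + ∑ i, P.h (x i t ω)

/-- Smoothness handles u at the average iterate and convexity handles h at the individual ones. Of
the gain μ per squared step, Young's inequality spends μ / 2 on the three gradient errors and the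
quadratic smoothness term spends μ / 8, which leaves 3μ / 8. -/
lemma IsRun.potential_succ_le (hP : P.Assumptions L σ) (hS : P.SurrogateAssumptions fhat μ Ls)
    (hL : 0 ≤ L) (hμ : 0 < μ) (hb : b₀ ≠ 0) (hn : n ≠ 0) (hW : W ∈ doublyStochastic ℝ (Fin n))
    (hx₁ : x₁ ∈ P.feasible) (hα0 : 0 ≤ α) (hα1 : α ≤ 1) (hLα : L * α ≤ μ / 8)
    {t : ℕ} (ht : 1 ≤ t) (htT : t ≤ T) (ω : Ω) :
    potential P x (t + 1) ω + α * (3 * μ / 8 * stepSq x xhat t ω) ≤ potential P x t ω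
      + α * (3 / (2 * μ) * (n * avgErrSq P x z t ω + L ^ 2 * dispAt x t ω + dispAt y t ω)) := by
  have hn' : (0 : ℝ) < n := by exact_mod_cast Nat.pos_of_ne_zero hn
  set δ : Fin n → Vec d := fun i => xhat i t ω - x i t ω with hδ
  set c := avg (fun i => x i t ω) with hc
  have hu := le_add_inner_add_sq_of_lipschitz_gradient hL hP.hasGradientAt_uAvg
    (hP.norm_gradAvg_sub_le hL hn) c (avg fun i => x i (t + 1) ω)
  rw [hR.avg_x_succ hW ht htT ω, ← hc, add_sub_cancel_left, norm_smul, mul_pow, Real.norm_eq_abs,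
    sq_abs, inner_smul_right] at hu
  have hδn := norm_avg_sq_le hn δ
  -- Jensen along the rows of W, then unit column sums: mixing cannot increase the sum of the values
  -- of h.
  have hh : ∑ i, P.h (x i (t + 1) ω) ≤ ∑ i, ((1 - α) * P.h (x i t ω) + α * P.h (xhat i t ω)) := by
    calc ∑ i, P.h (x i (t + 1) ω)
        ≤ ∑ i, ∑ j, W i j * P.h (x j t ω + α • (xhat j t ω - x j t ω)) := by
          refine Finset.sum_le_sum fun i _ => ?_
          rw [hR.x_step i t ω ht htT]
          exact hP.h_convex.map_sum_le (fun j _ => nonneg_of_mem_doublyStochastic hW)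
            (sum_row_of_mem_doublyStochastic hW i) fun _ _ => Set.mem_univ _
      _ = ∑ j, P.h (x j t ω + α • (xhat j t ω - x j t ω)) := by
          rw [Finset.sum_comm]
          refine Finset.sum_congr rfl fun j _ => ?_
          rw [← Finset.sum_mul, sum_col_of_mem_doublyStochastic hW, one_mul]
      _ ≤ _ := by
          refine Finset.sum_le_sum fun j _ => ?_
          have h1 := hP.h_convex.2 (Set.mem_univ (x j t ω)) (Set.mem_univ (xhat j t ω))
            (by linarith : 0 ≤ 1 - α) hα0 (by ring)
          rw [show (1 - α) • x j t ω + α • xhat j t ω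
            = x j t ω + α • (xhat j t ω - x j t ω) by module] at h1
          simpa using h1
  have hi : ∀ i, inner ℝ (gradAvg P c) (δ i) + (P.h (xhat i t ω) - P.h (x i t ω))
      ≤ 3 / (2 * μ) * (‖gradAvg P c - avg fun j => gradient (P.u j) (x j t ω)‖ ^ 2
        + avgErrSq P x z t ω + ‖y i t ω - avg fun j => y j t ω‖ ^ 2) - μ / 2 * ‖δ i‖ ^ 2 := by
    intro i
    have h1 := hR.h_step_le hP hS hb i ht htT ω
      (hR.x_mem hP hW hx₁ hα0 hα1 ω ht (by omega) i)
    have h2 : inner ℝ (gradAvg P c) (δ i) = inner ℝ (y i t ω) (δ i)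
        + inner ℝ (gradAvg P c - avg fun j => gradient (P.u j) (x j t ω)) (δ i)
        + inner ℝ (-avg (fun j => gradErr P x z j t ω)) (δ i)
        + inner ℝ (-(y i t ω - avg fun j => y j t ω)) (δ i) := by
      rw [← inner_add_left, ← inner_add_left, ← inner_add_left]
      congr 1
      have := hR.gradAvg_sub_y hW ht (by omega : t ≤ T + 1) i ω c
      rw [sub_eq_iff_eq_add] at this
      exact this.trans (by abel)
    -- Three applications of Young with this parameter cost 3 · μ / 6 = μ / 2.
    have hk : 0 < μ / 3 := by positivity
    have h3 := inner_le_of_pos hk (gradAvg P c - avg fun j => gradient (P.u j) (x j t ω)) (δ i)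
    have h4 := inner_le_of_pos hk (-avg (fun j => gradErr P x z j t ω)) (δ i)
    have h5 := inner_le_of_pos hk (-(y i t ω - avg fun j => y j t ω)) (δ i)
    rw [norm_neg] at h4 h5
    have h6 : (2 * (μ / 3))⁻¹ = 3 / (2 * μ) := by field_simp
    rw [h6] at h3 h4 h5
    rw [h2, avgErrSq]
    linarith
  have hsum := Finset.sum_le_sum fun i (_ : i ∈ Finset.univ) => hi i
  rw [Finset.sum_sub_distrib, ← Finset.mul_sum, ← Finset.mul_sum, Finset.sum_add_distrib,
    Finset.sum_add_distrib, ← inner_sum, Finset.sum_add_distrib, Finset.sum_const,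
    Finset.sum_const, Finset.card_univ, Fintype.card_fin, nsmul_eq_mul, nsmul_eq_mul] at hsum
  have hgl := hP.norm_gradAvg_sub_avg_sq_le hL hn (fun j => x j t ω)
  rw [← hc] at hgl
  have hinner : inner ℝ (gradAvg P c) (∑ i, δ i) = n * inner ℝ (gradAvg P c) (avg δ) := by
    rw [avg, inner_smul_right]
    field_simp
  rw [hinner] at hsum
  have h7 : L * (α * α) * (n * ‖avg δ‖ ^ 2) ≤ α * (μ / 8) * ∑ i, ‖δ i‖ ^ 2 := by
    calc L * (α * α) * (n * ‖avg δ‖ ^ 2) ≤ L * (α * α) * ∑ i, ‖δ i‖ ^ 2 := by gcongr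
      _ = α * (L * α) * ∑ i, ‖δ i‖ ^ 2 := by ring
      _ ≤ α * (μ / 8) * ∑ i, ‖δ i‖ ^ 2 := by gcongr
  have h8 := mul_le_mul_of_nonneg_left hu hn'.le
  have h9 : 3 / (2 * μ) * (n * ‖gradAvg P c - avg fun j => gradient (P.u j) (x j t ω)‖ ^ 2
      + n * avgErrSq P x z t ω + dispAt y t ω) ≤ 3 / (2 * μ) * (n * avgErrSq P x z t ω
      + L ^ 2 * dispAt x t ω + dispAt y t ω) := by
    refine mul_le_mul_of_nonneg_left ?_ (by positivity)
    simp only [dispAt] at hgl ⊢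
    linarith
  have h10 := mul_le_mul_of_nonneg_left (hsum.trans (sub_le_sub_right h9 _)) hα0
  rw [Finset.sum_sub_distrib] at h10
  rw [Finset.sum_add_distrib, ← Finset.mul_sum, ← Finset.mul_sum] at hh
  simp only [potential, stepSq]
  rw [hR.avg_x_succ hW ht htT ω, ← hc]
  simp only [hδ] at h7 h8 h10
  linarith

lemma IsRun.potential_one (hn : n ≠ 0) (ω : Ω) : potential P x 1 ω = n * P.U x₁ := by
  simp [potential, hR.x_init, avg_const hn, Problem.U]
  ring

/-- By convexity the average iterate is feasible and its h-value is at most the mean of the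
h-values, so the potential dominates n U(x̄_t). -/
lemma IsRun.le_potential (hP : P.Assumptions L σ) (hn : n ≠ 0)
    (hW : W ∈ doublyStochastic ℝ (Fin n))
    (hx₁ : x₁ ∈ P.feasible) (hα0 : 0 ≤ α) (hα1 : α ≤ 1)
    {t : ℕ} (ht : 1 ≤ t) (htT : t ≤ T + 1) (ω : Ω) :
    n * P.optValue ≤ potential P x t ω := by
  have hn' : (0 : ℝ) < n := by exact_mod_cast Nat.pos_of_ne_zero hn
  have hw : ∑ _i : Fin n, (n : ℝ)⁻¹ = 1 := by simp [hn'.ne']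
  have hm := fun i => hR.x_mem hP hW hx₁ hα0 hα1 ω ht htT i
  have h1 : avg (fun i => x i t ω) ∈ P.feasible := by
    rw [avg, Finset.smul_sum]
    exact hP.convex_feasible.sum_mem (fun i _ => by positivity) hw fun i _ => hm i
  have h2 : P.h (avg fun i => x i t ω) ≤ (n : ℝ)⁻¹ * ∑ i, P.h (x i t ω) := by
    rw [avg, Finset.smul_sum, Finset.mul_sum]
    exact hP.h_convex.map_sum_le (fun i _ => by positivity) hw fun _ _ => Set.mem_univ _
  have h3 : P.optValue ≤ P.U (avg fun i => x i t ω) :=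
    csInf_le hP.bddBelow (Set.mem_image_of_mem _ h1)
  rw [le_inv_mul_iff₀ hn'] at h2
  rw [Problem.U] at h3
  have h4 := mul_le_mul_of_nonneg_left h3 hn'.le
  rw [potential]
  linarith

/-- Telescoping of the descent inequality. Partial horizons N are allowed because the later
finiteness induction advances one time at a time. -/
lemma IsRun.sum_stepSq_le (hP : P.Assumptions L σ) (hS : P.SurrogateAssumptions fhat μ Ls)
    (hL : 0 ≤ L) (hμ : 0 < μ) (hb : b₀ ≠ 0) (hn : n ≠ 0) (hW : W ∈ doublyStochastic ℝ (Fin n))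
    (hx₁ : x₁ ∈ P.feasible) (hα0 : 0 < α) (hα1 : α ≤ 1) (hLα : L * α ≤ μ / 8)
    {B : ℝ} (hB : P.U x₁ - P.optValue ≤ B) {N : ℕ} (hN : N ≤ T) (ω : Ω) :
    3 * μ / 8 * ∑ t ∈ Finset.Icc 1 N, stepSq x xhat t ω ≤ n * B / α
      + 3 / (2 * μ) * ∑ t ∈ Finset.Icc 1 N,
        (n * avgErrSq P x z t ω + L ^ 2 * dispAt x t ω + dispAt y t ω) := by
  have hn' : (0 : ℝ) < n := by exact_mod_cast Nat.pos_of_ne_zero hn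
  have h1 : ∀ N, N ≤ T → potential P x (N + 1) ω
      + α * (3 * μ / 8 * ∑ t ∈ Finset.Icc 1 N, stepSq x xhat t ω) ≤ potential P x 1 ω
      + α * (3 / (2 * μ) * ∑ t ∈ Finset.Icc 1 N,
        (n * avgErrSq P x z t ω + L ^ 2 * dispAt x t ω + dispAt y t ω)) := by
    intro N
    induction N with
    | zero => intro _; simp
    | succ N ih =>
      intro hN
      have h2 := hR.potential_succ_le hP hS hL hμ hb hn hW hx₁ hα0.le hα1 hLα
        (by omega : 1 ≤ N + 1) hN ω
      have h3 := ih (by omega)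
      rw [Finset.sum_Icc_succ_top (by omega), Finset.sum_Icc_succ_top (by omega)]
      linarith
  have h2 := h1 N hN
  have h3 := hR.le_potential hP hn hW hx₁ hα0.le hα1 (by omega : 1 ≤ N + 1) (by omega) ω
  rw [hR.potential_one hn] at h2
  have h4 := mul_le_mul_of_nonneg_left hB hn'.le
  rw [← sub_le_iff_le_add, le_div_iff₀ hα0]
  linarith

/-- The residual is split into six pieces: two Lipschitz differences of ∇u (from the minimiser to
x_i^t, and on to x̄_t), the mismatch between subgradient and tracker, and the three tracking pieces.
The factor 6 is Cauchy–Schwarz, and disagreement appears twice, hence 12 L². -/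
lemma IsRun.sum_gap_le (hP : P.Assumptions L σ) (hS : P.SurrogateAssumptions fhat μ Ls)
    (hL : 0 ≤ L) (hb : b₀ ≠ 0) (hn : n ≠ 0) (hW : W ∈ doublyStochastic ℝ (Fin n))
    {t : ℕ} (ht : 1 ≤ t) (htT : t ≤ T) (ω : Ω) :
    ∑ i, ‖gradient P.uAvg (xhat i t ω) + subgrad P fhat ξ β b₀ x xhat z y i t ω‖ ^ 2
      ≤ 6 * (L ^ 2 + Ls ^ 2) * stepSq x xhat t ω + 12 * L ^ 2 * dispAt x t ω
        + 6 * n * avgErrSq P x z t ω + 6 * dispAt y t ω := by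
  set c := avg (fun i => x i t ω) with hc
  set e := avg (fun j => gradErr P x z j t ω) with he
  set r := gradAvg P c - avg fun j => gradient (P.u j) (x j t ω) with hr
  have h1 : ∀ i, ‖gradient P.uAvg (xhat i t ω) + subgrad P fhat ξ β b₀ x xhat z y i t ω‖ ^ 2
      ≤ 6 * (L ^ 2 + Ls ^ 2) * ‖xhat i t ω - x i t ω‖ ^ 2 + 6 * L ^ 2 * ‖x i t ω - c‖ ^ 2
        + 6 * ‖r‖ ^ 2 + 6 * ‖e‖ ^ 2 + 6 * ‖y i t ω - avg fun j => y j t ω‖ ^ 2 := by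
    intro i
    set w := subgrad P fhat ξ β b₀ x xhat z y i t ω with hw
    have h2 := norm_sum_sq_le ![gradAvg P (xhat i t ω) - gradAvg P (x i t ω), w + y i t ω,
      gradAvg P (x i t ω) - gradAvg P c, r, -e, -(y i t ω - avg fun j => y j t ω)]
    simp only [Fin.sum_univ_six, Matrix.cons_val] at h2
    have h3 : gradAvg P (xhat i t ω) - gradAvg P (x i t ω) + (w + y i t ω)
        + (gradAvg P (x i t ω) - gradAvg P c) + r + -e + -(y i t ω - avg fun j => y j t ω)
        = gradient P.uAvg (xhat i t ω) + w := by
      have := hR.gradAvg_sub_y hW ht (by omega : t ≤ T + 1) i ω c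
      rw [(hP.hasGradientAt_uAvg _).gradient]
      rw [← hr, ← he, sub_eq_iff_eq_add] at this
      rw [this]
      abel
    rw [h3, norm_neg, norm_neg] at h2
    have h4 := pow_le_pow_left₀ (norm_nonneg _)
      (hP.norm_gradAvg_sub_le hL hn (xhat i t ω) (x i t ω)) 2
    have h5 := pow_le_pow_left₀ (norm_nonneg _) (hP.norm_gradAvg_sub_le hL hn (x i t ω) c) 2
    have h6 := pow_le_pow_left₀ (norm_nonneg _) (hR.norm_subgrad_add_le hS hb i ht htT ω) 2
    rw [mul_pow] at h4 h5 h6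
    push_cast at h2
    linarith
  refine (Finset.sum_le_sum fun i _ => h1 i).trans ?_
  simp only [Finset.sum_add_distrib, ← Finset.mul_sum, Finset.sum_const, Finset.card_univ,
    Fintype.card_fin, nsmul_eq_mul]
  have hgl := hP.norm_gradAvg_sub_avg_sq_le hL hn (fun j => x j t ω)
  rw [← hc, ← hr] at hgl
  simp only [stepSq, avgErrSq, dispAt]
  rw [← he]
  simp only [disp] at hgl ⊢
  rw [← hc] at hgl ⊢
  linarith

lemma IsRun.gradErr_succ {t : ℕ} (ht : 1 ≤ t) (htT : t ≤ T) (i : Fin n) (ω : Ω) :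
    gradErr P x z i (t + 1) ω = (1 - β) • gradErr P x z i t ω
      + P.innov β i (x i (t + 1) ω) (x i t ω) (ξ i (t + 1) 0 ω) := by
  rw [gradErr, hR.z_step i t ω ht htT, gradErr, Problem.innov]
  module

/-- Of the three parts, the first is of the size of the move in x, and the other two carry a factor
β. -/
lemma IsRun.z_succ_sub {t : ℕ} (ht : 1 ≤ t) (htT : t ≤ T) (i : Fin n) (ω : Ω) :
    z i (t + 1) ω - z i t ω
      = (P.gradf i (x i (t + 1) ω) (ξ i (t + 1) 0 ω) - P.gradf i (x i t ω) (ξ i (t + 1) 0 ω))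
        + -(β • gradErr P x z i t ω)
        + β • (P.gradf i (x i t ω) (ξ i (t + 1) 0 ω) - gradient (P.u i) (x i t ω)) := by
  rw [hR.z_step i t ω ht htT, gradErr]
  module

end Pathwise

/-! ### Recursions for the second moments -/

section Stochastic

variable {n d : ℕ} {Ξ Ω : Type*} [MeasurableSpace Ξ]
  {P : Problem n d Ξ} {fhat : Fin n → Vec d → Vec d → Ξ → ℝ} {W : Matrix (Fin n) (Fin n) ℝ}
  {ξ : Fin n → ℕ → ℕ → Ω → Ξ} {L μ Ls α β : ℝ} {σ : Fin n → ℝ} {b₀ T : ℕ} {x₁ : Vec d}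
  {x xhat z y : Fin n → ℕ → Ω → Vec d} [MeasurableSpace Ω] {Pr : Measure Ω}

lemma IsSampling.ex_sample (hξ : IsSampling P Pr ξ) (i : Fin n) (t r : ℕ) {f : Ξ → ℝ}
    (hf : Measurable f) : ex Pr (fun ω => f (ξ i t r ω)) = ex (P.law i) f := by
  rw [← hξ.law_eq i t r]
  exact (lintegral_map hf.ennreal_ofReal (hξ.measurable i t r)).symm

lemma IsSampling.integral_sample (hξ : IsSampling P Pr ξ) (i : Fin n) (t r : ℕ) {F : Ξ → Vec d}
    (hF : Measurable F) : ∫ ω, F (ξ i t r ω) ∂Pr = ∫ s, F s ∂(P.law i) := by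
  rw [← hξ.law_eq i t r]
  exact (integral_map (hξ.measurable i t r).aemeasurable hF.aestronglyMeasurable).symm

lemma measurable_avg {m : MeasurableSpace Ω} {a : Fin n → Ω → Vec d}
    (ha : ∀ i, Measurable[m] (a i)) : Measurable[m] fun ω => avg fun i => a i ω :=
  Measurable.fun_const_smul (Finset.measurable_sum _ fun i _ => ha i) (n : ℝ)⁻¹

lemma measurable_dispAt {a : Fin n → ℕ → Ω → Vec d} {t : ℕ} (ha : ∀ i, Measurable (a i t)) :
    Measurable (dispAt a t) := by
  unfold dispAt disp
  exact Finset.measurable_sum _ fun i _ => ((ha i).fun_sub (measurable_avg ha)).norm.pow_const 2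

variable [IsProbabilityMeasure Pr]

/-- Injectivity of κ says that distinct terms use distinct samples, so cross terms vanish. It covers
both the initial batches and one round of fresh samples. -/
lemma IsSampling.ex_norm_add_sum_sq_le {ι : Type*} (hξ : IsSampling P Pr ξ)
    {κ : ι → Fin n × ℕ × ℕ} (hκ : Function.Injective κ) {F : ι → Ξ → Vec d}
    (hF : ∀ p, Measurable (F p)) (h0 : ∀ p, ∫ s, F p s ∂(P.law (κ p).1) = 0) {k : ι → ℝ}
    (hk : ∀ p, ex (P.law (κ p).1) (fun s => ‖F p s‖ ^ 2) ≤ ENNReal.ofReal (k p)) (c : Vec d)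
    (s : Finset ι) :
    ex Pr (fun ω => ‖c + ∑ p ∈ s, F p (ξ (κ p).1 (κ p).2.1 (κ p).2.2 ω)‖ ^ 2)
      ≤ ENNReal.ofReal (‖c‖ ^ 2) + ∑ p ∈ s, ENNReal.ofReal (k p) := by
  have h1 : ∀ p, ex Pr (fun ω => ‖F p (ξ (κ p).1 (κ p).2.1 (κ p).2.2 ω)‖ ^ 2)
      ≤ ENNReal.ofReal (k p) := fun p =>
    (hξ.ex_sample _ _ _ ((hF p).norm.pow_const 2)).le.trans (hk p)
  have hind : iIndepFun (fun p ω => F p (ξ (κ p).1 (κ p).2.1 (κ p).2.2 ω)) Pr :=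
    (hξ.indep.precomp hκ).comp F hF
  rw [ex_norm_add_sum_sq (X := fun p ω => F p (ξ (κ p).1 (κ p).2.1 (κ p).2.2 ω))
    (fun p => (hF p).comp (hξ.measurable _ _ _)) hind
    (fun p => ((h1 p).trans_lt ENNReal.ofReal_lt_top).ne)
    (fun p => by rw [hξ.integral_sample _ _ _ (hF p), h0])]
  gcongr with p
  exact h1 p

lemma IsSampling.ex_le_of_past {S : Type*} [MeasurableSpace S] (hξ : IsSampling P Pr ξ) {t : ℕ}
    {A : Ω → S} (hA : Measurable[past ξ t] A) (i : Fin n) {ψ : S × Ξ → ℝ} (hψ : Measurable ψ)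
    {k : S → ℝ} (hk : ∀ a, ex (P.law i) (fun s => ψ (a, s)) ≤ ENNReal.ofReal (k a)) :
    ex Pr (fun ω => ψ (A ω, ξ i (t + 1) 0 ω)) ≤ ex Pr (fun ω => k (A ω)) := by
  have hind := (hξ.indepFun_past hA).comp measurable_id (measurable_pi_apply i)
  rw [ex_eq_lintegral_ex_of_indepFun (hA.mono (hξ.past_le t) le_rfl) (hξ.measurable i (t + 1) 0)
    hind hψ]
  refine lintegral_mono fun ω => ?_
  rw [hξ.ex_sample i (t + 1) 0 (f := fun s => ψ (A ω, s))
    (hψ.comp (measurable_const.prodMk measurable_id))]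
  exact hk _

section Run

variable (hR : IsRun P fhat W ξ α β b₀ T x₁ x xhat z y) (hξ : IsSampling P Pr ξ)
  (hP : P.Assumptions L σ) (hS : P.SurrogateAssumptions fhat μ Ls) (hL : 0 ≤ L) (hμ : 0 < μ)
  (hb : b₀ ≠ 0) (hx₁ : x₁ ∈ P.feasible)

section
include hR hP hξ hL hb

/-- The weights unify two uses: constant 1/n for the averaged error, the indicator of one agent for
individual errors. -/
lemma IsRun.ex_gradErr_one_le (a : Fin n → ℝ) :
    ex Pr (fun ω => ‖∑ i, a i • gradErr P x z i 1 ω‖ ^ 2)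
      ≤ ENNReal.ofReal ((∑ i, a i ^ 2 * σ i ^ 2) / b₀) := by
  have hb' : (b₀ : ℝ) ≠ 0 := by exact_mod_cast hb
  let F : Fin n × ℕ → Ξ → Vec d := fun p s =>
    (a p.1 * (b₀ : ℝ)⁻¹) • (P.gradf p.1 x₁ s - gradient (P.u p.1) x₁)
  have h1 := hξ.ex_norm_add_sum_sq_le (κ := fun p : Fin n × ℕ => (p.1, 1, p.2))
    (fun p q h => by
      simp only [Prod.mk.injEq, true_and] at h
      exact Prod.ext h.1 h.2) (F := F)
    (fun p => ((hP.measurable_gradf_right p.1 x₁).sub_const _).fun_const_smul (a p.1 * (b₀ : ℝ)⁻¹))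
    (fun p => by simp only [F]; rw [integral_smul, hP.integral_gradf_sub, smul_zero])
    (k := fun p => (a p.1 * (b₀ : ℝ)⁻¹) ^ 2 * σ p.1 ^ 2)
    (fun p => by
      simp only [F, norm_smul, mul_pow, norm_mul, Real.norm_eq_abs, sq_abs]
      rw [← mul_pow]
      rw [ex_mul (sq_nonneg _), ENNReal.ofReal_mul (sq_nonneg _)]
      gcongr
      exact hP.ex_gradf_sub_le p.1 x₁) 0 (Finset.univ ×ˢ Finset.range b₀)
  simp only [F, Finset.sum_product, zero_add, norm_zero, ne_eq, OfNat.ofNat_ne_zero,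
    not_false_eq_true, zero_pow, ENNReal.ofReal_zero, Finset.sum_const, Finset.card_range] at h1
  refine le_trans (le_of_eq ?_) (h1.trans (le_of_eq ?_))
  · congr 1
    funext ω
    congr 2
    refine Finset.sum_congr rfl fun i _ => ?_
    rw [gradErr, hR.z_init, hR.x_init, ← Finset.smul_sum, Finset.sum_sub_distrib, mul_smul,
      smul_sub (b₀ : ℝ)⁻¹]
    simp [← Nat.cast_smul_eq_nsmul ℝ, smul_smul, hb']
  · rw [Finset.sum_div, ENNReal.ofReal_sum_of_nonneg fun i _ => by positivity]
    refine Finset.sum_congr rfl fun i _ => ?_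
    rw [← ENNReal.ofReal_nsmul]
    congr 1
    rw [nsmul_eq_mul]
    field_simp

end

include hR hξ hP hS hμ hb hx₁

lemma IsRun.measurable_x {t : ℕ} (ht : 1 ≤ t) (htT : t ≤ T + 1) (i : Fin n) :
    Measurable (x i t) :=
  (hR.measurable_past hP hS hμ hb hx₁ ht htT i).1.mono (hξ.past_le t) le_rfl

lemma IsRun.measurable_z {t : ℕ} (ht : 1 ≤ t) (htT : t ≤ T + 1) (i : Fin n) :
    Measurable (z i t) :=
  (hR.measurable_past hP hS hμ hb hx₁ ht htT i).2.1.mono (hξ.past_le t) le_rfl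

lemma IsRun.measurable_y {t : ℕ} (ht : 1 ≤ t) (htT : t ≤ T + 1) (i : Fin n) :
    Measurable (y i t) :=
  (hR.measurable_past hP hS hμ hb hx₁ ht htT i).2.2.1.mono (hξ.past_le t) le_rfl

lemma IsRun.measurable_xhat {t : ℕ} (ht : 1 ≤ t) (htT : t ≤ T) (i : Fin n) :
    Measurable (xhat i t) :=
  ((hR.measurable_past hP hS hμ hb hx₁ ht (by omega) i).2.2.2 htT).1.mono (hξ.past_le t) le_rfl

lemma IsRun.measurable_subgrad {t : ℕ} (ht : 1 ≤ t) (htT : t ≤ T) (i : Fin n) :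
    Measurable (subgrad P fhat ξ β b₀ x xhat z y i t) :=
  (measurable_modelGrad hP hS ht
    (fun s hs hst => hR.measurable_x hξ hP hS hμ hb hx₁ hs (by omega) i)
    (fun s hs hst => hR.measurable_z hξ hP hS hμ hb hx₁ hs (by omega) i)
    (hR.measurable_y hξ hP hS hμ hb hx₁ ht (by omega) i) (fun r => hξ.measurable i t r)
    (hR.measurable_xhat hξ hP hS hμ hb hx₁ ht htT i)).neg

lemma IsRun.measurable_stepSq {t : ℕ} (ht : 1 ≤ t) (htT : t ≤ T) :
    Measurable (stepSq x xhat t) :=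
  Finset.measurable_sum _ fun i _ => ((hR.measurable_xhat hξ hP hS hμ hb hx₁ ht htT i).fun_sub
    (hR.measurable_x hξ hP hS hμ hb hx₁ ht (by omega) i)).norm.pow_const 2

lemma IsRun.measurable_incrSq_x {t : ℕ} (ht : 1 ≤ t) (htT : t ≤ T) :
    Measurable (incrSq x t) :=
  Finset.measurable_sum _ fun i _ =>
    ((hR.measurable_x hξ hP hS hμ hb hx₁ (by omega : 1 ≤ t + 1) (by omega) i).fun_sub
      (hR.measurable_x hξ hP hS hμ hb hx₁ ht (by omega) i)).norm.pow_const 2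

lemma IsRun.measurable_dispAt_x {t : ℕ} (ht : 1 ≤ t) (htT : t ≤ T + 1) :
    Measurable (dispAt x t) :=
  measurable_dispAt fun i => hR.measurable_x hξ hP hS hμ hb hx₁ ht htT i

lemma IsRun.measurable_dispAt_y {t : ℕ} (ht : 1 ≤ t) (htT : t ≤ T + 1) :
    Measurable (dispAt y t) :=
  measurable_dispAt fun i => hR.measurable_y hξ hP hS hμ hb hx₁ ht htT i

include hL

lemma IsRun.measurable_gradErr_past {t : ℕ} (ht : 1 ≤ t) (htT : t ≤ T + 1) (i : Fin n) :
    Measurable[past ξ t] (gradErr P x z i t) := by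
  have h1 := hR.measurable_past hP hS hμ hb hx₁ ht htT i
  exact h1.2.1.sub ((hP.continuous_gradient_u hL i).measurable.comp h1.1)

lemma IsRun.measurable_gradErr {t : ℕ} (ht : 1 ≤ t) (htT : t ≤ T + 1) (i : Fin n) :
    Measurable (gradErr P x z i t) :=
  (hR.measurable_gradErr_past hξ hP hS hL hμ hb hx₁ ht htT i).mono (hξ.past_le t) le_rfl

lemma IsRun.measurable_avgErrSq {t : ℕ} (ht : 1 ≤ t) (htT : t ≤ T + 1) :
    Measurable (avgErrSq P x z t) :=
  (measurable_avg fun i =>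
    hR.measurable_gradErr hξ hP hS hL hμ hb hx₁ ht htT i).norm.pow_const 2

/-- With the past frozen, the new error is (1 - β) times the old one plus independent centred
innovations, so squares add without cross terms. The squared weights produce the 1/n² for the
averaged error. -/
lemma IsRun.ex_gradErr_succ_le (hβ0 : 0 ≤ β) (hβ1 : β ≤ 1) (a : Fin n → ℝ) {t : ℕ}
    (ht : 1 ≤ t) (htT : t ≤ T) :
    ex Pr (fun ω => ‖∑ i, a i • gradErr P x z i (t + 1) ω‖ ^ 2)
      ≤ ex Pr (fun ω => (1 - β) ^ 2 * ‖∑ i, a i • gradErr P x z i t ω‖ ^ 2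
        + ∑ i, a i ^ 2 * (2 * β ^ 2 * σ i ^ 2
          + 2 * L ^ 2 * ‖x i (t + 1) ω - x i t ω‖ ^ 2)) := by
  -- Everything the update needs besides the fresh samples; it is measurable with respect to the
  -- past up to time t.
  let A : Ω → (Fin n → Vec d) × (Fin n → Vec d) × Vec d := fun ω =>
    (fun i => x i (t + 1) ω, fun i => x i t ω, ∑ i, a i • gradErr P x z i t ω)
  have hm := fun i => hR.measurable_past hP hS hμ hb hx₁ ht (by omega : t ≤ T + 1) i
  have hA : Measurable[past ξ t] A := by
    refine Measurable.prodMk (@measurable_pi_lambda _ _ _ (_) _ _ fun i => ((hm i).2.2.2 htT).2)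
      (Measurable.prodMk (@measurable_pi_lambda _ _ _ (_) _ _ fun i => (hm i).1) ?_)
    exact Finset.measurable_sum _ fun i _ => Measurable.fun_const_smul
      (hR.measurable_gradErr_past hξ hP hS hL hμ hb hx₁ ht (by omega) i) _
  let ψ : ((Fin n → Vec d) × (Fin n → Vec d) × Vec d) × (Fin n → Ξ) → ℝ := fun r =>
    ‖(1 - β) • r.1.2.2 + ∑ i, a i • P.innov β i (r.1.1 i) (r.1.2.1 i) (r.2 i)‖ ^ 2
  have hψ : Measurable ψ := by
    have q1 : Measurable fun r : ((Fin n → Vec d) × (Fin n → Vec d) × Vec d) × (Fin n → Ξ) =>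
        r.1.2.2 := by fun_prop
    have q2 : ∀ i, Measurable fun r :
        ((Fin n → Vec d) × (Fin n → Vec d) × Vec d) × (Fin n → Ξ) =>
          (r.1.1 i, r.1.2.1 i, r.2 i) := by fun_prop
    exact ((q1.fun_const_smul (1 - β)).fun_add (Finset.measurable_sum _ fun i _ =>
      ((hP.measurable_innov hL β i).comp (q2 i)).fun_const_smul (a i))).norm.pow_const 2
  have h1 : ∀ ω, ‖∑ i, a i • gradErr P x z i (t + 1) ω‖ ^ 2
      = ψ (A ω, fun i => ξ i (t + 1) 0 ω) := by
    intro ω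
    simp only [ψ, A, hR.gradErr_succ ht htT, smul_add, Finset.sum_add_distrib, Finset.smul_sum,
      smul_comm (a _)]
  simp only [h1]
  rw [ex_eq_lintegral_ex_of_indepFun (hA.mono (hξ.past_le t) le_rfl)
    (measurable_pi_lambda _ fun i => hξ.measurable i (t + 1) 0) (hξ.indepFun_past hA) hψ]
  refine lintegral_mono fun ω => ?_
  have h2 := hξ.ex_norm_add_sum_sq_le (κ := fun i : Fin n => (i, t + 1, 0))
    (fun i j h => by simpa using h)
    (F := fun i s => a i • P.innov β i (x i (t + 1) ω) (x i t ω) s)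
    (fun i => ((hP.measurable_innov hL β i).comp
      (measurable_const.prodMk (measurable_const.prodMk measurable_id))).fun_const_smul _)
    (fun i => by rw [integral_smul, hP.integral_innov, smul_zero])
    (k := fun i => a i ^ 2 * (2 * β ^ 2 * σ i ^ 2 + 2 * L ^ 2 * ‖x i (t + 1) ω - x i t ω‖ ^ 2))
    (fun i => by
      simp only [norm_smul, mul_pow, Real.norm_eq_abs, sq_abs]
      rw [ex_mul (sq_nonneg _), ENNReal.ofReal_mul (sq_nonneg _)]
      gcongr
      exact hP.ex_innov_le hβ0 hβ1 i _ _)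
    ((1 - β) • ∑ i, a i • gradErr P x z i t ω) Finset.univ
  refine h2.trans (le_of_eq ?_)
  rw [norm_smul, mul_pow, Real.norm_eq_abs, sq_abs,
    ← ENNReal.ofReal_sum_of_nonneg fun i _ => by positivity,
    ← ENNReal.ofReal_add (by positivity) (Finset.sum_nonneg fun i _ => by positivity)]

lemma IsRun.ex_avgErrSq_succ_le (hβ0 : 0 ≤ β) (hβ1 : β ≤ 1) {V : ℝ} (hV : ∑ i, σ i ^ 2 ≤ V) {t : ℕ}
    (ht : 1 ≤ t) (htT : t ≤ T) :
    ex Pr (avgErrSq P x z (t + 1)) ≤ ENNReal.ofReal (1 - β) * ex Pr (avgErrSq P x z t)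
      + ENNReal.ofReal (2 * β ^ 2 * V / n ^ 2)
      + ENNReal.ofReal (2 * L ^ 2 / n ^ 2) * ex Pr (incrSq x t) := by
  have h1 := hR.ex_gradErr_succ_le hξ hP hS hL hμ hb hx₁ hβ0 hβ1 (fun _ => (n : ℝ)⁻¹) ht htT
  have hV0 : 0 ≤ V := (Finset.sum_nonneg fun i _ => sq_nonneg _).trans hV
  have hmx := hR.measurable_incrSq_x hξ hP hS hμ hb hx₁ ht htT
  have hme := hR.measurable_avgErrSq hξ hP hS hL hμ hb hx₁ ht (by omega : t ≤ T + 1)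
  have h2 : ex Pr (avgErrSq P x z (t + 1)) ≤ ex Pr (fun ω => (1 - β) * avgErrSq P x z t ω
      + (2 * β ^ 2 * V / n ^ 2 + 2 * L ^ 2 / n ^ 2 * incrSq x t ω)) := by
    refine le_trans (le_of_eq ?_) (h1.trans (ex_mono fun ω => ?_))
    · congr 1
      funext ω
      rw [avgErrSq, avg, Finset.smul_sum]
    · refine add_le_add ?_ ?_
      · rw [avgErrSq, avg, Finset.smul_sum]
        refine mul_le_mul_of_nonneg_right ?_ (sq_nonneg _)
        nlinarith
      · rw [← Finset.mul_sum, Finset.sum_add_distrib, ← Finset.mul_sum, ← Finset.mul_sum]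
        calc ((n : ℝ)⁻¹) ^ 2 * (2 * β ^ 2 * ∑ i, σ i ^ 2
              + 2 * L ^ 2 * ∑ i, ‖x i (t + 1) ω - x i t ω‖ ^ 2)
            ≤ ((n : ℝ)⁻¹) ^ 2 * (2 * β ^ 2 * V + 2 * L ^ 2 * incrSq x t ω) := by
              rw [incrSq]; gcongr
          _ = _ := by field_simp
  refine h2.trans (le_of_eq ?_)
  have hi := incrSq_nonneg x t
  have he := avgErrSq_nonneg P x z t
  have h1β : 0 ≤ 1 - β := by linarith
  rw [ex_add (hme.const_mul _) (fun ω => mul_nonneg h1β (he ω))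
      (fun ω => add_nonneg (by positivity) (mul_nonneg (by positivity) (hi ω))),
    ex_add measurable_const (fun ω => by positivity)
      (fun ω => mul_nonneg (by positivity) (hi ω)), ex_const, ex_mul h1β,
    ex_mul (by positivity), add_assoc]

lemma IsRun.ex_errSq_succ_le (hβ0 : 0 ≤ β) (hβ1 : β ≤ 1) {V : ℝ} (hV : ∑ i, σ i ^ 2 ≤ V) {t : ℕ}
    (ht : 1 ≤ t) (htT : t ≤ T) :
    ex Pr (errSq P x z (t + 1)) ≤ ENNReal.ofReal (1 - β) * ex Pr (errSq P x z t)
      + ENNReal.ofReal (2 * β ^ 2 * V) + ENNReal.ofReal (2 * L ^ 2) * ex Pr (incrSq x t) := by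
  have hV0 : 0 ≤ V := (Finset.sum_nonneg fun i _ => sq_nonneg _).trans hV
  have hm := fun i => hR.measurable_gradErr hξ hP hS hL hμ hb hx₁ ht (by omega : t ≤ T + 1) i
  have hm' := fun i => hR.measurable_gradErr hξ hP hS hL hμ hb hx₁ (by omega : 1 ≤ t + 1)
    (by omega : t + 1 ≤ T + 1) i
  have hmd := fun i =>
    (hR.measurable_x hξ hP hS hμ hb hx₁ (by omega : 1 ≤ t + 1) (by omega) i).fun_sub
      (hR.measurable_x hξ hP hS hμ hb hx₁ ht (by omega) i)
  have h1β : 0 ≤ 1 - β := by linarith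
  have h1 : ∀ j, ex Pr (fun ω => ‖gradErr P x z j (t + 1) ω‖ ^ 2)
      ≤ ex Pr (fun ω => (1 - β) * ‖gradErr P x z j t ω‖ ^ 2
        + (2 * β ^ 2 * σ j ^ 2 + 2 * L ^ 2 * ‖x j (t + 1) ω - x j t ω‖ ^ 2)) := by
    intro j
    have h2 := hR.ex_gradErr_succ_le hξ hP hS hL hμ hb hx₁ hβ0 hβ1 (fun i => if i = j then 1 else 0)
      ht htT
    simp only [ite_smul, one_smul, zero_smul, Finset.sum_ite_eq', Finset.mem_univ, if_true,
      ite_pow, one_pow, ne_eq, OfNat.ofNat_ne_zero, not_false_eq_true, zero_pow, ite_mul, one_mul,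
      zero_mul] at h2
    refine h2.trans (ex_mono fun ω => add_le_add ?_ le_rfl)
    refine mul_le_mul_of_nonneg_right ?_ (sq_nonneg _)
    nlinarith
  have h3 : ex Pr (errSq P x z (t + 1)) ≤ ex Pr (fun ω => (1 - β) * errSq P x z t ω
      + (2 * β ^ 2 * V + 2 * L ^ 2 * incrSq x t ω)) := by
    calc ex Pr (errSq P x z (t + 1))
        = ∑ j, ex Pr (fun ω => ‖gradErr P x z j (t + 1) ω‖ ^ 2) :=
          ex_sum _ (fun j _ => (hm' j).norm.pow_const 2) fun j _ ω => by positivity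
      _ ≤ ∑ j, ex Pr (fun ω => (1 - β) * ‖gradErr P x z j t ω‖ ^ 2
          + (2 * β ^ 2 * σ j ^ 2 + 2 * L ^ 2 * ‖x j (t + 1) ω - x j t ω‖ ^ 2)) :=
          Finset.sum_le_sum fun j _ => h1 j
      _ = ex Pr (fun ω => ∑ j, ((1 - β) * ‖gradErr P x z j t ω‖ ^ 2
          + (2 * β ^ 2 * σ j ^ 2 + 2 * L ^ 2 * ‖x j (t + 1) ω - x j t ω‖ ^ 2))) :=
          (ex_sum _ (fun j _ => (((hm j).norm.pow_const 2).const_mul _).fun_add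
            ((((hmd j).norm.pow_const 2).const_mul _).const_add _)) fun j _ ω => add_nonneg
              (mul_nonneg h1β (sq_nonneg _)) (by positivity)).symm
      _ ≤ _ := ex_mono fun ω => by
          simp only [Finset.sum_add_distrib, ← Finset.mul_sum, errSq, incrSq]
          gcongr
  have hi := incrSq_nonneg x t
  have he := errSq_nonneg P x z t
  refine h3.trans (le_of_eq ?_)
  have hme : Measurable (errSq P x z t) :=
    Finset.measurable_sum _ fun j _ => (hm j).norm.pow_const 2
  rw [ex_add (hme.const_mul _)
      (fun ω => mul_nonneg h1β (he ω))
      (fun ω => add_nonneg (by positivity) (mul_nonneg (by positivity) (hi ω))),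
    ex_add measurable_const (fun ω => by positivity)
      (fun ω => mul_nonneg (by positivity) (hi ω)), ex_const, ex_mul h1β,
    ex_mul (by positivity), add_assoc]

/-- Here crude Cauchy–Schwarz on the three parts of the increment suffices: it enters only through
the tracking error, whose feedback carries no 1/β. -/
lemma IsRun.ex_incrSq_z_le {V : ℝ} (hV : ∑ i, σ i ^ 2 ≤ V) {t : ℕ} (ht : 1 ≤ t) (htT : t ≤ T) :
    ex Pr (incrSq z t) ≤ ENNReal.ofReal (3 * L ^ 2) * ex Pr (incrSq x t)
      + ENNReal.ofReal (3 * β ^ 2) * ex Pr (errSq P x z t) + ENNReal.ofReal (3 * β ^ 2 * V) := by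
  have hm := fun i => hR.measurable_past hP hS hμ hb hx₁ ht (by omega : t ≤ T + 1) i
  have hme := fun i => hR.measurable_gradErr hξ hP hS hL hμ hb hx₁ ht (by omega : t ≤ T + 1) i
  have hmx := fun i => hR.measurable_x hξ hP hS hμ hb hx₁ ht (by omega : t ≤ T + 1) i
  have hmx' := fun i =>
    hR.measurable_x hξ hP hS hμ hb hx₁ (by omega : 1 ≤ t + 1) (by omega : t + 1 ≤ T + 1) i
  have hmz := fun i => (hR.measurable_z hξ hP hS hμ hb hx₁ (by omega : 1 ≤ t + 1)
    (by omega : t + 1 ≤ T + 1) i).fun_sub (hR.measurable_z hξ hP hS hμ hb hx₁ ht (by omega) i)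
  have hmd : ∀ i, Measurable fun ω =>
      P.gradf i (x i (t + 1) ω) (ξ i (t + 1) 0 ω) - P.gradf i (x i t ω) (ξ i (t + 1) 0 ω) := fun i =>
    ((hP.measurable_gradf i).comp ((hmx' i).prodMk (hξ.measurable i (t + 1) 0))).fun_sub
      ((hP.measurable_gradf i).comp ((hmx i).prodMk (hξ.measurable i (t + 1) 0)))
  have h1 : ∀ i, ex Pr (fun ω => ‖z i (t + 1) ω - z i t ω‖ ^ 2)
      ≤ ENNReal.ofReal (3 * L ^ 2) * ex Pr (fun ω => ‖x i (t + 1) ω - x i t ω‖ ^ 2)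
        + ENNReal.ofReal (3 * β ^ 2) * ex Pr (fun ω => ‖gradErr P x z i t ω‖ ^ 2)
        + ENNReal.ofReal (3 * β ^ 2 * σ i ^ 2) := by
    intro i
    have h2 : ex Pr (fun ω => ‖z i (t + 1) ω - z i t ω‖ ^ 2) ≤ ex Pr (fun ω =>
        3 * ‖P.gradf i (x i (t + 1) ω) (ξ i (t + 1) 0 ω)
          - P.gradf i (x i t ω) (ξ i (t + 1) 0 ω)‖ ^ 2
        + (3 * β ^ 2 * ‖gradErr P x z i t ω‖ ^ 2
        + 3 * β ^ 2 * ‖P.gradf i (x i t ω) (ξ i (t + 1) 0 ω) - gradient (P.u i) (x i t ω)‖ ^ 2)) := by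
      refine ex_mono fun ω => ?_
      have h4 := norm_sum_sq_le ![P.gradf i (x i (t + 1) ω) (ξ i (t + 1) 0 ω)
        - P.gradf i (x i t ω) (ξ i (t + 1) 0 ω), -(β • gradErr P x z i t ω),
        β • (P.gradf i (x i t ω) (ξ i (t + 1) 0 ω) - gradient (P.u i) (x i t ω))]
      simp only [Fin.sum_univ_three, Matrix.cons_val] at h4
      rw [← hR.z_succ_sub ht htT, norm_neg, norm_smul, norm_smul, mul_pow, mul_pow,
        Real.norm_eq_abs, sq_abs] at h4
      push_cast at h4
      linarith
    rw [ex_add (((hmd i).norm.pow_const 2).const_mul _) (fun _ => by positivity)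
      (fun _ => by positivity), ex_add (((hme i).norm.pow_const 2).const_mul _)
      (fun _ => by positivity) (fun _ => by positivity), ex_mul (by positivity),
      ex_mul (by positivity), ex_mul (by positivity), ← add_assoc] at h2
    refine h2.trans ?_
    have h5 : ex Pr (fun ω => ‖P.gradf i (x i (t + 1) ω) (ξ i (t + 1) 0 ω)
        - P.gradf i (x i t ω) (ξ i (t + 1) 0 ω)‖ ^ 2)
        ≤ ENNReal.ofReal (L ^ 2) * ex Pr (fun ω => ‖x i (t + 1) ω - x i t ω‖ ^ 2) := by
      have h6 := hξ.ex_le_of_past (A := fun ω => (x i (t + 1) ω, x i t ω))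
        (Measurable.prodMk ((hm i).2.2.2 htT).2 (hm i).1) i
        (ψ := fun r => ‖P.gradf i r.1.1 r.2 - P.gradf i r.1.2 r.2‖ ^ 2)
        ((((hP.measurable_gradf i).comp (measurable_fst.fst.prodMk measurable_snd)).fun_sub
          ((hP.measurable_gradf i).comp (measurable_fst.snd.prodMk measurable_snd))).norm.pow_const
            2) (k := fun a => L ^ 2 * ‖a.1 - a.2‖ ^ 2)
        (fun a => hP.ex_gradf_sub_gradf_le i a.1 a.2)
      rwa [ex_mul (sq_nonneg _)] at h6
    have h7 : ex Pr (fun ω => ‖P.gradf i (x i t ω) (ξ i (t + 1) 0 ω)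
        - gradient (P.u i) (x i t ω)‖ ^ 2) ≤ ENNReal.ofReal (σ i ^ 2) := by
      have h6 := hξ.ex_le_of_past (A := fun ω => x i t ω) (hm i).1 i
        (ψ := fun r => ‖P.gradf i r.1 r.2 - gradient (P.u i) r.1‖ ^ 2)
        (((hP.measurable_gradf i).fun_sub
          ((hP.continuous_gradient_u hL i).measurable.comp measurable_fst)).norm.pow_const 2)
        (k := fun _ => σ i ^ 2) (fun a => hP.ex_gradf_sub_le i a)
      rwa [ex_const] at h6
    rw [ENNReal.ofReal_mul (q := L ^ 2) (by positivity : (0 : ℝ) ≤ 3),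
      ENNReal.ofReal_mul (q := σ i ^ 2) (by positivity : (0 : ℝ) ≤ 3 * β ^ 2), mul_assoc]
    gcongr
  calc ex Pr (incrSq z t)
      = ∑ i, ex Pr (fun ω => ‖z i (t + 1) ω - z i t ω‖ ^ 2) :=
        ex_sum _ (fun i _ => (hmz i).norm.pow_const 2) fun _ _ _ => by positivity
    _ ≤ ∑ i, _ := Finset.sum_le_sum fun i _ => h1 i
    _ = ENNReal.ofReal (3 * L ^ 2) * ex Pr (incrSq x t)
      + ENNReal.ofReal (3 * β ^ 2) * ex Pr (errSq P x z t)
      + ENNReal.ofReal (3 * β ^ 2 * ∑ i, σ i ^ 2) := by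
        rw [Finset.sum_add_distrib, Finset.sum_add_distrib, ← Finset.mul_sum, ← Finset.mul_sum,
          ← ex_sum _ (fun i _ => ((hmx' i).fun_sub (hmx i)).norm.pow_const 2)
            (fun _ _ _ => by positivity),
          ← ex_sum _ (fun i _ => (hme i).norm.pow_const 2) (fun _ _ _ => by positivity),
          ← ENNReal.ofReal_sum_of_nonneg (fun _ _ => by positivity), Finset.mul_sum]
        rfl
    _ ≤ _ := by gcongr

lemma IsRun.ex_dispAt_y_succ_le (hn : n ≠ 0) (hW : W ∈ doublyStochastic ℝ (Fin n))
    (hlam : lambdaW W < 1) {t : ℕ} (ht : 1 ≤ t) (htT : t ≤ T) :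
    ex Pr (dispAt y (t + 1)) ≤ ENNReal.ofReal ((1 + lambdaW W ^ 2) / 2) * ex Pr (dispAt y t)
      + ENNReal.ofReal (lambdaW W ^ 2 * (1 + lambdaW W ^ 2) / (1 - lambdaW W ^ 2))
        * ex Pr (incrSq z t) := by
  have hl : 0 ≤ 1 - lambdaW W ^ 2 := by nlinarith [lambdaW_nonneg W]
  have hk : 0 ≤ lambdaW W ^ 2 * (1 + lambdaW W ^ 2) / (1 - lambdaW W ^ 2) := by positivity
  rw [← ex_mul (by positivity), ← ex_mul hk, ← ex_add
    ((hR.measurable_dispAt_y hξ hP hS hμ hb hx₁ ht (by omega)).const_mul _)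
    (fun ω => mul_nonneg (by positivity) (dispAt_nonneg y t ω))
    (fun ω => mul_nonneg hk (incrSq_nonneg z t ω))]
  exact ex_mono fun ω => hR.dispAt_y_succ_le hn hW hlam ht htT ω

lemma IsRun.ex_dispAt_x_succ_le (hn : n ≠ 0) (hW : W ∈ doublyStochastic ℝ (Fin n))
    (hlam : lambdaW W < 1) {t : ℕ} (ht : 1 ≤ t) (htT : t ≤ T) :
    ex Pr (dispAt x (t + 1)) ≤ ENNReal.ofReal ((1 + lambdaW W ^ 2) / 2) * ex Pr (dispAt x t)
      + ENNReal.ofReal (lambdaW W ^ 2 * (1 + lambdaW W ^ 2) / (1 - lambdaW W ^ 2) * α ^ 2)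
        * ex Pr (stepSq x xhat t) := by
  have hl : 0 ≤ 1 - lambdaW W ^ 2 := by nlinarith [lambdaW_nonneg W]
  have hk : 0 ≤ lambdaW W ^ 2 * (1 + lambdaW W ^ 2) / (1 - lambdaW W ^ 2) * α ^ 2 := by positivity
  rw [← ex_mul (by positivity), ← ex_mul hk, ← ex_add
    ((hR.measurable_dispAt_x hξ hP hS hμ hb hx₁ ht (by omega)).const_mul _)
    (fun ω => mul_nonneg (by positivity) (dispAt_nonneg x t ω))
    (fun ω => mul_nonneg hk (stepSq_nonneg x xhat t ω))]
  exact ex_mono fun ω => hR.dispAt_x_succ_le hn hW hlam ht htT ω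

lemma IsRun.ex_incrSq_x_le (hn : n ≠ 0) (hW : W ∈ doublyStochastic ℝ (Fin n))
    {t : ℕ} (ht : 1 ≤ t) (htT : t ≤ T) :
    ex Pr (incrSq x t) ≤ ENNReal.ofReal 3 * ex Pr (dispAt x (t + 1))
      + ENNReal.ofReal 3 * ex Pr (dispAt x t)
      + ENNReal.ofReal (3 * α ^ 2) * ex Pr (stepSq x xhat t) := by
  have h1 := (hR.measurable_dispAt_x hξ hP hS hμ hb hx₁ ht (by omega : t ≤ T + 1)).const_mul 3
  have h2 := (hR.measurable_dispAt_x hξ hP hS hμ hb hx₁ (by omega : 1 ≤ t + 1)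
    (by omega : t + 1 ≤ T + 1)).const_mul 3
  have h3 := fun ω => mul_nonneg (by positivity : (0 : ℝ) ≤ 3) (dispAt_nonneg x t ω)
  have h4 := fun ω => mul_nonneg (by positivity : (0 : ℝ) ≤ 3) (dispAt_nonneg x (t + 1) ω)
  have h5 := fun ω =>
    mul_nonneg (by positivity : (0 : ℝ) ≤ 3 * α ^ 2) (stepSq_nonneg x xhat t ω)
  rw [← ex_mul (by positivity), ← ex_mul (by positivity), ← ex_mul (by positivity),
    ← ex_add h2 h4 h3, ← ex_add (h2.fun_add h1) (fun ω => add_nonneg (h4 ω) (h3 ω)) h5]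
  exact ex_mono fun ω => hR.incrSq_x_le hn hW ht htT ω

lemma IsRun.ex_sum_stepSq_le (hn : n ≠ 0) (hW : W ∈ doublyStochastic ℝ (Fin n))
    (hα0 : 0 < α) (hα1 : α ≤ 1) (hLα : L * α ≤ μ / 8)
    {B : ℝ} (hB0 : 0 ≤ B) (hB : P.U x₁ - P.optValue ≤ B) {N : ℕ} (hN : N ≤ T) :
    ENNReal.ofReal (3 * μ / 8) * ∑ t ∈ Finset.Icc 1 N, ex Pr (stepSq x xhat t)
      ≤ ENNReal.ofReal (n * B / α) + ENNReal.ofReal (3 / (2 * μ)) * ∑ t ∈ Finset.Icc 1 N,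
        (ENNReal.ofReal n * ex Pr (avgErrSq P x z t) + ENNReal.ofReal (L ^ 2) * ex Pr (dispAt x t)
          + ex Pr (dispAt y t)) := by
  have hm1 : ∀ t ∈ Finset.Icc 1 N, Measurable (stepSq x xhat t) := fun t ht => by
    rw [Finset.mem_Icc] at ht
    exact hR.measurable_stepSq hξ hP hS hμ hb hx₁ ht.1 (by omega)
  have hm2 : ∀ t ∈ Finset.Icc 1 N, Measurable (fun ω => (n : ℝ) * avgErrSq P x z t ω) := fun t ht => by
    rw [Finset.mem_Icc] at ht
    exact (hR.measurable_avgErrSq hξ hP hS hL hμ hb hx₁ ht.1 (by omega)).const_mul _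
  have hm3 : ∀ t ∈ Finset.Icc 1 N, Measurable (fun ω => L ^ 2 * dispAt x t ω) := fun t ht => by
    rw [Finset.mem_Icc] at ht
    exact (hR.measurable_dispAt_x hξ hP hS hμ hb hx₁ ht.1 (by omega)).const_mul _
  have hm4 : ∀ t ∈ Finset.Icc 1 N, Measurable (dispAt y t) := fun t ht => by
    rw [Finset.mem_Icc] at ht
    exact hR.measurable_dispAt_y hξ hP hS hμ hb hx₁ ht.1 (by omega)
  have h2 := fun t ω => mul_nonneg (Nat.cast_nonneg n : (0 : ℝ) ≤ n) (avgErrSq_nonneg P x z t ω)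
  have h3 := fun t ω => mul_nonneg (sq_nonneg L) (dispAt_nonneg x t ω)
  have h4 := fun t ω => dispAt_nonneg y t ω
  have h5 : ∀ t ∈ Finset.Icc 1 N, ENNReal.ofReal n * ex Pr (avgErrSq P x z t)
      + ENNReal.ofReal (L ^ 2) * ex Pr (dispAt x t) + ex Pr (dispAt y t)
      = ex Pr (fun ω => n * avgErrSq P x z t ω + L ^ 2 * dispAt x t ω + dispAt y t ω) := by
    intro t ht
    rw [ex_add ((hm2 t ht).fun_add (hm3 t ht)) (fun ω => add_nonneg (h2 t ω) (h3 t ω)) (h4 t),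
      ex_add (hm2 t ht) (h2 t) (h3 t), ex_mul (by positivity), ex_mul (by positivity)]
  rw [Finset.sum_congr rfl h5, ← ex_sum _ hm1 (fun t _ ω => stepSq_nonneg x xhat t ω),
    ← ex_sum _ (fun t ht => ((hm2 t ht).fun_add (hm3 t ht)).fun_add (hm4 t ht))
      (fun t _ ω => add_nonneg (add_nonneg (h2 t ω) (h3 t ω)) (h4 t ω)),
    ← ex_mul (by positivity), ← ex_mul (by positivity), ← ex_const (Pr := Pr) (n * B / α),
    ← ex_add measurable_const (fun ω => by positivity) (fun ω => mul_nonneg (by positivity)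
      (Finset.sum_nonneg fun t _ => add_nonneg (add_nonneg (h2 t ω) (h3 t ω)) (h4 t ω)))]
  exact ex_mono fun ω => hR.sum_stepSq_le hP hS hL hμ hb hn hW hx₁ hα0 hα1 hLα hB hN ω

lemma IsRun.ex_sum_gap_le (hn : n ≠ 0) (hW : W ∈ doublyStochastic ℝ (Fin n))
    {t : ℕ} (ht : 1 ≤ t) (htT : t ≤ T) :
    ∑ i, ∫⁻ ω, ‖gradient P.uAvg (xhat i t ω) + subgrad P fhat ξ β b₀ x xhat z y i t ω‖ₑ ^ 2 ∂Pr
      ≤ ENNReal.ofReal (6 * (L ^ 2 + Ls ^ 2)) * ex Pr (stepSq x xhat t)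
        + ENNReal.ofReal (12 * L ^ 2) * ex Pr (dispAt x t)
        + ENNReal.ofReal (6 * n) * ex Pr (avgErrSq P x z t)
        + ENNReal.ofReal 6 * ex Pr (dispAt y t) := by
  have hmx := fun i => hR.measurable_xhat hξ hP hS hμ hb hx₁ ht htT i
  have hmw := fun i => hR.measurable_subgrad hξ hP hS hμ hb hx₁ ht htT i
  have hu : ∀ i, Measurable fun ω => gradient P.uAvg (xhat i t ω) := by
    intro i
    rw [gradient_eq hP.hasGradientAt_uAvg]
    exact measurable_avg fun j => (hP.continuous_gradient_u hL j).measurable.comp (hmx i)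
  simp only [← ex_norm_sq]
  rw [← ex_sum _ (fun i _ => ((hu i).fun_add (hmw i)).norm.pow_const 2)
    (fun _ _ _ => by positivity)]
  have m1 := (hR.measurable_stepSq hξ hP hS hμ hb hx₁ ht htT).const_mul (6 * (L ^ 2 + Ls ^ 2))
  have m2 := (hR.measurable_dispAt_x hξ hP hS hμ hb hx₁ ht (by omega : t ≤ T + 1)).const_mul
    (12 * L ^ 2)
  have m3 := (hR.measurable_avgErrSq hξ hP hS hL hμ hb hx₁ ht (by omega : t ≤ T + 1)).const_mul
    (6 * (n : ℝ))
  have p1 := fun ω => mul_nonneg (by positivity : 0 ≤ 6 * (L ^ 2 + Ls ^ 2))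
    (stepSq_nonneg x xhat t ω)
  have p2 := fun ω => mul_nonneg (by positivity : 0 ≤ 12 * L ^ 2) (dispAt_nonneg x t ω)
  have p3 := fun ω => mul_nonneg (by positivity : 0 ≤ 6 * (n : ℝ)) (avgErrSq_nonneg P x z t ω)
  have p4 := fun ω => mul_nonneg (by positivity : (0 : ℝ) ≤ 6) (dispAt_nonneg y t ω)
  rw [← ex_mul (by positivity), ← ex_mul (by positivity), ← ex_mul (by positivity),
    ← ex_mul (by positivity), ← ex_add m1 p1 p2,
    ← ex_add (m1.fun_add m2) (fun ω => add_nonneg (p1 ω) (p2 ω)) p3,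
    ← ex_add ((m1.fun_add m2).fun_add m3) (fun ω => add_nonneg (add_nonneg (p1 ω) (p2 ω)) (p3 ω)) p4]
  exact ex_mono fun ω => hR.sum_gap_le hP hS hL hb hn hW ht htT ω

lemma IsRun.ex_errSq_one_le {V : ℝ} (hV : ∑ i, σ i ^ 2 ≤ V) :
    ex Pr (errSq P x z 1) ≤ ENNReal.ofReal (V / b₀) := by
  have h1 : ∀ j, ex Pr (fun ω => ‖gradErr P x z j 1 ω‖ ^ 2) ≤ ENNReal.ofReal (σ j ^ 2 / b₀) := by
    intro j
    have h2 := hR.ex_gradErr_one_le hξ hP hL hb (fun i => if i = j then 1 else 0)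
    simpa only [ite_smul, one_smul, zero_smul, Finset.sum_ite_eq', Finset.mem_univ, if_true,
      ite_pow, one_pow, ne_eq, OfNat.ofNat_ne_zero, not_false_eq_true, zero_pow, ite_mul, one_mul,
      zero_mul] using h2
  calc ex Pr (errSq P x z 1) = ∑ j, ex Pr (fun ω => ‖gradErr P x z j 1 ω‖ ^ 2) :=
        ex_sum _ (fun j _ => (hR.measurable_gradErr hξ hP hS hL hμ hb hx₁ le_rfl
          (by omega : 1 ≤ T + 1) j).norm.pow_const 2) fun _ _ _ => by positivity
    _ ≤ ∑ j, ENNReal.ofReal (σ j ^ 2 / b₀) := Finset.sum_le_sum fun j _ => h1 j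
    _ = ENNReal.ofReal ((∑ j, σ j ^ 2) / b₀) := by
        rw [← ENNReal.ofReal_sum_of_nonneg (fun _ _ => by positivity), Finset.sum_div]
    _ ≤ _ := by gcongr

lemma IsRun.ex_avgErrSq_one_le {V : ℝ} (hV : ∑ i, σ i ^ 2 ≤ V) :
    ex Pr (avgErrSq P x z 1) ≤ ENNReal.ofReal (V / (n ^ 2 * b₀)) := by
  have h2 := hR.ex_gradErr_one_le hξ hP hL hb (fun _ => (n : ℝ)⁻¹)
  refine le_trans (le_of_eq ?_) (h2.trans (ENNReal.ofReal_le_ofReal ?_))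
  · simp only [← Finset.smul_sum]; rfl
  · rw [← Finset.mul_sum, inv_pow, inv_mul_eq_div, div_div]
    gcongr

/-- The trackers start at the batch gradients, that is, at the local gradients plus initial errors;
disagreement is at most the sum of squares. This is the only place where Γ enters. -/
lemma IsRun.ex_dispAt_y_one_le (hn : n ≠ 0) {V Γ : ℝ} (hV : ∑ i, σ i ^ 2 ≤ V)
    (hΓ : ∑ i, ‖gradient (P.u i) x₁‖ ^ 2 ≤ Γ) :
    ex Pr (dispAt y 1) ≤ ENNReal.ofReal (2 * (V / b₀) + 2 * Γ) := by
  have hV0 : 0 ≤ V := (Finset.sum_nonneg fun i _ => sq_nonneg _).trans hV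
  have hΓ0 : 0 ≤ Γ := (Finset.sum_nonneg fun i _ => sq_nonneg _).trans hΓ
  have hme : Measurable fun ω => 2 * errSq P x z 1 ω :=
    (Finset.measurable_sum _ fun j _ => (hR.measurable_gradErr hξ hP hS hL hμ hb hx₁ le_rfl
      (by omega : 1 ≤ T + 1) j).norm.pow_const 2).const_mul _
  have h1 : ex Pr (dispAt y 1) ≤ ex Pr (fun ω => 2 * errSq P x z 1 ω + 2 * Γ) := by
    refine ex_mono fun ω => ?_
    have h2 : ∀ i, ‖y i 1 ω‖ ^ 2
        ≤ 2 * ‖gradErr P x z i 1 ω‖ ^ 2 + 2 * ‖gradient (P.u i) x₁‖ ^ 2 := by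
      intro i
      have h3 := norm_add_sq_le one_pos (gradErr P x z i 1 ω) (gradient (P.u i) x₁)
      rw [gradErr, hR.x_init, sub_add_cancel, ← hR.y_init] at h3
      rw [gradErr, hR.x_init, ← hR.y_init]
      norm_num at h3
      exact h3
    have h4 := Finset.sum_le_sum fun i (_ : i ∈ Finset.univ) => h2 i
    rw [Finset.sum_add_distrib, ← Finset.mul_sum, ← Finset.mul_sum] at h4
    have h5 := disp_le_sum_sq hn fun i => y i 1 ω
    simp only [dispAt, errSq]
    linarith
  refine h1.trans ?_
  have h6 := hR.ex_errSq_one_le hξ hP hS hL hμ hb hx₁ hV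
  rw [ex_add hme (fun ω => mul_nonneg zero_le_two (errSq_nonneg P x z 1 ω)) (fun _ => by positivity),
    ex_const, ex_mul zero_le_two, ENNReal.ofReal_add (by positivity) (by positivity),
    ENNReal.ofReal_mul (q := V / b₀) zero_le_two]
  gcongr

end Run

end Stochastic

/-! ### Closing the coupled recursions -/

section Recursion

lemma toReal_le_mul_add {a b c : ℝ≥0∞} {k : ℝ} (hk : 0 ≤ k) (h : a ≤ ENNReal.ofReal k * b + c)
    (hb : b ≠ ∞) (hc : c ≠ ∞) : a.toReal ≤ k * b.toReal + c.toReal := by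
  have h1 : ENNReal.ofReal k * b ≠ ∞ := ENNReal.mul_ne_top ENNReal.ofReal_ne_top hb
  have h2 := ENNReal.toReal_mono (ENNReal.add_ne_top.2 ⟨h1, hc⟩) h
  rwa [ENNReal.toReal_add h1 hc, ENNReal.toReal_mul, ENNReal.toReal_ofReal hk] at h2

lemma add_mul_sum_le_of_succ_le {r : ℝ} {a b : ℕ → ℝ} {T : ℕ}
    (h : ∀ t, 1 ≤ t → t ≤ T → a (t + 1) ≤ (1 - r) * a t + b t) :
    a (T + 1) + r * ∑ t ∈ Finset.Icc 1 T, a t ≤ a 1 + ∑ t ∈ Finset.Icc 1 T, b t := by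
  induction T with
  | zero => simp
  | succ T ih =>
    have h1 := ih fun t ht htT => h t ht (by omega)
    have h2 := h (T + 1) (by omega) le_rfl
    rw [Finset.sum_Icc_succ_top (by omega), Finset.sum_Icc_succ_top (by omega)]
    linarith

/-- The coupled recursions of the mean squared step `D`, consensus error `X`, increment `M`,
averaged gradient error `v`, gradient error `s`, increment `Z` of the estimators, and tracking
error `Y`. -/
structure EnergyRecursion (n : ℕ) (μ L l V B Γ α β : ℝ) (b₀ T : ℕ) (D X M v s Z Y : ℕ → ℝ≥0∞) :
    Prop where
  X_one : X 1 = 0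
  X_succ : ∀ t, 1 ≤ t → t ≤ T → X (t + 1) ≤ ENNReal.ofReal ((1 + l ^ 2) / 2) * X t
    + ENNReal.ofReal (l ^ 2 * (1 + l ^ 2) / (1 - l ^ 2) * α ^ 2) * D t
  M_le : ∀ t, 1 ≤ t → t ≤ T → M t ≤ ENNReal.ofReal 3 * X (t + 1) + ENNReal.ofReal 3 * X t
    + ENNReal.ofReal (3 * α ^ 2) * D t
  v_one : v 1 ≤ ENNReal.ofReal (V / (n ^ 2 * b₀))
  v_succ : ∀ t, 1 ≤ t → t ≤ T → v (t + 1) ≤ ENNReal.ofReal (1 - β) * v t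
    + ENNReal.ofReal (2 * β ^ 2 * V / n ^ 2) + ENNReal.ofReal (2 * L ^ 2 / n ^ 2) * M t
  s_one : s 1 ≤ ENNReal.ofReal (V / b₀)
  s_succ : ∀ t, 1 ≤ t → t ≤ T → s (t + 1) ≤ ENNReal.ofReal (1 - β) * s t
    + ENNReal.ofReal (2 * β ^ 2 * V) + ENNReal.ofReal (2 * L ^ 2) * M t
  Z_le : ∀ t, 1 ≤ t → t ≤ T → Z t ≤ ENNReal.ofReal (3 * L ^ 2) * M t
    + ENNReal.ofReal (3 * β ^ 2) * s t + ENNReal.ofReal (3 * β ^ 2 * V)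
  Y_one : Y 1 ≤ ENNReal.ofReal (2 * (V / b₀) + 2 * Γ)
  Y_succ : ∀ t, 1 ≤ t → t ≤ T → Y (t + 1) ≤ ENNReal.ofReal ((1 + l ^ 2) / 2) * Y t
    + ENNReal.ofReal (l ^ 2 * (1 + l ^ 2) / (1 - l ^ 2)) * Z t
  D_sum : ∀ N, N ≤ T → ENNReal.ofReal (3 * μ / 8) * ∑ t ∈ Finset.Icc 1 N, D t
    ≤ ENNReal.ofReal (n * B / α) + ENNReal.ofReal (3 / (2 * μ)) * ∑ t ∈ Finset.Icc 1 N,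
      (ENNReal.ofReal n * v t + ENNReal.ofReal (L ^ 2) * X t + Y t)

namespace EnergyRecursion

variable {n : ℕ} {μ L l V B Γ α β : ℝ} {b₀ T : ℕ} {D X M v s Z Y : ℕ → ℝ≥0∞}
  (h : EnergyRecursion n μ L l V B Γ α β b₀ T D X M v s Z Y)
include h

lemma ne_top_of_D {t : ℕ} (ht : 1 ≤ t) (htT : t ≤ T) (hX : X t ≠ ∞) (hs : s t ≠ ∞) (hD : D t ≠ ∞) :
    X (t + 1) ≠ ∞ ∧ M t ≠ ∞ ∧ Z t ≠ ∞ := by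
  have h1 : X (t + 1) ≠ ∞ := ne_top_of_le_ne_top (by finiteness) (h.X_succ t ht htT)
  have h2 : M t ≠ ∞ := ne_top_of_le_ne_top (by finiteness) (h.M_le t ht htT)
  exact ⟨h1, h2, ne_top_of_le_ne_top (by finiteness) (h.Z_le t ht htT)⟩

/-- Order matters: at time t the errors are finite by the recursions from t - 1, and only then does
the summed descent inequality, truncated at t, make `D t` finite. -/
lemma ne_top (hμ : 0 < μ) {t : ℕ} (ht : 1 ≤ t) (htT : t ≤ T + 1) :
    (X t ≠ ∞ ∧ v t ≠ ∞ ∧ s t ≠ ∞ ∧ Y t ≠ ∞) ∧ (t ≤ T → D t ≠ ∞) := by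
  induction t using Nat.strong_induction_on with
  | _ t ih =>
  have key : X t ≠ ∞ ∧ v t ≠ ∞ ∧ s t ≠ ∞ ∧ Y t ≠ ∞ := by
    by_cases h1 : t = 1
    · subst h1
      exact ⟨by simp [h.X_one], ne_top_of_le_ne_top (by finiteness) h.v_one,
        ne_top_of_le_ne_top (by finiteness) h.s_one, ne_top_of_le_ne_top (by finiteness) h.Y_one⟩
    · obtain ⟨k, rfl⟩ : ∃ k, t = k + 1 := ⟨t - 1, by omega⟩
      have hk : 1 ≤ k := by omega
      have hkT : k ≤ T := by omega
      obtain ⟨⟨hX, hv, hs, hY⟩, hD⟩ := ih k (by omega) hk (by omega)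
      obtain ⟨hX', hM, hZ⟩ := h.ne_top_of_D hk hkT hX hs (hD hkT)
      exact ⟨hX', ne_top_of_le_ne_top (by finiteness) (h.v_succ k hk hkT),
        ne_top_of_le_ne_top (by finiteness) (h.s_succ k hk hkT),
        ne_top_of_le_ne_top (by finiteness) (h.Y_succ k hk hkT)⟩
  refine ⟨key, fun hT => ?_⟩
  have h1 := h.D_sum t hT
  have h2 : ∑ k ∈ Finset.Icc 1 t, (ENNReal.ofReal n * v k + ENNReal.ofReal (L ^ 2) * X k + Y k)
      ≠ ∞ := by
    refine ENNReal.sum_ne_top.2 fun k hk => ?_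
    rw [Finset.mem_Icc] at hk
    have h3 : X k ≠ ∞ ∧ v k ≠ ∞ ∧ s k ≠ ∞ ∧ Y k ≠ ∞ := by
      rcases hk.2.eq_or_lt with rfl | hlt
      · exact key
      · exact (ih k hlt hk.1 (by omega)).1
    obtain ⟨hX, hv, -, hY⟩ := h3
    finiteness
  have h4 : ENNReal.ofReal (3 * μ / 8) * ∑ k ∈ Finset.Icc 1 t, D k ≠ ∞ :=
    ne_top_of_le_ne_top (by finiteness) h1
  have h5 : ∑ k ∈ Finset.Icc 1 t, D k ≠ ∞ := fun h6 => h4 (by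
    rw [h6]
    exact ENNReal.mul_top (ENNReal.ofReal_pos.2 (by positivity)).ne')
  exact ENNReal.sum_ne_top.1 h5 t (Finset.mem_Icc.2 ⟨ht, le_rfl⟩)

/-- The bound on the accumulated squared steps, up to the factor `8 / μ`. -/
def budget (n : ℕ) (μ l V B Γ α β : ℝ) (b₀ T : ℕ) : ℝ :=
  n * B / α + 3 / (2 * μ * n) * (V / (β * b₀) + 2 * T * β * V)
    + 3 / (μ * (1 - l ^ 2)) * (2 * (V / b₀) + 2 * Γ
      + l ^ 2 * (1 + l ^ 2) / (1 - l ^ 2) * V * (3 / b₀ + 9 * T * β ^ 2))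

set_option maxHeartbeats 1600000 in
omit h in
-- Every error total is bounded by initial data plus a multiple of SD and inserted into `rD`. The
-- feedbacks are μ/24 (consensus), μ/12 (averaged momentum error) and μ/24 (tracking), in all μ/6 <
-- 3μ/8, so SD is absorbed.
lemma sums_le_of_recursion {SX SX' SD SM Sv Ss SZ SY : ℝ} (hn : n ≠ 0) (hμ : 0 < μ)
    (hl0 : 0 ≤ l) (hl1 : l < 1) (hV : 0 ≤ V) (hB : 0 ≤ B)
    (hΓ : 0 ≤ Γ) (hα0 : 0 < α) (hβ0 : 0 < β) (hβ1 : β ≤ 1) (hb : b₀ ≠ 0) {γ q : ℝ}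
    (hγ : γ = l ^ 2 * (1 + l ^ 2) / (1 - l ^ 2)) (hq : q = l ^ 2 / (1 - l ^ 2) ^ 2)
    (hmain : 108 * L ^ 2 * (1 + 8 * q) * α ^ 2 ≤ n * μ ^ 2 * β)
    (hsmallX : 6 * L ^ 2 * q / μ * α ^ 2 ≤ μ / 24)
    (hsmallY : 81 * γ * L ^ 2 * (1 + 8 * q) / (μ * (1 - l ^ 2)) * α ^ 2 ≤ μ / 24)
    (pD : 0 ≤ SD)
    (sX : (1 - l ^ 2) / 2 * SX ≤ γ * α ^ 2 * SD)
    (sX' : SX' ≤ (1 - (1 - l ^ 2) / 2) * SX + γ * α ^ 2 * SD)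
    (sM : SM ≤ 3 * SX' + 3 * SX + 3 * α ^ 2 * SD)
    (sv : β * Sv ≤ V / (n ^ 2 * b₀) + (T * (2 * β ^ 2 * V / n ^ 2) + 2 * L ^ 2 / n ^ 2 * SM))
    (ss : β * Ss ≤ V / b₀ + (T * (2 * β ^ 2 * V) + 2 * L ^ 2 * SM))
    (sZ : SZ ≤ 3 * L ^ 2 * SM + 3 * β ^ 2 * Ss + T * (3 * β ^ 2 * V))
    (sY : (1 - l ^ 2) / 2 * SY ≤ 2 * (V / b₀) + 2 * Γ + γ * SZ)
    (rD : 3 * μ / 8 * SD ≤ n * B / α + 3 / (2 * μ) * (n * Sv + L ^ 2 * SX + SY)) :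
    SD ≤ 8 / μ * budget n μ l V B Γ α β b₀ T ∧ L ^ 2 * SX ≤ 8 * μ / 3 * budget n μ l V B Γ α β b₀ T
    ∧ n * Sv ≤ 8 * μ / 3 * budget n μ l V B Γ α β b₀ T
    ∧ SY ≤ 8 * μ / 3 * budget n μ l V B Γ α β b₀ T := by
  have hn' : (0 : ℝ) < n := by exact_mod_cast Nat.pos_of_ne_zero hn
  have hb' : (0 : ℝ) < b₀ := by exact_mod_cast Nat.pos_of_ne_zero hb
  have hr : 0 < 1 - l ^ 2 := by nlinarith
  have hγ0 : 0 ≤ γ := by rw [hγ]; positivity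
  have hq0 : 0 ≤ q := by rw [hq]; positivity
  have hγq : γ ≤ 2 * q * (1 - l ^ 2) := by
    rw [hγ, hq, div_le_iff₀ hr]
    have : 2 * (l ^ 2 / (1 - l ^ 2) ^ 2) * (1 - l ^ 2) * (1 - l ^ 2) = 2 * l ^ 2 := by field_simp
    rw [this]
    nlinarith
  have bX : SX ≤ 4 * q * α ^ 2 * SD := by
    have h1 : (1 - l ^ 2) / 2 * SX ≤ (1 - l ^ 2) / 2 * (4 * q * α ^ 2 * SD) := by
      have h2 := mul_le_mul_of_nonneg_right hγq (by positivity : 0 ≤ α ^ 2 * SD)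
      linarith only [h2, sX]
    exact le_of_mul_le_mul_left h1 (by positivity)
  have bX' : SX' ≤ 4 * q * α ^ 2 * SD := by
    have h2 := mul_le_mul_of_nonneg_right hγq (by positivity : 0 ≤ α ^ 2 * SD)
    have h3 := mul_le_mul_of_nonneg_left bX 
      (by linarith only [sq_nonneg l] : 0 ≤ 1 - (1 - l ^ 2) / 2)
    linarith only [h2, h3, sX']
  -- Both consensus sums contribute 3 · 4q, whence 3 + 24 q; this is the origin of the factor 1 + 8q
  -- in the step-size condition.
  have bM : SM ≤ 3 * (1 + 8 * q) * α ^ 2 * SD := by linarith only [bX, bX', sM]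
  have bv : β * Sv ≤ V / (n ^ 2 * b₀) + T * (2 * β ^ 2 * V / n ^ 2)
      + 6 * L ^ 2 * (1 + 8 * q) * α ^ 2 / n ^ 2 * SD := by
    have h1 := mul_le_mul_of_nonneg_left bM (by positivity : 0 ≤ 2 * L ^ 2 / (n : ℝ) ^ 2)
    have h2 : 2 * L ^ 2 / (n : ℝ) ^ 2 * (3 * (1 + 8 * q) * α ^ 2 * SD)
      = 6 * L ^ 2 * (1 + 8 * q) * α ^ 2 / n ^ 2 * SD := by ring
    linarith only [sv, h1, h2]
  have bs : β * Ss ≤ V / b₀ + T * (2 * β ^ 2 * V) + 6 * L ^ 2 * (1 + 8 * q) * α ^ 2 * SD := by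
    have h1 := mul_le_mul_of_nonneg_left bM (by positivity : 0 ≤ 2 * L ^ 2)
    linarith only [h1, ss]
  have bZ : SZ ≤ 27 * L ^ 2 * (1 + 8 * q) * α ^ 2 * SD + V * (3 / b₀ + 9 * T * β ^ 2) := by
    have h1 := mul_le_mul_of_nonneg_left bM (by positivity : 0 ≤ 3 * L ^ 2)
    -- Only β² Ss is needed, so one spare factor β ≤ 1 is discarded and no 1/β remains in front of
    -- SD.
    have h2 : β * (β * Ss) ≤ V / b₀ + T * (2 * β ^ 2 * V)
        + 6 * L ^ 2 * (1 + 8 * q) * α ^ 2 * SD := by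
      refine (mul_le_mul_of_nonneg_left bs hβ0.le).trans (mul_le_of_le_one_left ?_ hβ1)
      positivity
    have h3 : V * (3 / b₀ + 9 * T * β ^ 2) = 3 * (V / b₀) + 9 * T * β ^ 2 * V := by ring
    linarith only [h1, h2, h3, sZ]
  have bY : (1 - l ^ 2) / 2 * SY ≤ 2 * (V / b₀) + 2 * Γ + γ * V * (3 / b₀ + 9 * T * β ^ 2)
      + 27 * γ * L ^ 2 * (1 + 8 * q) * α ^ 2 * SD := by
    have h1 := mul_le_mul_of_nonneg_left bZ hγ0
    linarith only [h1, sY]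
  have nX : 3 / (2 * μ) * (L ^ 2 * SX) ≤ μ / 24 * SD := by
    have h1 := mul_le_mul_of_nonneg_left bX (by positivity : 0 ≤ 3 / (2 * μ) * L ^ 2)
    have h2 := mul_le_mul_of_nonneg_right hsmallX pD
    have h3 : 3 / (2 * μ) * L ^ 2 * (4 * q * α ^ 2 * SD) = 6 * L ^ 2 * q / μ * α ^ 2 * SD := by
      field_simp; ring
    linarith only [h1, h2, h3]
  -- The critical feedback: its coefficient is 9 L² (1 + 8q) α² / (μ n β), and `hmain` says
  -- precisely that this is at most μ / 12.
  have nv : 3 / (2 * μ) * (n * Sv)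
      ≤ 3 / (2 * μ * n) * (V / (β * b₀) + 2 * T * β * V) + μ / 12 * SD := by
    have h1 := mul_le_mul_of_nonneg_left bv (by positivity : 0 ≤ 3 * n / (2 * μ * β))
    have h2 : 3 * n / (2 * μ * β) * (β * Sv) = 3 / (2 * μ) * (n * Sv) := by field_simp
    have h3 : 3 * n / (2 * μ * β) * (V / (n ^ 2 * b₀) + T * (2 * β ^ 2 * V / n ^ 2)
      + 6 * L ^ 2 * (1 + 8 * q) * α ^ 2 / n ^ 2 * SD)
      = 3 / (2 * μ * n) * (V / (β * b₀) + 2 * T * β * V)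
        + (108 * L ^ 2 * (1 + 8 * q) * α ^ 2) * (SD / (12 * μ * n * β)) := by
      field_simp; ring
    have h4 := mul_le_mul_of_nonneg_right hmain (by positivity : 0 ≤ SD / (12 * μ * n * β))
    have h5 : n * μ ^ 2 * β * (SD / (12 * μ * n * β)) = μ / 12 * SD := by field_simp
    linarith only [h1, h2, h3, h4, h5]
  have nY : 3 / (2 * μ) * SY ≤ 3 / (μ * (1 - l ^ 2)) * (2 * (V / b₀) + 2 * Γ
      + γ * V * (3 / b₀ + 9 * T * β ^ 2)) + μ / 24 * SD := by
    have h1 := mul_le_mul_of_nonneg_left bY (by positivity : 0 ≤ 3 / (μ * (1 - l ^ 2)))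
    have h2 : 3 / (μ * (1 - l ^ 2)) * ((1 - l ^ 2) / 2 * SY) = 3 / (2 * μ) * SY := by field_simp
    have h3 := mul_le_mul_of_nonneg_right hsmallY pD
    have h4 : 3 / (μ * (1 - l ^ 2)) * (27 * γ * L ^ 2 * (1 + 8 * q) * α ^ 2 * SD)
      = 81 * γ * L ^ 2 * (1 + 8 * q) / (μ * (1 - l ^ 2)) * α ^ 2 * SD := by ring
    linarith only [h1, h2, h3, h4]
  have p1 : 0 ≤ n * B / α := by positivity
  have p2 : 0 ≤ 3 / (2 * μ * n) * (V / (β * b₀) + 2 * T * β * V) := by positivity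
  have p3 : 0 ≤ 3 / (μ * (1 - l ^ 2)) * (2 * (V / b₀) + 2 * Γ
    + γ * V * (3 / b₀ + 9 * T * β ^ 2)) := by positivity
  have hR : budget n μ l V B Γ α β b₀ T = n * B / α
      + 3 / (2 * μ * n) * (V / (β * b₀) + 2 * T * β * V) + 3 / (μ * (1 - l ^ 2)) * (2 * (V / b₀)
      + 2 * Γ + γ * V * (3 / b₀ + 9 * T * β ^ 2)) := by
    rw [hγ]; rfl
  set R := budget n μ l V B Γ α β b₀ T
  have hSD : μ / 8 * SD ≤ R := by
    have : 0 ≤ μ * SD := by positivity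
    linarith only [this, rD, nX, nv, nY, hR]
  -- The factor 4 is generous; it gives one common bound for the three error totals.
  have conv : ∀ w, 3 / (2 * μ) * w ≤ 4 * R → w ≤ 8 * μ / 3 * R := by
    intro w hw
    have h1 := mul_le_mul_of_nonneg_left hw (by positivity : 0 ≤ 2 * μ / 3)
    have h2 : 2 * μ / 3 * (3 / (2 * μ) * w) = w := by field_simp
    linarith only [h1, h2]
  have hμSD : 0 ≤ μ * SD := by positivity
  refine ⟨?_, conv _ (by linarith only [nX, hSD, hμSD]),
    conv _ (by linarith only [nv, hSD, hR, p1, p3, hμSD]),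
    conv _ (by linarith only [nY, hSD, hR, p1, p2, hμSD])⟩
  have h1 := mul_le_mul_of_nonneg_left hSD (by positivity : 0 ≤ 8 / μ)
  have h2 : 8 / μ * (μ / 8 * SD) = SD := by field_simp
  linarith only [h1, h2]

/-- Finiteness allows the recursions to be read in the reals, where they are summed over time; the
nonnegative terminal values are then dropped. -/
lemma real_bounds (hn : n ≠ 0) (hμ : 0 < μ) (hl0 : 0 ≤ l) (hl1 : l < 1) (hV : 0 ≤ V) (hB : 0 ≤ B)
    (hΓ : 0 ≤ Γ) (hα0 : 0 < α) (hβ0 : 0 < β) (hβ1 : β ≤ 1) (hb : b₀ ≠ 0)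
    (hmain : 108 * L ^ 2 * (1 + 8 * l ^ 2 / (1 - l ^ 2) ^ 2) * α ^ 2 ≤ n * μ ^ 2 * β)
    (hsmallX : 6 * L ^ 2 * (l ^ 2 / (1 - l ^ 2) ^ 2) / μ * α ^ 2 ≤ μ / 24)
    (hsmallY : 81 * (l ^ 2 * (1 + l ^ 2) / (1 - l ^ 2)) * L ^ 2
      * (1 + 8 * l ^ 2 / (1 - l ^ 2) ^ 2) / (μ * (1 - l ^ 2)) * α ^ 2 ≤ μ / 24) :
    ∑ t ∈ Finset.Icc 1 T, (D t).toReal ≤ 8 / μ * budget n μ l V B Γ α β b₀ T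
    ∧ L ^ 2 * ∑ t ∈ Finset.Icc 1 T, (X t).toReal ≤ 8 * μ / 3 * budget n μ l V B Γ α β b₀ T
    ∧ n * ∑ t ∈ Finset.Icc 1 T, (v t).toReal ≤ 8 * μ / 3 * budget n μ l V B Γ α β b₀ T
    ∧ ∑ t ∈ Finset.Icc 1 T, (Y t).toReal ≤ 8 * μ / 3 * budget n μ l V B Γ α β b₀ T := by
  have hn' : (0 : ℝ) < n := by exact_mod_cast Nat.pos_of_ne_zero hn
  have hb' : (0 : ℝ) < b₀ := by exact_mod_cast Nat.pos_of_ne_zero hb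
  have hr : 0 < 1 - l ^ 2 := by nlinarith
  have hfin := fun t (ht : 1 ≤ t) (htT : t ≤ T + 1) => h.ne_top hμ ht htT
  have hfin' : ∀ t, 1 ≤ t → t ≤ T → M t ≠ ∞ ∧ Z t ≠ ∞ := fun t ht htT =>
    (h.ne_top_of_D ht htT (hfin t ht (by omega)).1.1 (hfin t ht (by omega)).1.2.2.1
      ((hfin t ht (by omega)).2 htT)).2
  set γ := l ^ 2 * (1 + l ^ 2) / (1 - l ^ 2) with hγ
  have hγ0 : 0 ≤ γ := by positivity
  set q := l ^ 2 / (1 - l ^ 2) ^ 2 with hq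
  have hq0 : 0 ≤ q := by positivity
  have h8q : 8 * l ^ 2 / (1 - l ^ 2) ^ 2 = 8 * q := by rw [hq]; ring
  rw [h8q] at hmain hsmallY
  have h1β : 0 ≤ 1 - β := by linarith
  have rX : ∀ t, 1 ≤ t → t ≤ T → (X (t + 1)).toReal
      ≤ (1 - (1 - l ^ 2) / 2) * (X t).toReal + γ * α ^ 2 * (D t).toReal := by
    intro t ht htT
    obtain ⟨⟨hX, hv, hs, hY⟩, hD⟩ := hfin t ht (by omega)
    have hD := hD htT
    have h1 := toReal_le_mul_add (by positivity) (h.X_succ t ht htT) hX (by finiteness)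
    rw [ENNReal.toReal_mul, ENNReal.toReal_ofReal (by positivity)] at h1
    linarith
  have rM : ∀ t, 1 ≤ t → t ≤ T → (M t).toReal
      ≤ 3 * (X (t + 1)).toReal + 3 * (X t).toReal + 3 * α ^ 2 * (D t).toReal := by
    intro t ht htT
    obtain ⟨⟨hX, hv, hs, hY⟩, hD⟩ := hfin t ht (by omega)
    have hX' := (hfin (t + 1) (by omega) (by omega)).1.1
    have hD := hD htT
    have h1 := h.M_le t ht htT
    rw [add_assoc] at h1
    have h2 := toReal_le_mul_add (by positivity) h1 hX' (by finiteness)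
    rw [ENNReal.toReal_add (by finiteness) (by finiteness), ENNReal.toReal_mul, ENNReal.toReal_mul,
      ENNReal.toReal_ofReal (by positivity), ENNReal.toReal_ofReal (by positivity)] at h2
    linarith
  have rv : ∀ t, 1 ≤ t → t ≤ T → (v (t + 1)).toReal ≤ (1 - β) * (v t).toReal
      + (2 * β ^ 2 * V / n ^ 2 + 2 * L ^ 2 / n ^ 2 * (M t).toReal) := by
    intro t ht htT
    obtain ⟨⟨hX, hv, hs, hY⟩, hD⟩ := hfin t ht (by omega)
    obtain ⟨hM, hZ⟩ := hfin' t ht htT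
    have h1 := h.v_succ t ht htT
    rw [add_assoc] at h1
    have h2 := toReal_le_mul_add h1β h1 hv (by finiteness)
    rwa [ENNReal.toReal_add (by finiteness) (by finiteness), ENNReal.toReal_mul,
      ENNReal.toReal_ofReal (by positivity), ENNReal.toReal_ofReal (by positivity)] at h2
  have rs : ∀ t, 1 ≤ t → t ≤ T → (s (t + 1)).toReal ≤ (1 - β) * (s t).toReal
      + (2 * β ^ 2 * V + 2 * L ^ 2 * (M t).toReal) := by
    intro t ht htT
    obtain ⟨⟨hX, hv, hs, hY⟩, hD⟩ := hfin t ht (by omega)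
    obtain ⟨hM, hZ⟩ := hfin' t ht htT
    have h1 := h.s_succ t ht htT
    rw [add_assoc] at h1
    have h2 := toReal_le_mul_add h1β h1 hs (by finiteness)
    rwa [ENNReal.toReal_add (by finiteness) (by finiteness), ENNReal.toReal_mul,
      ENNReal.toReal_ofReal (by positivity), ENNReal.toReal_ofReal (by positivity)] at h2
  have rZ : ∀ t, 1 ≤ t → t ≤ T → (Z t).toReal ≤ 3 * L ^ 2 * (M t).toReal
      + 3 * β ^ 2 * (s t).toReal + 3 * β ^ 2 * V := by
    intro t ht htT
    obtain ⟨⟨hX, hv, hs, hY⟩, hD⟩ := hfin t ht (by omega)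
    obtain ⟨hM, hZ⟩ := hfin' t ht htT
    have h1 := h.Z_le t ht htT
    rw [add_assoc] at h1
    have h2 := toReal_le_mul_add (by positivity) h1 hM (by finiteness)
    rw [ENNReal.toReal_add (by finiteness) (by finiteness), ENNReal.toReal_mul,
      ENNReal.toReal_ofReal (by positivity), ENNReal.toReal_ofReal (by positivity)] at h2
    linarith
  have rY : ∀ t, 1 ≤ t → t ≤ T → (Y (t + 1)).toReal
      ≤ (1 - (1 - l ^ 2) / 2) * (Y t).toReal + γ * (Z t).toReal := by
    intro t ht htT
    obtain ⟨⟨hX, hv, hs, hY⟩, hD⟩ := hfin t ht (by omega)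
    obtain ⟨hM, hZ⟩ := hfin' t ht htT
    have h1 := toReal_le_mul_add (by positivity) (h.Y_succ t ht htT) hY (by finiteness)
    rw [ENNReal.toReal_mul, ENNReal.toReal_ofReal (by positivity)] at h1
    linarith
  have hsumD := h.D_sum T le_rfl
  have hXs : ∀ t ∈ Finset.Icc 1 T, X t ≠ ∞ ∧ v t ≠ ∞ ∧ Y t ≠ ∞ ∧ D t ≠ ∞ := fun t ht => by
    rw [Finset.mem_Icc] at ht
    obtain ⟨⟨hX, hv, hs, hY⟩, hD⟩ := hfin t ht.1 (by omega)
    exact ⟨hX, hv, hY, hD ht.2⟩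
  have rD : 3 * μ / 8 * ∑ t ∈ Finset.Icc 1 T, (D t).toReal ≤ n * B / α + 3 / (2 * μ) *
      (n * ∑ t ∈ Finset.Icc 1 T, (v t).toReal + L ^ 2 * ∑ t ∈ Finset.Icc 1 T, (X t).toReal
        + ∑ t ∈ Finset.Icc 1 T, (Y t).toReal) := by
    have hf : ∀ t ∈ Finset.Icc 1 T,
        ENNReal.ofReal n * v t + ENNReal.ofReal (L ^ 2) * X t + Y t ≠ ∞ := fun t ht => by
      obtain ⟨hX, hv, hY, hD⟩ := hXs t ht
      finiteness
    have hf2 := ENNReal.sum_ne_top.2 hf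
    rw [add_comm (ENNReal.ofReal (n * B / α))] at hsumD
    have h2 := toReal_le_mul_add (by positivity) hsumD hf2 (by finiteness)
    rw [ENNReal.toReal_mul, ENNReal.toReal_ofReal (by positivity),
      ENNReal.toReal_ofReal (by positivity), ENNReal.toReal_sum fun t ht => (hXs t ht).2.2.2,
      ENNReal.toReal_sum hf] at h2
    have h3 : ∀ t ∈ Finset.Icc 1 T,
        (ENNReal.ofReal n * v t + ENNReal.ofReal (L ^ 2) * X t + Y t).toReal
          = n * (v t).toReal + L ^ 2 * (X t).toReal + (Y t).toReal := fun t ht => by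
      obtain ⟨hX, hv, hY, hD⟩ := hXs t ht
      rw [ENNReal.toReal_add (by finiteness) hY, ENNReal.toReal_add (by finiteness) (by finiteness),
        ENNReal.toReal_mul, ENNReal.toReal_mul, ENNReal.toReal_ofReal (by positivity),
        ENNReal.toReal_ofReal (by positivity)]
    rw [Finset.sum_congr rfl h3, Finset.sum_add_distrib, Finset.sum_add_distrib, ← Finset.mul_sum,
      ← Finset.mul_sum] at h2
    linarith
  have iv : (v 1).toReal ≤ V / (n ^ 2 * b₀) :=
    ENNReal.toReal_le_of_le_ofReal (by positivity) h.v_one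
  have is : (s 1).toReal ≤ V / b₀ := ENNReal.toReal_le_of_le_ofReal (by positivity) h.s_one
  have iY : (Y 1).toReal ≤ 2 * (V / b₀) + 2 * Γ :=
    ENNReal.toReal_le_of_le_ofReal (by positivity) h.Y_one
  have sX := add_mul_sum_le_of_succ_le (a := fun t => (X t).toReal)
    (b := fun t => γ * α ^ 2 * (D t).toReal) rX
  have sv := add_mul_sum_le_of_succ_le (a := fun t => (v t).toReal)
    (b := fun t => 2 * β ^ 2 * V / n ^ 2 + 2 * L ^ 2 / n ^ 2 * (M t).toReal) rv
  have ss := add_mul_sum_le_of_succ_le (a := fun t => (s t).toReal)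
    (b := fun t => 2 * β ^ 2 * V + 2 * L ^ 2 * (M t).toReal) rs
  have sY := add_mul_sum_le_of_succ_le (a := fun t => (Y t).toReal)
    (b := fun t => γ * (Z t).toReal) rY
  have sX' := Finset.sum_le_sum fun t (ht : t ∈ Finset.Icc 1 T) =>
    rX t (Finset.mem_Icc.1 ht).1 (Finset.mem_Icc.1 ht).2
  have sM := Finset.sum_le_sum fun t (ht : t ∈ Finset.Icc 1 T) =>
    rM t (Finset.mem_Icc.1 ht).1 (Finset.mem_Icc.1 ht).2
  have sZ := Finset.sum_le_sum fun t (ht : t ∈ Finset.Icc 1 T) =>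
    rZ t (Finset.mem_Icc.1 ht).1 (Finset.mem_Icc.1 ht).2
  simp only [Finset.sum_add_distrib, ← Finset.mul_sum, Finset.sum_const, Nat.card_Icc,
    add_tsub_cancel_right, nsmul_eq_mul] at sX sv ss sY sX' sM sZ
  rw [h.X_one, ENNReal.toReal_zero, zero_add] at sX
  have pX := ENNReal.toReal_nonneg (a := X (T + 1))
  have pv := ENNReal.toReal_nonneg (a := v (T + 1))
  have ps := ENNReal.toReal_nonneg (a := s (T + 1))
  have pY := ENNReal.toReal_nonneg (a := Y (T + 1))
  have pD : 0 ≤ ∑ t ∈ Finset.Icc 1 T, (D t).toReal :=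
    Finset.sum_nonneg fun _ _ => ENNReal.toReal_nonneg
  exact sums_le_of_recursion (Ss := ∑ t ∈ Finset.Icc 1 T, (s t).toReal)
    (SZ := ∑ t ∈ Finset.Icc 1 T, (Z t).toReal)
    hn hμ hl0 hl1 hV hB hΓ hα0 hβ0 hβ1 hb hγ hq hmain hsmallX hsmallY pD
    (by linarith only [sX, pX]) sX' sM (by linarith only [sv, pv, iv])
    (by linarith only [ss, ps, is]) (by linarith only [sZ]) (by linarith only [sY, pY, iY]) rD

end EnergyRecursion

end Recursion

open EnergyRecursion

lemma sfoCalls_eq (n b₀ T : ℕ) : sfoCalls n b₀ T = n * (b₀ + 2 * T) := by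
  simp [sfoCalls, mul_comm]

/-! ### The rate of the stationary gap -/

section Rate

variable {n d : ℕ} {Ξ Ω : Type*} [MeasurableSpace Ξ]
  {P : Problem n d Ξ} {fhat : Fin n → Vec d → Vec d → Ξ → ℝ} {W : Matrix (Fin n) (Fin n) ℝ}
  {ξ : Fin n → ℕ → ℕ → Ω → Ξ} {L μ Ls α β : ℝ} {σ : Fin n → ℝ} {b₀ T : ℕ} {x₁ : Vec d}
  {x xhat z y : Fin n → ℕ → Ω → Vec d} [MeasurableSpace Ω] {Pr : Measure Ω}
  [IsProbabilityMeasure Pr]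

section

variable (hR : IsRun P fhat W ξ α β b₀ T x₁ x xhat z y) (hξ : IsSampling P Pr ξ)
  (hP : P.Assumptions L σ) (hS : P.SurrogateAssumptions fhat μ Ls) (hL : 0 ≤ L) (hμ : 0 < μ)
  (hb : b₀ ≠ 0) (hx₁ : x₁ ∈ P.feasible)
include hR hξ hP hS hL hμ hb hx₁

lemma IsRun.energyRecursion (hn : n ≠ 0) (hW : W ∈ doublyStochastic ℝ (Fin n))
    (hlam : lambdaW W < 1) {V B Γ : ℝ} (hV : ∑ i, σ i ^ 2 ≤ V) (hB0 : 0 ≤ B)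
    (hB : P.U x₁ - P.optValue ≤ B) (hΓ : ∑ i, ‖gradient (P.u i) x₁‖ ^ 2 ≤ Γ) (hα0 : 0 < α)
    (hα1 : α ≤ 1) (hLα : L * α ≤ μ / 8) (hβ0 : 0 ≤ β) (hβ1 : β ≤ 1) :
    EnergyRecursion n μ L (lambdaW W) V B Γ α β b₀ T (fun t => ex Pr (stepSq x xhat t))
      (fun t => ex Pr (dispAt x t)) (fun t => ex Pr (incrSq x t))
      (fun t => ex Pr (avgErrSq P x z t)) (fun t => ex Pr (errSq P x z t))
      (fun t => ex Pr (incrSq z t)) (fun t => ex Pr (dispAt y t)) where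
  X_one := by simp [ex, hR.dispAt_x_one hn]
  X_succ _ := hR.ex_dispAt_x_succ_le hξ hP hS hL hμ hb hx₁ hn hW hlam
  M_le _ := hR.ex_incrSq_x_le hξ hP hS hL hμ hb hx₁ hn hW
  v_one := hR.ex_avgErrSq_one_le hξ hP hS hL hμ hb hx₁ hV
  v_succ _ := hR.ex_avgErrSq_succ_le hξ hP hS hL hμ hb hx₁ hβ0 hβ1 hV
  s_one := hR.ex_errSq_one_le hξ hP hS hL hμ hb hx₁ hV
  s_succ _ := hR.ex_errSq_succ_le hξ hP hS hL hμ hb hx₁ hβ0 hβ1 hV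
  Z_le _ := hR.ex_incrSq_z_le hξ hP hS hL hμ hb hx₁ hV
  Y_one := hR.ex_dispAt_y_one_le hξ hP hS hL hμ hb hx₁ hn hV hΓ
  Y_succ _ := hR.ex_dispAt_y_succ_le hξ hP hS hL hμ hb hx₁ hn hW hlam
  D_sum _ := hR.ex_sum_stepSq_le hξ hP hS hL hμ hb hx₁ hn hW hα0 hα1 hLα hB0 hB

lemma IsRun.meanSquaredGap_le (hn : n ≠ 0) (hW : W ∈ doublyStochastic ℝ (Fin n))
    (hlam : lambdaW W < 1) {V B Γ : ℝ} (hV : ∑ i, σ i ^ 2 ≤ V) (hB0 : 0 ≤ B)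
    (hB : P.U x₁ - P.optValue ≤ B) (hΓ : ∑ i, ‖gradient (P.u i) x₁‖ ^ 2 ≤ Γ) (hα0 : 0 < α)
    (hα1 : α ≤ 1) (hLα : L * α ≤ μ / 8) (hβ0 : 0 < β) (hβ1 : β ≤ 1)
    (hmain : 108 * L ^ 2 * (1 + 8 * lambdaW W ^ 2 / (1 - lambdaW W ^ 2) ^ 2) * α ^ 2
      ≤ n * μ ^ 2 * β)
    (hsmallX : 6 * L ^ 2 * (lambdaW W ^ 2 / (1 - lambdaW W ^ 2) ^ 2) / μ * α ^ 2 ≤ μ / 24)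
    (hsmallY : 81 * (lambdaW W ^ 2 * (1 + lambdaW W ^ 2) / (1 - lambdaW W ^ 2)) * L ^ 2
      * (1 + 8 * lambdaW W ^ 2 / (1 - lambdaW W ^ 2) ^ 2) / (μ * (1 - lambdaW W ^ 2)) * α ^ 2
        ≤ μ / 24) (hT : T ≠ 0) :
    meanSquaredGap P Pr T xhat (subgrad P fhat ξ β b₀ x xhat z y)
      ≤ ENNReal.ofReal ((48 * (L ^ 2 + Ls ^ 2) / μ + 64 * μ)
        * budget n μ (lambdaW W) V B Γ α β b₀ T / T) := by
  have hV0 : 0 ≤ V := (Finset.sum_nonneg fun i _ => sq_nonneg _).trans hV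
  have hΓ0 : 0 ≤ Γ := (Finset.sum_nonneg fun i _ => sq_nonneg _).trans hΓ
  have hE := hR.energyRecursion hξ hP hS hL hμ hb hx₁ hn hW hlam hV hB0 hB hΓ hα0 hα1 hLα hβ0.le hβ1
  obtain ⟨hD, hX, hv, hY⟩ := hE.real_bounds hn hμ (lambdaW_nonneg W) hlam hV0 hB0 hΓ0 hα0 hβ0 hβ1
    hb hmain hsmallX hsmallY
  have hfin : ∀ t ∈ Finset.Icc 1 T, ex Pr (dispAt x t) ≠ ∞ ∧ ex Pr (avgErrSq P x z t) ≠ ∞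
      ∧ ex Pr (dispAt y t) ≠ ∞ ∧ ex Pr (stepSq x xhat t) ≠ ∞ := fun t ht => by
    rw [Finset.mem_Icc] at ht
    obtain ⟨⟨h1, h2, -, h3⟩, h4⟩ := hE.ne_top hμ ht.1 (by omega)
    exact ⟨h1, h2, h3, h4 ht.2⟩
  have hsum : ∀ {a : ℕ → ℝ≥0∞}, (∀ t ∈ Finset.Icc 1 T, a t ≠ ∞) →
      ∑ t ∈ Finset.Icc 1 T, a t = ENNReal.ofReal (∑ t ∈ Finset.Icc 1 T, (a t).toReal) :=
    fun {a} ha => by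
      rw [← ENNReal.toReal_sum ha, ENNReal.ofReal_toReal (ENNReal.sum_ne_top.2 ha)]
  set R := budget n μ (lambdaW W) V B Γ α β b₀ T
  have hpos : ∀ a : ℕ → ℝ≥0∞, 0 ≤ ∑ t ∈ Finset.Icc 1 T, (a t).toReal := fun a =>
    Finset.sum_nonneg fun _ _ => ENNReal.toReal_nonneg
  have hT' : (0 : ℝ) < T := by exact_mod_cast Nat.pos_of_ne_zero hT
  have key : ∑ t ∈ Finset.Icc 1 T, ∑ i,
      ∫⁻ ω, ‖gradient P.uAvg (xhat i t ω) + subgrad P fhat ξ β b₀ x xhat z y i t ω‖ₑ ^ 2 ∂Pr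
      ≤ ENNReal.ofReal ((48 * (L ^ 2 + Ls ^ 2) / μ + 64 * μ) * R) := by
    refine (Finset.sum_le_sum fun t ht => hR.ex_sum_gap_le hξ hP hS hL hμ hb hx₁ hn hW
      (Finset.mem_Icc.1 ht).1 (Finset.mem_Icc.1 ht).2).trans ?_
    simp only [Finset.sum_add_distrib, ← Finset.mul_sum]
    rw [hsum fun t ht => (hfin t ht).1, hsum fun t ht => (hfin t ht).2.1,
      hsum fun t ht => (hfin t ht).2.2.1, hsum fun t ht => (hfin t ht).2.2.2]
    have pD := hpos fun t => ex Pr (stepSq x xhat t)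
    have pX := hpos fun t => ex Pr (dispAt x t)
    have pv := hpos fun t => ex Pr (avgErrSq P x z t)
    have pY := hpos fun t => ex Pr (dispAt y t)
    rw [← ENNReal.ofReal_mul (by positivity), ← ENNReal.ofReal_mul (by positivity),
      ← ENNReal.ofReal_mul (by positivity), ← ENNReal.ofReal_mul (by positivity),
      ← ENNReal.ofReal_add (by positivity) (by positivity),
      ← ENNReal.ofReal_add (by positivity) (by positivity),
      ← ENNReal.ofReal_add (by positivity) (by positivity)]
    refine ENNReal.ofReal_le_ofReal ?_
    have h1 := mul_le_mul_of_nonneg_left hD (by positivity : 0 ≤ 6 * (L ^ 2 + Ls ^ 2))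
    have h2 : 6 * (L ^ 2 + Ls ^ 2) * (8 / μ * R) = 48 * (L ^ 2 + Ls ^ 2) / μ * R := by ring
    -- The three error totals contribute (12 + 6 + 6) · 8μ/3 = 64 μ.
    linarith only [h1, h2, hX, hv, hY]
  -- The average over agents is simply bounded by the sum.
  have hn1 : (n : ℝ≥0∞)⁻¹ ≤ 1 :=
    ENNReal.inv_le_one.2 (by exact_mod_cast Nat.one_le_iff_ne_zero.2 hn)
  rw [meanSquaredGap, ← Finset.mul_sum, Finset.sum_comm]
  refine (mul_le_of_le_one_left zero_le hn1).trans ?_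
  rw [ENNReal.ofReal_div_of_pos hT', ENNReal.ofReal_natCast, div_eq_mul_inv, mul_comm]
  gcongr

end

/-- The rate constant of the accumulated squared steps: `budget ≤ budgetRate * T ^ (1 / 3)`. -/
def budgetRate (n : ℕ) (μ l V B Γ a₁ k₁ k₂ b₁ : ℝ) : ℝ :=
  n * B / a₁ + 3 / (2 * μ * n) * (V / (k₁ * b₁) + 2 * k₂ * V)
    + 3 / (μ * (1 - l ^ 2)) * (2 * V + 2 * Γ
      + l ^ 2 * (1 + l ^ 2) / (1 - l ^ 2) * V * (3 + 9 * k₂ ^ 2))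

/-- With τ = T^(1/3), the terms B/α, V/(β b₀) and T β V are genuinely of order τ. The others are of
lower order and are inflated to τ using τ ≥ 1 and b₀ ≥ 1. -/
lemma budget_le_budgetRate_mul {l V B Γ a₁ k₁ k₂ b₁ τ : ℝ} (hμ : 0 < μ) (hl0 : 0 ≤ l) (hl1 : l < 1)
    (hV : 0 ≤ V) (hB : 0 ≤ B) (hΓ : 0 ≤ Γ) (ha₁ : 0 < a₁) (hk₁ : 0 < k₁) (hb₁ : 0 < b₁)
    (hτ : 1 ≤ τ) (hT : (T : ℝ) = τ ^ 3) (hα : a₁ / τ ≤ α) (hβ : k₁ / τ ^ 2 ≤ β)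
    (hβ' : β ≤ k₂ / τ ^ 2) (hb : b₀ ≠ 0) (hb₀ : b₁ * τ ≤ b₀) :
    budget n μ l V B Γ α β b₀ T ≤ budgetRate n μ l V B Γ a₁ k₁ k₂ b₁ * τ := by
  have hr : 0 < 1 - l ^ 2 := by nlinarith
  have hτ0 : 0 < τ := by linarith
  have hβ0 : 0 < β := lt_of_lt_of_le (by positivity) hβ
  have hb1 : (1 : ℝ) ≤ b₀ := by exact_mod_cast Nat.one_le_iff_ne_zero.2 hb
  have h1 : n * B / α ≤ n * B / a₁ * τ :=
    calc n * B / α ≤ n * B / (a₁ / τ) := by gcongr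
      _ = n * B / a₁ * τ := by field_simp
  have h2 : V / (β * b₀) ≤ V / (k₁ * b₁) * τ :=
    calc V / (β * b₀) ≤ V / (k₁ / τ ^ 2 * (b₁ * τ)) := by gcongr
      _ = V / (k₁ * b₁) * τ := by field_simp
  have h3 : T * β ≤ k₂ * τ :=
    calc T * β ≤ τ ^ 3 * (k₂ / τ ^ 2) := by rw [hT]; gcongr
      _ = k₂ * τ := by field_simp
  have h4 : V / b₀ ≤ V * τ :=
    (div_le_self hV hb1).trans (le_mul_of_one_le_right hV hτ)
  have h5 : T * β ^ 2 ≤ k₂ ^ 2 * τ :=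
    calc T * β ^ 2 ≤ τ ^ 3 * (k₂ / τ ^ 2) ^ 2 := by rw [hT]; gcongr
      _ = k₂ ^ 2 * (1 / τ) := by field_simp
      _ ≤ k₂ ^ 2 * τ := by
        gcongr
        exact (div_le_self zero_le_one hτ).trans hτ
  have h6 : (3 : ℝ) / b₀ ≤ 3 * τ :=
    (div_le_self (by norm_num) hb1).trans (le_mul_of_one_le_right (by norm_num) hτ)
  have h7 : Γ ≤ Γ * τ := le_mul_of_one_le_right hΓ hτ
  calc budget n μ l V B Γ α β b₀ T
      = n * B / α + 3 / (2 * μ * n) * (V / (β * b₀) + 2 * V * (T * β))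
        + 3 / (μ * (1 - l ^ 2)) * (2 * (V / b₀) + 2 * Γ
          + l ^ 2 * (1 + l ^ 2) / (1 - l ^ 2) * V * (3 / b₀ + 9 * (T * β ^ 2))) := by
        rw [budget]; ring
    _ ≤ n * B / a₁ * τ + 3 / (2 * μ * n) * (V / (k₁ * b₁) * τ + 2 * V * (k₂ * τ))
        + 3 / (μ * (1 - l ^ 2)) * (2 * (V * τ) + 2 * (Γ * τ)
          + l ^ 2 * (1 + l ^ 2) / (1 - l ^ 2) * V * (3 * τ + 9 * (k₂ ^ 2 * τ))) := by
        gcongr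
    _ = _ := by rw [budgetRate]; ring

/-- The bounds by c ≤ τ make T large enough for α, β ≤ 1, for L α ≤ μ/8 and for the two small
feedbacks; `hmain` alone must be assumed, since α²/β does not shrink with T. -/
lemma IsRun.meanSquaredGap_le_of_stepSizes {l V B Γ a₁ a₂ k₁ k₂ b₁ c τ ε : ℝ}
    (hR : IsRun P fhat W ξ α β b₀ T x₁ x xhat z y) (hξ : IsSampling P Pr ξ)
    (hP : P.Assumptions L σ) (hS : P.SurrogateAssumptions fhat μ Ls) (hL : 0 ≤ L) (hμ : 0 < μ)
    (hx₁ : x₁ ∈ P.feasible) (hn : n ≠ 0) (hW : W ∈ doublyStochastic ℝ (Fin n))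
    (hl : lambdaW W = l) (hlam : l < 1) (hV : ∑ i, σ i ^ 2 ≤ V) (hB0 : 0 ≤ B)
    (hB : P.U x₁ - P.optValue ≤ B) (hΓ : ∑ i, ‖gradient (P.u i) x₁‖ ^ 2 ≤ Γ)
    (ha₁ : 0 < a₁) (hk₁ : 0 < k₁) (hb₁ : 0 < b₁) (hT : (T : ℝ) = τ ^ 3)
    (hα : a₁ / τ ≤ α) (hα' : α ≤ a₂ / τ) (hβ : k₁ / τ ^ 2 ≤ β) (hβ' : β ≤ k₂ / τ ^ 2)
    (hb₀ : b₁ * τ ≤ b₀)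
    (hmain : 108 * L ^ 2 * (1 + 8 * l ^ 2 / (1 - l ^ 2) ^ 2) * α ^ 2 ≤ n * μ ^ 2 * β)
    (hc1 : 1 ≤ c) (hca : a₂ ≤ c) (hcL : 8 * L * a₂ / μ ≤ c) (hck : k₂ ≤ c)
    (hcX : 24 * (6 * L ^ 2 * (l ^ 2 / (1 - l ^ 2) ^ 2) / μ) * a₂ ^ 2 / μ ≤ c)
    (hcY : 24 * (81 * (l ^ 2 * (1 + l ^ 2) / (1 - l ^ 2)) * L ^ 2
      * (1 + 8 * l ^ 2 / (1 - l ^ 2) ^ 2) / (μ * (1 - l ^ 2))) * a₂ ^ 2 / μ ≤ c)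
    (hcτ : c ≤ τ)
    (hε : (48 * (L ^ 2 + Ls ^ 2) / μ + 64 * μ) * budgetRate n μ l V B Γ a₁ k₁ k₂ b₁ ≤ ε * τ ^ 2) :
    meanSquaredGap P Pr T xhat (subgrad P fhat ξ β b₀ x xhat z y) ≤ ENNReal.ofReal ε := by
  subst hl
  have hτ1 : 1 ≤ τ := hc1.trans hcτ
  have hτ0 : 0 < τ := by linarith
  have hl0 := lambdaW_nonneg W
  have hr : 0 < 1 - lambdaW W ^ 2 := by nlinarith
  have hα0 : 0 < α := lt_of_lt_of_le (by positivity) hα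
  have hβ0 : 0 < β := lt_of_lt_of_le (by positivity) hβ
  have hV0 : 0 ≤ V := (Finset.sum_nonneg fun i _ => sq_nonneg _).trans hV
  have hΓ0 : 0 ≤ Γ := (Finset.sum_nonneg fun i _ => sq_nonneg _).trans hΓ
  have hb : b₀ ≠ 0 := by
    rintro rfl
    have : 0 < b₁ * τ := by positivity
    rw [Nat.cast_zero] at hb₀
    linarith
  have hατ : α * τ ≤ a₂ := (le_div_iff₀ hτ0).1 hα'
  have hα1 : α ≤ 1 := by
    refine hα'.trans ((div_le_one hτ0).2 (hca.trans hcτ))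
  have hβ1 : β ≤ 1 := by
    refine hβ'.trans ((div_le_one (by positivity)).2 ((hck.trans hcτ).trans ?_))
    exact le_self_pow₀ hτ1 two_ne_zero
  have hLα : L * α ≤ μ / 8 := by
    have h1 := (div_le_iff₀ hμ).1 (hcL.trans hcτ)
    have h2 := mul_le_mul_of_nonneg_left hατ hL
    refine le_of_mul_le_mul_right ?_ hτ0
    linarith
  -- α² decays like τ^(-2); one power of τ is given up so that the thresholds are linear in c.
  have hα2 : α ^ 2 * τ ≤ a₂ ^ 2 :=
    calc α ^ 2 * τ ≤ α ^ 2 * τ ^ 2 := by gcongr; exact le_self_pow₀ hτ1 two_ne_zero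
      _ = (α * τ) ^ 2 := by ring
      _ ≤ a₂ ^ 2 := by gcongr
  have hsmall : ∀ A : ℝ, 0 ≤ A → 24 * A * a₂ ^ 2 / μ ≤ c → A * α ^ 2 ≤ μ / 24 := by
    intro A hA h
    have h1 := (div_le_iff₀ hμ).1 (h.trans hcτ)
    have h2 := mul_le_mul_of_nonneg_left hα2 hA
    refine le_of_mul_le_mul_right ?_ hτ0
    linarith
  have hT0 : T ≠ 0 := by
    rintro rfl
    rw [Nat.cast_zero] at hT
    exact (pow_pos hτ0 3).ne hT
  refine (hR.meanSquaredGap_le hξ hP hS hL hμ hb hx₁ hn hW hlam hV hB0 hB hΓ hα0 hα1 hLα hβ0 hβ1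
    hmain (hsmall _ (by positivity) hcX) (hsmall _ (by positivity) hcY) hT0).trans
    (ENNReal.ofReal_le_ofReal ?_)
  have h1 := budget_le_budgetRate_mul (n := n) hμ hl0 hlam hV0 hB0 hΓ0 ha₁ hk₁ hb₁ hτ1 hT hα hβ hβ'
    hb hb₀
  have h2 : (0 : ℝ) ≤ 48 * (L ^ 2 + Ls ^ 2) / μ + 64 * μ := by positivity
  rw [hT, div_le_iff₀ (by positivity)]
  calc _ ≤ (48 * (L ^ 2 + Ls ^ 2) / μ + 64 * μ)
        * (budgetRate n μ (lambdaW W) V B Γ a₁ k₁ k₂ b₁ * τ) := mul_le_mul_of_nonneg_left h1 h2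
    _ = (48 * (L ^ 2 + Ls ^ 2) / μ + 64 * μ)
        * budgetRate n μ (lambdaW W) V B Γ a₁ k₁ k₂ b₁ * τ := by ring
    _ ≤ ε * τ ^ 2 * τ := by gcongr
    _ = ε * τ ^ 3 := by ring

end Rate

end DMSSCA

end

/-! ### Choice of the constants and the oracle count -/

theorem corollary1 (n : ℕ)
    -- constants of the problem
    (L Ls μ lam V B Γ : ℝ) (hL : 0 ≤ L) (hμ : 0 < μ)
    -- constants of the orders of `α`, `β` and `b₀`
    (a₁ a₂ k₁ k₂ b₁ b₂ : ℝ) (ha₁ : 0 < a₁) (hk₁ : 0 < k₁) (hb₁ : 0 < b₁) :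
    ∃ c C : ℝ, 0 < c ∧ 0 < C ∧
      ∀ ε : ℝ, 0 < ε → ε ≤ 1 → ∀ T : ℕ, T = ⌈c * ε ^ (-(3 / 2) : ℝ)⌉₊ →
      ∀ (d : ℕ) (Ξ : Type*) [MeasurableSpace Ξ] (Ω : Type*) [MeasurableSpace Ω]
        (Pr : MeasureTheory.Measure Ω) [MeasureTheory.IsProbabilityMeasure Pr]
        (P : DMSSCA.Problem n d Ξ) (fhat : Fin n → DMSSCA.Vec d → DMSSCA.Vec d → Ξ → ℝ)
        (G : SimpleGraph (Fin n)) (W : Matrix (Fin n) (Fin n) ℝ) (σ : Fin n → ℝ)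
        (x₁ : DMSSCA.Vec d) (ξ : Fin n → ℕ → ℕ → Ω → Ξ),
        P.Assumptions L σ → P.SurrogateAssumptions fhat μ Ls →
        DMSSCA.NetworkAssumptions G W → DMSSCA.IsSampling P Pr ξ →
        x₁ ∈ P.feasible →
        DMSSCA.lambdaW W = lam →
        ∑ i, σ i ^ 2 ≤ V →
        P.U x₁ - P.optValue ≤ B →
        ∑ i, ‖gradient (P.u i) x₁‖ ^ 2 ≤ Γ →
      ∀ (α β : ℝ) (b₀ : ℕ),
        a₁ * (T : ℝ) ^ (-(1 / 3) : ℝ) ≤ α → α ≤ a₂ * (T : ℝ) ^ (-(1 / 3) : ℝ) →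
        k₁ * (T : ℝ) ^ (-(2 / 3) : ℝ) ≤ β → β ≤ k₂ * (T : ℝ) ^ (-(2 / 3) : ℝ) →
        b₁ * (T : ℝ) ^ (1 / 3 : ℝ) ≤ b₀ → (b₀ : ℝ) ≤ b₂ * (T : ℝ) ^ (1 / 3 : ℝ) →
        108 * L ^ 2 * (1 + 8 * lam ^ 2 / (1 - lam ^ 2) ^ 2) * α ^ 2 ≤ n * μ ^ 2 * β →
      ∀ x xhat z y : Fin n → ℕ → Ω → DMSSCA.Vec d,
        DMSSCA.IsRun P fhat W ξ α β b₀ T x₁ x xhat z y →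
        DMSSCA.IsEpsKKT P Pr T xhat ε ∧
          (DMSSCA.sfoCalls n b₀ T : ℝ) ≤ C * ε ^ (-(3 / 2) : ℝ) := by
  set A := 24 * (6 * L ^ 2 * (lam ^ 2 / (1 - lam ^ 2) ^ 2) / μ) * a₂ ^ 2 / μ with hA
  set A' := 24 * (81 * (lam ^ 2 * (1 + lam ^ 2) / (1 - lam ^ 2)) * L ^ 2
      * (1 + 8 * lam ^ 2 / (1 - lam ^ 2) ^ 2) / (μ * (1 - lam ^ 2))) * a₂ ^ 2 / μ with hA'
  set K := (48 * (L ^ 2 + Ls ^ 2) / μ + 64 * μ)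
    * DMSSCA.budgetRate n μ lam V B Γ a₁ k₁ k₂ b₁ with hK
  -- The constants are fixed before any run is given, so the signs of these quantities are not yet
  -- known (nor is lam < 1); absolute values make c dominate each of them.
  set c := 1 + |a₂| + |8 * L * a₂ / μ| + |k₂| + |A| + |A'| + |K| with hc
  have q1 := abs_nonneg a₂
  have q2 := abs_nonneg (8 * L * a₂ / μ)
  have q3 := abs_nonneg k₂
  have q4 := abs_nonneg A
  have q5 := abs_nonneg A'
  have q6 := abs_nonneg K
  have hc1 : 1 ≤ c := by linarith
  have hc0 : 0 < c := by linarith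
  -- The cube makes T^(1/3) at least c ε^(-1/2). In the second constant, c³ + 1 absorbs the rounding
  -- up of T, and the final + 1 ensures positivity even for n = 0.
  refine ⟨c ^ 3, n * (|b₂| + 2) * (c ^ 3 + 1) + 1, by positivity, by positivity, ?_⟩
  intro ε hε0 hε1 T hT d Ξ _ Ω _ Pr _ P fhat G W σ x₁ ξ hP hS hNet hξ hx₁ hlam hV hB hΓ α β b₀
    hα hα' hβ hβ' hb₀ hb₀' hmain x xhat z y hR
  set η := ε ^ (-(1 / 2) : ℝ) with hη
  have hη0 : 0 < η := Real.rpow_pos_of_pos hε0 _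
  have hη1 : 1 ≤ η := Real.one_le_rpow_of_pos_of_le_one_of_nonpos hε0 hε1 (by norm_num)
  have hη3 : ε ^ (-(3 / 2) : ℝ) = η ^ 3 := by
    rw [hη, ← Real.rpow_mul_natCast hε0.le]; norm_num
  have hη2 : ε * η ^ 2 = 1 := by
    rw [hη, ← Real.rpow_mul_natCast hε0.le]
    norm_num [Real.rpow_neg_one, hε0.ne']
  set τ := (T : ℝ) ^ (1 / 3 : ℝ) with hτ
  have hτn : 0 ≤ τ := Real.rpow_nonneg T.cast_nonneg _
  have hTτ : (T : ℝ) = τ ^ 3 := by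
    rw [hτ, ← Real.rpow_mul_natCast T.cast_nonneg]; norm_num
  have h13 : (T : ℝ) ^ (-(1 / 3) : ℝ) = τ⁻¹ := by rw [hτ, Real.rpow_neg T.cast_nonneg]
  have h23 : (T : ℝ) ^ (-(2 / 3) : ℝ) = (τ ^ 2)⁻¹ := by
    rw [hτ, Real.rpow_neg T.cast_nonneg, ← Real.rpow_mul_natCast T.cast_nonneg]; norm_num
  rw [h13, ← div_eq_mul_inv] at hα hα'
  rw [h23, ← div_eq_mul_inv] at hβ hβ'
  rw [hη3] at hT ⊢
  have hcη : c * η ≤ τ := by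
    refine (pow_le_pow_iff_left₀ (by positivity) hτn three_ne_zero).1 ?_
    rw [mul_pow, ← hTτ, hT]
    exact Nat.le_ceil _
  have hcτ : c ≤ τ := (le_mul_of_one_le_right hc0.le hη1).trans hcη
  -- B is an arbitrary real in the statement; feasibility of the starting point forces it to be
  -- nonnegative.
  have hB0 : 0 ≤ B := by
    have h1 : P.optValue ≤ P.U x₁ := csInf_le hP.bddBelow ⟨x₁, hx₁, rfl⟩
    linarith
  have hτ1 : 1 ≤ τ := hc1.trans hcτ
  have hb : b₀ ≠ 0 := by
    rintro rfl
    have : 0 < b₁ * τ := by positivity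
    rw [Nat.cast_zero] at hb₀
    linarith
  -- The accuracy requirement: since ε η² = 1, the bound τ ≥ c η gives ε τ² ≥ c² ≥ c ≥ K.
  have hKε : K ≤ ε * τ ^ 2 :=
    calc K ≤ c := by linarith [le_abs_self K]
      _ ≤ c ^ 2 := le_self_pow₀ hc1 two_ne_zero
      _ = ε * (c * η) ^ 2 := by rw [mul_pow]; linear_combination (-c ^ 2) * hη2
      _ ≤ ε * τ ^ 2 := by gcongr
  refine ⟨⟨DMSSCA.subgrad P fhat ξ β b₀ x xhat z y,
    fun i t ht htT => hR.measurable_subgrad hξ hP hS hμ hb hx₁ ht htT i,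
    fun i t ω ht htT => hR.subgrad_mem hP hS hb i ht htT ω,
    hR.meanSquaredGap_le_of_stepSizes hξ hP hS hL hμ hx₁ hNet.pos hNet.doublyStochastic hlam
      (hlam ▸ hNet.lambdaW_lt_one) hV hB0 hB hΓ ha₁ hk₁ hb₁ hTτ hα hα' hβ hβ' hb₀ hmain hc1
      (by linarith [le_abs_self a₂]) (by linarith [le_abs_self (8 * L * a₂ / μ)])
      (by linarith [le_abs_self k₂]) (by linarith [le_abs_self A]) (by linarith [le_abs_self A'])
      hcτ hKε⟩, ?_⟩
  have hTη : (T : ℝ) ≤ (c ^ 3 + 1) * η ^ 3 := by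
    have h1 : (T : ℝ) < c ^ 3 * η ^ 3 + 1 := hT ▸ Nat.ceil_lt_add_one (by positivity)
    have h2 : 1 ≤ η ^ 3 := one_le_pow₀ hη1
    linarith
  have hbT : (b₀ : ℝ) ≤ |b₂| * T :=
    calc (b₀ : ℝ) ≤ b₂ * τ := hb₀'
      _ ≤ |b₂| * τ := by gcongr; exact le_abs_self b₂
      _ ≤ |b₂| * T := by rw [hTτ]; gcongr; exact le_self_pow₀ hτ1 three_ne_zero
  rw [DMSSCA.sfoCalls_eq]
  push_cast
  calc (n : ℝ) * (b₀ + 2 * T) ≤ n * (|b₂| * T + 2 * T) := by gcongr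
    _ = n * (|b₂| + 2) * T := by ring
    _ ≤ n * (|b₂| + 2) * ((c ^ 3 + 1) * η ^ 3) := by gcongr
    _ ≤ (n * (|b₂| + 2) * (c ^ 3 + 1) + 1) * η ^ 3 := by
      have : 0 ≤ η ^ 3 := by positivity
      linarith
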